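/- Let $N,k\in\mathbb N$ and let $V=\mathbb C[X_i^{(j)} : 0\le i\le N,\ j\ge 0]$ be the algebra of differential polynomials in $N+1$ variables. An invertible power series $\alpha\in\mathbb C[[T]]^\times$ acts on $V$ by the algebra map $X_i^{(m)}\mapsto\sum_{j=0}^m\binom mj\alpha^{(m-j)}(0)\,X_i^{(j)}$. A polynomial $P\in V$ is differentially homogeneous of degree $d$ if $\alpha\cdot P=\alpha(0)^dP$ for all $\alpha\in\mathbb C[[T]]^\times$; let $V^{\mathrm{Diff}}_d$ be the space of these, $V^{\mathrm{Diff}}=\bigoplus_d V^{\mathrm{Diff}}_d$, and let $(V^{\mathrm{Diff}})^{(k)}=V^{\mathrm{Diff}}\cap\mathbb C[X_i^{(j)}: j\le k]$. The order of $P$ is the largest $j$ such that some $X_i^{(j)}$ occurs in $P$. For $d\ge1$ let $\overline{\Sigma_d}$ be the set of sequences $\alpha=(\alpha_0,\dots,\alpha_N)$ of (possibly empty) tuples $\alpha_i=(\alpha_{i,1},\dots,\alpha_{i,r_i})$ of natural numbers such that, with $s_i:=r_0+\dots+r_i$: (a) $0\le\alpha_{i,1}<\dots<\alpha_{i,r_i}<s_i$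 whenever $r_i\ge1$; (b) $s_N=d$; (c) there is an $i$ with $r_i\ge1$, $\alpha_{i,1}=0$, with $\alpha_{i,r_i}<s_i-1$ if $r_i>1$, and with $\alpha_{j,r_j}<s_j-1$ for every $j>i$ with $r_j\ge1$. For such $\alpha$ let $W_\alpha$ be the $d\times d$ determinant with columns $$J^{\alpha_{0,1}}v_0,\dots,J^{\alpha_{0,r_0}}v_0,\ \dots,\ J^{\alpha_{N,1}}v_N,\dots,J^{\alpha_{N,r_N}}v_N,$$ where $v_i=(X_i^{(0)},\dots,X_i^{(d-1)})^{\top}$ and $J$ acts entrywise by $JX_i^{(j)}=jX_i^{(j-1)}$ (so $JX_i^{(0)}=0$). Put $\mathcal G_d=\{W_\alpha:\alpha\in\overline{\Sigma_d}\}$. Theorem. (1) The algebra $(V^{\mathrm{Diff}})^{(k)}$ is finitely generated, and $\mathcal G_1\cup\dots\cup\mathcal G_{k+1}$ is a minimal generating set of it (it generates, and no proper subset does). Here $|\mathcal G_1|=N+1$ and $|\mathcal G_i|=\frac{N(N+1)}2(N+1)^{i-2}$ for $2\le i\le k+1$, and the elements of $\mathcal G_i$ are differentially homogeneous of degree $i$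 and of order exactly $i-1$ for $1\le i\le k+1$. (2) Let $F$ be a $\mathbb C$-vector space of dimension $k+1$ with a nilpotent endomorphism $J$ such that $J^k\ne0$. Then $P\mapsto P(J)$ induces an isomorphism $(\mathbb C[T]/(T^{k+1}))^\times\simeq\mathbb C[J]^\times$, and $F$ has a basis $f_0,\dots,f_k$ with $Jf_0=0$ and $Jf_j=jf_{j-1}$ for $1\le j\le k$. Let $\mathbb C[J]^\times$ act diagonally on the symmetric algebra $S^\bullet(F^{\oplus(N+1)})$, and call $v$ quasi-invariant of degree $d$ if $P(J)\cdot v=P(0)^dv$ for all $P(J)\in\mathbb C[J]^\times$. For every such basis, the algebra of quasi-invariants (the sum over $d\in\mathbb N$ of the spaces of quasi-invariants of degree $d$) is finitely generated, and it is minimally generated by $\mathcal G_1\cup\dots\cup\mathcal G_{k+1}$, where $X_i^{(j)}$ now denotes the vector $f_j$ of the $i$-th copy of $F$ ($0\le i\le N$). The families have the same cardinalities as in (1), and the elements of $\mathcal G_i$ are non-zero quasi-invariants of degree $i$. -/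

import Mathlib

open MvPolynomial

noncomputable section

namespace DiffHom

/-- Differential polynomials in the variables `X_0, …, X_N`; the variable `X (i, j)` is the
formal derivative `X_i^{(j)}`. -/
abbrev V (N : ℕ) : Type := MvPolynomial (Fin (N + 1) × ℕ) ℂ

/-- The action of `α ∈ ℂ⟦T⟧ˣ` on differential polynomials: the algebra map substituting for
`X_i^{(k)}` the value at `T = 0` of the Leibniz expression
`∑_{j ≤ k} (k choose j) α^{(k - j)} X_i^{(j)}`. -/
def act {N : ℕ} (α : (PowerSeries ℂ)ˣ) : V N →ₐ[ℂ] V N :=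
  aeval fun p : Fin (N + 1) × ℕ =>
    ∑ j ∈ Finset.range (p.2 + 1),
      ((p.2.choose j : ℂ) *
        PowerSeries.constantCoeff ((PowerSeries.derivative ℂ)^[p.2 - j] (α : PowerSeries ℂ))) •
          (X (p.1, j) : V N)

/-- The space of differentially homogeneous polynomials of degree `d`. -/
def diffHom (N d : ℕ) : Submodule ℂ (V N) where
  carrier := {P | ∀ α : (PowerSeries ℂ)ˣ,
    act α P = (PowerSeries.constantCoeff (α : PowerSeries ℂ)) ^ d • P}
  add_mem' := by
    intro P Q hP hQ α
    rw [map_add, hP α, hQ α, smul_add]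
  zero_mem' := by
    intro α
    simp
  smul_mem' := by
    intro c P hP α
    rw [map_smul, hP α, smul_comm]

instance diffHom_gradedMonoid (N : ℕ) : SetLike.GradedMonoid (diffHom N) where
  one_mem := by
    intro α
    simp
  mul_mem := by
    intro i j P Q hP hQ α
    rw [map_mul, hP α, hQ α, smul_mul_smul_comm, pow_add]

/-- The algebra of differentially homogeneous polynomials: the sum of the spaces
`diffHom N d`, `d ∈ ℕ`. -/
def diffAlg (N : ℕ) : Subalgebra ℂ (V N) :=
  (DirectSum.coeAlgHom (diffHom N)).range

/-- The differential polynomials of order at most `k`. -/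
def orderLE (N k : ℕ) : Subalgebra ℂ (V N) :=
  supported ℂ {p : Fin (N + 1) × ℕ | p.2 ≤ k}

/-- The algebra of differentially homogeneous polynomials of order at most `k`. -/
def diffAlgLE (N k : ℕ) : Subalgebra ℂ (V N) :=
  diffAlg N ⊓ orderLE N k

/-- The order of a differential polynomial: the largest `j` such that some `X_i^{(j)}`
occurs in it. -/
def order {N : ℕ} (P : V N) : ℕ :=
  P.vars.sup Prod.snd

/-- `r_0 + ⋯ + r_i`, where `r_j` is the length of the `j`-th tuple. -/
def partialLength {N : ℕ} (α : Fin (N + 1) → List ℕ) (i : Fin (N + 1)) : ℕ :=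
  ∑ j ∈ Finset.Iic i, (α j).length

/-- The index set of the generators of degree `d`: sequences of (possibly empty) tuples
`α_0, …, α_N` of total length `d`, each one strictly increasing with entries less than
`r_0 + ⋯ + r_i`, with the additional condition `exists_head_zero`. -/
structure IsIndex {N : ℕ} (d : ℕ) (α : Fin (N + 1) → List ℕ) : Prop where
  increasing : ∀ i, (α i).Pairwise (· < ·)
  lt_partialLength : ∀ i, ∀ a ∈ α i, a < partialLength α i
  length_eq : ∑ i, (α i).length = d
  exists_head_zero : ∃ i, (α i).head? = some 0 ∧
    (1 < (α i).length → ∀ a ∈ (α i).getLast?, a + 1 < partialLength α i) ∧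
    ∀ j, i < j → ∀ a ∈ (α j).getLast?, a + 1 < partialLength α j

/-- The list of pairs `(i, α_{i,s})` in lexicographic order of `(i, s)`. -/
def columns {N : ℕ} (α : Fin (N + 1) → List ℕ) : List (Fin (N + 1) × ℕ) :=
  (List.finRange (N + 1)).flatMap fun i => (α i).map fun a => (i, a)

/-- Given elements `x i j` (playing the role of `X_i^{(j)}`) of a commutative algebra, the
determinant of the square matrix whose columns are the `J^a v_i`, for `(i, a)` in
`columns α`, where `v_i = (x i 0, x i 1, …)ᵀ` and `J` acts entrywise by
`J (x i j) = j • x i (j - 1)`, so that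
`J^a (x i j) = j (j - 1) ⋯ (j - a + 1) • x i (j - a)`, which is `0` for `a > j`. -/
def W {N : ℕ} {A : Type*} [CommRing A] (x : Fin (N + 1) → ℕ → A)
    (α : Fin (N + 1) → List ℕ) : A :=
  Matrix.det (Matrix.of fun j c : Fin (columns α).length =>
    (j : ℕ).descFactorial ((columns α).get c).2 •
      x ((columns α).get c).1 ((j : ℕ) - ((columns α).get c).2))

/-- The family of generators of degree `d`, written in the elements `x i j`. -/
def genFamily {N : ℕ} {A : Type*} [CommRing A] (x : Fin (N + 1) → ℕ → A) (d : ℕ) : Set A :=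
  {P | ∃ α : Fin (N + 1) → List ℕ, IsIndex d α ∧ P = W x α}

/-- The family `𝒢_d` of differentially homogeneous polynomials. -/
def G (N d : ℕ) : Set (V N) :=
  genFamily (fun i j => X (i, j)) d

/-- The number of generators of degree `d ≥ 1`. -/
def numGen (N d : ℕ) : ℕ :=
  if d = 1 then N + 1 else N * (N + 1) / 2 * (N + 1) ^ (d - 2)

section Invariants

variable {F : Type*} [AddCommGroup F] [Module ℂ F]

/-- The symmetric algebra of the direct sum of `N + 1` copies of `F`. -/
abbrev SymCopies (N : ℕ) (F : Type*) [AddCommGroup F] [Module ℂ F] : Type _ :=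
  SymmetricAlgebra ℂ (Fin (N + 1) → F)

/-- The diagonal action of an endomorphism of `F` on the symmetric algebra of
`N + 1` copies of `F`. -/
def symAct (N : ℕ) (g : Module.End ℂ F) : SymCopies N F →ₐ[ℂ] SymCopies N F :=
  SymmetricAlgebra.lift
    (SymmetricAlgebra.ι ℂ (Fin (N + 1) → F) ∘ₗ LinearMap.compLeft g (Fin (N + 1)))

/-- Quasi-invariants of degree `d` under `ℂ[J]ˣ`: the elements `v` such that
`P(J) · v = P(0)^d v` for every `P(J) ∈ ℂ[J]ˣ`. -/
def quasiInv (N : ℕ) (J : Module.End ℂ F) (d : ℕ) : Submodule ℂ (SymCopies N F) where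
  carrier := {v | ∀ (g : (Algebra.adjoin ℂ {J})ˣ) (P : Polynomial ℂ),
    Polynomial.aeval J P = ((g : Algebra.adjoin ℂ {J}) : Module.End ℂ F) →
      symAct N ((g : Algebra.adjoin ℂ {J}) : Module.End ℂ F) v = (P.eval 0) ^ d • v}
  add_mem' := by
    intro v w hv hw g P h
    rw [map_add, hv g P h, hw g P h, smul_add]
  zero_mem' := by
    intro g P h
    simp
  smul_mem' := by
    intro c v hv g P h
    rw [map_smul, hv g P h, smul_comm]

instance quasiInv_gradedMonoid (N : ℕ) (J : Module.End ℂ F) :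
    SetLike.GradedMonoid (quasiInv N J) where
  one_mem := by
    intro g P h
    simp
  mul_mem := by
    intro i j v w hv hw g P h
    rw [map_mul, hv g P h, hw g P h, smul_mul_smul_comm, pow_add]

/-- The algebra of quasi-invariants: the sum of the spaces `quasiInv N J d`, `d ∈ ℕ`. -/
def quasiInvAlg (N : ℕ) (J : Module.End ℂ F) : Subalgebra ℂ (SymCopies N F) :=
  (DirectSum.coeAlgHom (quasiInv N J)).range

/-- A basis `f_0, …, f_k` of `F` such that `J f_0 = 0` and `J f_j = j f_{j-1}` for `j ≥ 1`
(for `j = 0` the coefficient is `0`). -/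
def IsAdapted {k : ℕ} (J : Module.End ℂ F) (f : Module.Basis (Fin (k + 1)) ℂ F) : Prop :=
  ∀ j : Fin (k + 1), J (f j) = ((j : ℕ) : ℂ) • f (j - 1)

/-- The vector `f_j` of the `i`-th copy of `F`, as an element of the symmetric algebra
(`0` for `j > k`; such `j` do not occur in the generators of degree at most `k + 1`). -/
def copyVar (N : ℕ) {k : ℕ} (f : Module.Basis (Fin (k + 1)) ℂ F) (i : Fin (N + 1)) (j : ℕ) :
    SymCopies N F :=
  if h : j < k + 1 then SymmetricAlgebra.ι ℂ (Fin (N + 1) → F) (Pi.single i (f ⟨j, h⟩)) else 0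

end Invariants

end DiffHom

end

/-!
The order-`d` partial derivatives of a differentially homogeneous polynomial `P` of degree `d`
determine it. Taken along a fixed word of variables they form a function on exponents `ℕ^d`, and
invariance of `P` under the units `1 + zT` makes this function harmonic: it is killed by the
elementary symmetric polynomials in the shifts. For harmonic functions supported in `[0, k]^d`, the
relations of Tanisaki restrict the possible leading exponents, and every allowed one is attained by
a product of Vandermonde determinants of sizes at most `k + 1`. So these products span (as in the
work of Garsia and Procesi), and turning derivatives back into polynomials, `P` becomes a linear
combination of products of determinants with columns `J^a v_i`, of sizes at most `k + 1`. Such a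
determinant is itself harmonic as a function of the exponents `a`, which allows rewriting it, up to
multiples of some `X_i^{(0)}`, until the `a` satisfy the staircase conditions defining the index set
of the generators.

For minimality, consider the power series `∑_j X_i^{(j)} c^j T^j / j!`, on which the group acts by
scalars. The products of `d` of them, at nodes `c_1, …, c_d`, span a module whose limit at `T = 0`
consists of elements of degree `d`. For distinct nodes the limit is the whole space, of dimension
`(N + 1)^d`; as a decomposable element is a limit for any nodes split into two groups of distinct
ones, it is a limit for nodes with one coincidence, and the dimension drops accordingly. This bounds
the number of generators needed in degree `d` from below by the number of available ones.

Under `X_i^{(j)} ↦ f_j`, the action of `α` on polynomials of order at most `k` becomes that of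
`α(J)`, because `J` is the derivative of the basis `f_j` just as for `X_i^{(j)}`.
-/

noncomputable section

namespace DiffHom

section Harmonic

variable {ι M : Type*} [AddCommGroup M]

/-- The action on a function `φ` of exponents of the `r`-th elementary symmetric polynomial
`e_r(S)` in the shifts `φ ↦ φ(· + e_i)`, `i ∈ S`, of the coordinates in `S`. -/
def shiftSum (S : Finset ι) (r : ℕ) (φ : (ι → ℕ) → M) (a : ι → ℕ) : M :=
  ∑ T ∈ S.powersetCard r, φ (a + (T : Set ι).indicator 1)

/-- A function on exponents is harmonic if it is killed by all symmetric polynomials in the shifts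
without constant term. -/
def IsHarmonic [Fintype ι] (φ : (ι → ℕ) → M) : Prop :=
  ∀ r a, shiftSum Finset.univ (r + 1) φ a = 0

lemma shiftSum_zero (S : Finset ι) (φ : (ι → ℕ) → M) (a : ι → ℕ) :
    shiftSum S 0 φ a = φ a := by
  rw [shiftSum, Finset.powersetCard_zero, Finset.sum_singleton, Finset.coe_empty,
    Set.indicator_empty', add_zero]

lemma shiftSum_of_card_lt {S : Finset ι} {r : ℕ} (h : S.card < r) (φ : (ι → ℕ) → M)
    (a : ι → ℕ) : shiftSum S r φ a = 0 := by
  simp [shiftSum, Finset.powersetCard_eq_empty.2 h]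

lemma shiftSum_card (S : Finset ι) (φ : (ι → ℕ) → M) (a : ι → ℕ) :
    shiftSum S S.card φ a = φ (a + (S : Set ι).indicator 1) := by
  simp [shiftSum, Finset.powersetCard_self]

section DecidableEq

variable [DecidableEq ι]

lemma indicator_insert_one {i : ι} {T : Finset ι} (h : i ∉ T) :
    ((insert i T : Finset ι) : Set ι).indicator (1 : ι → ℕ) =
      Pi.single i 1 + (T : Set ι).indicator 1 := by
  funext j
  rcases eq_or_ne j i with rfl | hj
  · simp [h]
  · simp [Set.indicator_apply, hj]

lemma sub_single_add_single {a : ι → ℕ} {i : ι} {n : ℕ} (h : n ≤ a i) :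
    a - Pi.single i n + Pi.single i n = a := by
  refine tsub_add_cancel_of_le fun j => ?_
  rcases eq_or_ne j i with rfl | hj
  · simpa using h
  · simp [hj]

lemma shiftSum_insert {S : Finset ι} {i : ι} (h : i ∉ S) (r : ℕ) (φ : (ι → ℕ) → M)
    (a : ι → ℕ) : shiftSum (insert i S) (r + 1) φ a =
      shiftSum S (r + 1) φ a + shiftSum S r φ (a + Pi.single i 1) := by
  have notMem {n : ℕ} {T : Finset ι} (hT : T ∈ S.powersetCard n) : i ∉ T :=
    fun hi => h ((Finset.mem_powersetCard.1 hT).1 hi)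
  unfold shiftSum
  rw [Finset.powersetCard_succ_insert h, Finset.sum_union, Finset.sum_image]
  · congr 1
    refine Finset.sum_congr rfl fun T hT => ?_
    rw [indicator_insert_one (notMem hT), add_assoc]
  · intro T hT T' hT' hTT'
    rw [← Finset.erase_insert (notMem hT), ← Finset.erase_insert (notMem hT'), hTT']
  · rw [Finset.disjoint_left]
    rintro T hT hT'
    obtain ⟨T', -, rfl⟩ := Finset.mem_image.1 hT'
    exact notMem hT (Finset.mem_insert_self _ _)

lemma shiftSum_add_single {S : Finset ι} {i : ι} (h : i ∉ S) (r : ℕ) (φ : (ι → ℕ) → M)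
    (a : ι → ℕ) : shiftSum S r φ (a + Pi.single i 1) =
      shiftSum (insert i S) (r + 1) φ a - shiftSum S (r + 1) φ a := by
  rw [shiftSum_insert h, add_sub_cancel_left]

lemma shiftSum_succ {S : Finset ι} {i : ι} (h : i ∉ S) (r : ℕ) (φ : (ι → ℕ) → M)
    (a : ι → ℕ) : shiftSum S (r + 1) φ a =
      shiftSum (insert i S) (r + 1) φ a - shiftSum S r φ (a + Pi.single i 1) := by
  rw [shiftSum_insert h, add_sub_cancel_right]

/-- By `shiftSum_add_single`, lowering the exponent `a i` by one raises `r` by one. -/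
lemma shiftSum_eq_zero_of_le_apply {S : Finset ι} {i : ι} (hi : i ∉ S) {φ : (ι → ℕ) → M}
    {p : (ι → ℕ) → Prop} (hp : ∀ a, p (a + Pi.single i 1) → p a) (n : ℕ) {r : ℕ}
    (hinsert : ∀ s, r < s → ∀ a, p a → shiftSum (insert i S) s φ a = 0)
    (hS : ∀ a, p a → shiftSum S (r + n) φ a = 0) {a : ι → ℕ} (ha : p a) (hn : n ≤ a i) :
    shiftSum S r φ a = 0 := by
  induction n generalizing r a with
  | zero => exact hS a ha
  | succ n ih =>
    obtain ⟨a, rfl⟩ : ∃ a' : ι → ℕ, a = a' + Pi.single i 1 :=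
      ⟨_, (sub_single_add_single (by omega : 1 ≤ a i)).symm⟩
    rw [shiftSum_add_single hi, hinsert _ (Nat.lt_succ_self r) _ (hp a ha), zero_sub, neg_eq_zero]
    refine ih (fun s hs => hinsert s (by omega)) (fun a ha => ?_) (hp a ha) (by simpa using hn)
    rw [add_assoc, add_comm 1 n]
    exact hS a ha

/-- By `shiftSum_succ`, raising the exponent `a i` by one lowers `r` by one. -/
lemma shiftSum_eq_zero_of_apply_le {S : Finset ι} {i : ι} (hi : i ∉ S) {φ : (ι → ℕ) → M}
    {k n : ℕ} (hk : ∀ a, φ a ≠ 0 → a i ≤ k)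
    (hinsert : ∀ s, n < s → ∀ a, shiftSum (insert i S) s φ a = 0) {r : ℕ} (hr : n + k < r)
    (a : ι → ℕ) : shiftSum S r φ a = 0 := by
  suffices ∀ l r, n + l ≤ r → ∀ a, k + 1 ≤ a i + l → shiftSum S r φ a = 0 from
    this (k + 1) r hr a (by omega)
  intro l
  induction l with
  | zero =>
    intro r _ a ha
    refine Finset.sum_eq_zero fun T _ => ?_
    by_contra hne
    have := hk _ hne
    rw [Pi.add_apply] at this
    omega
  | succ l ih =>
    intro r hr a ha
    obtain ⟨r, rfl⟩ : ∃ s, r = s + 1 := ⟨r - 1, by omega⟩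
    rw [shiftSum_succ hi, hinsert _ (by omega), ih r (by omega) _ (by simp; omega), sub_zero]

end DecidableEq

lemma IsHarmonic.shiftSum_eq_zero [Fintype ι] {φ : (ι → ℕ) → M} (hφ : IsHarmonic φ) {k : ℕ}
    (hk : ∀ a, φ a ≠ 0 → ∀ i, a i ≤ k) {c : ℕ} {S : Finset ι}
    (hS : S.card + c = Fintype.card ι) {r : ℕ} (hr : c * k < r) (a : ι → ℕ) :
    shiftSum S r φ a = 0 := by
  classical
  induction c generalizing S r a with
  | zero =>
    obtain rfl : S = Finset.univ := by rwa [← Finset.card_eq_iff_eq_univ]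
    obtain ⟨r, rfl⟩ : ∃ s, r = s + 1 := ⟨r - 1, by omega⟩
    exact hφ r a
  | succ c ih =>
    obtain ⟨i, hi⟩ : ∃ i, i ∉ S := by
      by_contra! h
      rw [Finset.eq_univ_iff_forall.2 h, Finset.card_univ] at hS
      omega
    refine shiftSum_eq_zero_of_apply_le hi (fun a ha => hk a ha i) (fun s hs => ih ?_ hs)
      (by rwa [← add_one_mul]) a
    rw [Finset.card_insert_of_notMem hi]
    omega

end Harmonic

section Blocks

variable {d : ℕ}

/-- The number of indices among the first `m` that carry the label `h`. -/
def labelCount (p : Fin d → ℕ) (m h : ℕ) : ℕ :=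
  (Finset.univ.filter fun i : Fin d => (i : ℕ) < m ∧ p i = h).card

/-- The number of indices before `i` in the block of `i`; the blocks are the fibres of `p`. -/
def blockRank (p : Fin d → ℕ) (i : Fin d) : ℕ :=
  labelCount p i (p i)

lemma labelCount_zero (p : Fin d → ℕ) (h : ℕ) : labelCount p 0 h = 0 := by
  simp [labelCount]

lemma labelCount_self (p : Fin d → ℕ) (h : ℕ) :
    labelCount p d h = (Finset.univ.filter fun i => p i = h).card := by
  simp [labelCount]

lemma labelCount_mono (p : Fin d → ℕ) (h : ℕ) : Monotone fun m => labelCount p m h :=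
  fun _ _ hmn => Finset.card_le_card <| Finset.monotone_filter_right _
    fun _ _ hi => ⟨hi.1.trans_le hmn, hi.2⟩

lemma labelCount_congr {p q : Fin d → ℕ} {m : ℕ} (hpq : ∀ i : Fin d, (i : ℕ) < m → p i = q i)
    (h : ℕ) : labelCount p m h = labelCount q m h := by
  unfold labelCount
  congr 1
  refine Finset.filter_congr fun i _ => and_congr_right fun hi => ?_
  rw [hpq i hi]

lemma labelCount_succ (p : Fin d → ℕ) (i : Fin d) (h : ℕ) :
    labelCount p (i + 1) h = labelCount p i h + if p i = h then 1 else 0 := by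
  have hfilter : (Finset.univ.filter fun j : Fin d => (j : ℕ) < i + 1 ∧ p j = h) =
      (Finset.univ.filter fun j : Fin d => (j : ℕ) < i ∧ p j = h) ∪
        if p i = h then {i} else ∅ := by
    ext j
    rcases eq_or_ne j i with rfl | hj
    · split_ifs with hi <;> simp [hi]
    · have : (j : ℕ) ≠ i := Fin.val_ne_of_ne hj
      have : (j : ℕ) < i + 1 ↔ (j : ℕ) < i := by omega
      rw [Finset.mem_union, Finset.mem_filter, Finset.mem_filter, this]
      split_ifs <;> simp [hj]
  rw [labelCount, hfilter, Finset.card_union_of_disjoint, labelCount]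
  · split_ifs <;> rfl
  · split_ifs <;> simp

lemma labelCount_add_one (p : Fin d → ℕ) (i : Fin d) :
    labelCount p (i + 1) (p i) = blockRank p i + 1 := by
  rw [labelCount_succ, if_pos rfl, blockRank]

lemma blockRank_lt {p : Fin d → ℕ} {i j : Fin d} (hp : p i = p j) (h : i < j) :
    blockRank p i < blockRank p j := by
  rw [← Nat.add_one_le_iff, ← labelCount_add_one, hp]
  exact labelCount_mono p _ h

lemma eq_of_blockRank_eq {p : Fin d → ℕ} {i j : Fin d} (hp : p i = p j)
    (h : blockRank p i = blockRank p j) : i = j := by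
  rcases lt_trichotomy i j with hij | hij | hij
  · exact absurd h (blockRank_lt hp hij).ne
  · exact hij
  · exact absurd h (blockRank_lt hp.symm hij).ne'

lemma blockRank_lt_card (p : Fin d → ℕ) (i : Fin d) :
    blockRank p i < (Finset.univ.filter fun j => p j = p i).card := by
  rw [← Nat.add_one_le_iff, ← labelCount_add_one, ← labelCount_self]
  exact labelCount_mono p _ i.2

lemma exists_blockRank_add_one_eq {p : Fin d → ℕ} {i : Fin d} (h : blockRank p i ≠ 0) :
    ∃ j, p j = p i ∧ blockRank p j + 1 = blockRank p i := by
  obtain ⟨j, hj, hmax⟩ :=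
    (Finset.univ.filter fun j : Fin d => (j : ℕ) < i ∧ p j = p i).exists_max_image id
      (Finset.card_ne_zero.1 h)
  simp only [Finset.mem_filter, Finset.mem_univ, true_and, id] at hj hmax
  refine ⟨j, hj.2, ?_⟩
  rw [← labelCount_add_one, hj.2, blockRank, labelCount, labelCount]
  congr 1
  refine Finset.filter_congr fun l _ => and_congr_left fun hl => ⟨fun h => ?_, fun h => ?_⟩
  · exact (Nat.le_of_lt_succ h).trans_lt hj.1
  · exact Nat.lt_succ_of_le (hmax l ⟨h, hl⟩)

end Blocks

section Tanisaki

variable {d : ℕ} {M : Type*} [AddCommGroup M] {φ : (Fin d → ℕ) → M} {b : Fin d → ℕ}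
  {ρ : ℕ → ℕ}

/-- The first `m` coordinates. -/
def initSeg (d m : ℕ) : Finset (Fin d) := Finset.univ.filter fun i => (i : ℕ) < m

lemma mem_initSeg {m : ℕ} {i : Fin d} : i ∈ initSeg d m ↔ (i : ℕ) < m := by simp [initSeg]

lemma initSeg_succ (i : Fin d) : initSeg d (i + 1) = insert i (initSeg d i) := by
  ext j
  simp only [mem_initSeg, Finset.mem_insert, Fin.ext_iff]
  omega

lemma notMem_initSeg (i : Fin d) : i ∉ initSeg d i := by simp [mem_initSeg]

lemma initSeg_self (d : ℕ) : initSeg d d = Finset.univ := by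
  ext j; simp [mem_initSeg]

lemma card_initSeg {m : ℕ} (h : m ≤ d) : (initSeg d m).card = m := by
  rw [initSeg, Fin.card_filter_val_lt, min_eq_right h]

/-- The exponent `b` is the colexicographically largest one in the support of `φ`. -/
structure IsLeadingExponent (φ : (Fin d → ℕ) → M) (b : Fin d → ℕ) : Prop where
  ne_zero : φ b ≠ 0
  le : ∀ a, φ a ≠ 0 → toColex a ≤ toColex b

lemma IsLeadingExponent.eq_zero (hb : IsLeadingExponent φ b) {i : Fin d} {a : Fin d → ℕ}
    (ha : ∀ j, i < j → a j = b j) (hi : b i < a i) : φ a = 0 := by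
  by_contra hne
  exact absurd (Pi.apply_le_of_toColex (hb.le a hne) ha) (not_le.2 hi)

/-- `ρ 0 ≥ ρ 1 ≥ ⋯` are the row lengths, extended by zero, of a partition of an integer `≤ m`. -/
structure IsRowLengths (m : ℕ) (ρ : ℕ → ℕ) : Prop where
  antitone : Antitone ρ
  sum_le : ∀ c, ∑ h ∈ Finset.range c, ρ h ≤ m

/-- After freezing the coordinates `≥ m` at the values of `b`, the function `φ` is killed by the
generators `e_r(S)`, with `#S = m - c` and `r > ρ 0 + ⋯ + ρ (c - 1) - c`, of the Tanisaki ideal in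
the first `m` variables attached to the partition with columns of lengths `ρ h`. -/
def TanisakiVanish (φ : (Fin d → ℕ) → M) (b : Fin d → ℕ) (m : ℕ) (ρ : ℕ → ℕ) : Prop :=
  ∀ S ⊆ initSeg d m, ∀ c r, S.card + c = m → ∑ h ∈ Finset.range c, ρ h < r + c →
    ∀ a, (∀ i : Fin d, m ≤ i → a i = b i) → shiftSum S r φ a = 0

lemma TanisakiVanish.shiftSum_insert_eq_zero {i : Fin d} (H : TanisakiVanish φ b (i + 1) ρ)
    {S : Finset (Fin d)} (hS : S ⊆ initSeg d i) {c r : ℕ} (hc : S.card + c = i)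
    (hr : ∑ h ∈ Finset.range c, ρ h < r + c) {a : Fin d → ℕ} (ha : ∀ j, i < j → a j = b j) :
    shiftSum (insert i S) r φ a = 0 := by
  refine H _ ?_ c r ?_ hr a fun j hj => ha j (Fin.lt_def.2 hj)
  · rw [initSeg_succ]
    exact Finset.insert_subset_insert _ hS
  · rw [Finset.card_insert_of_notMem fun h => notMem_initSeg i (hS h)]
    omega

lemma TanisakiVanish.shiftSum_eq_zero {i : Fin d} (H : TanisakiVanish φ b (i + 1) ρ)
    {S : Finset (Fin d)} (hS : S ⊆ initSeg d i) {c r : ℕ} (hc : S.card + c = i)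
    (hr : ∑ h ∈ Finset.range c, ρ h = r + c) {a : Fin d → ℕ} (ha : ∀ j, i < j → a j = b j)
    (hi : ρ c ≤ a i) : shiftSum S r φ a = 0 := by
  refine shiftSum_eq_zero_of_le_apply (p := fun a => ∀ j, i < j → a j = b j)
    (fun h => notMem_initSeg i (hS h)) (fun a ha j hj => ?_) (ρ c) (fun s hs a ha => ?_)
    (fun a ha => ?_) ha hi
  · simpa [hj.ne'] using ha j hj
  · exact H.shiftSum_insert_eq_zero hS hc (by omega) ha
  · refine H S (fun j hj => ?_) (c + 1) _ (by omega) ?_ a fun j hj => ha j (Fin.lt_def.2 hj)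
    · rw [initSeg_succ]
      exact Finset.mem_insert_of_mem (hS hj)
    · rw [Finset.sum_range_succ]
      omega

lemma TanisakiVanish.exists_row {i : Fin d} (H : TanisakiVanish φ b (i + 1) ρ)
    (hρ : IsRowLengths (i + 1) ρ) (hb : φ b ≠ 0) : ∃ h, b i < ρ h ∧ ρ (h + 1) ≤ b i := by
  have hexists : ∃ h, ρ h ≤ b i := by
    by_contra! hlt
    have hcard : ∑ _h ∈ Finset.range (i + 2), 1 ≤ ∑ h ∈ Finset.range (i + 2), ρ h :=
      Finset.sum_le_sum fun h _ => (Nat.zero_le _).trans_lt (hlt h)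
    have := hρ.sum_le (i + 2)
    rw [Finset.sum_const, Finset.card_range, smul_eq_mul, mul_one] at hcard
    omega
  have hzero : Nat.find hexists ≠ 0 := by
    refine fun h0 => hb ?_
    have hle : ρ 0 ≤ b i := h0 ▸ Nat.find_spec hexists
    rw [← shiftSum_zero (initSeg d i) φ b]
    exact H.shiftSum_eq_zero subset_rfl (c := 0) (by rw [card_initSeg i.2.le, add_zero]) (by simp)
      (fun _ _ => rfl) hle
  obtain ⟨h, hh⟩ := Nat.exists_eq_succ_of_ne_zero hzero
  have hspec := Nat.find_spec hexists
  rw [hh] at hspec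
  exact ⟨h, not_le.1 (Nat.find_min hexists (by omega)), hspec⟩

lemma sum_range_sub_single {h : ℕ} (hpos : 0 < ρ h) (c : ℕ) :
    ∑ j ∈ Finset.range c, ρ j =
      ∑ j ∈ Finset.range c, (ρ - Pi.single h 1 : ℕ → ℕ) j + if h < c then 1 else 0 := by
  conv_lhs => rw [← sub_single_add_single (a := ρ) (i := h) (n := 1) hpos]
  simp only [Pi.add_apply, Finset.sum_add_distrib, Finset.sum_pi_single', Finset.mem_range]

lemma IsRowLengths.sub_single {m h : ℕ} (hρ : IsRowLengths (m + 1) ρ) (hh : ρ (h + 1) < ρ h) :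
    IsRowLengths m (ρ - Pi.single h 1) where
  antitone := antitone_nat_of_succ_le fun j => by
    have := hρ.antitone (Nat.le_succ j)
    rcases eq_or_ne j h with rfl | hj
    · simp only [Pi.sub_apply, Pi.single_eq_same, Pi.single_eq_of_ne (Nat.succ_ne_self j)]
      omega
    · rw [Pi.sub_apply, Pi.sub_apply, Pi.single_eq_of_ne hj]
      exact (Nat.sub_le _ _).trans this
  sum_le c := by
    have hc := sum_range_sub_single (Nat.zero_lt_of_lt hh) c
    have hh' := sum_range_sub_single (Nat.zero_lt_of_lt hh) (h + 1)
    have := hρ.sum_le c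
    have := hρ.sum_le (h + 1)
    split_ifs at hc with hlt
    · omega
    · have : ∑ j ∈ Finset.range c, (ρ - Pi.single h 1 : ℕ → ℕ) j ≤
          ∑ j ∈ Finset.range (h + 1), (ρ - Pi.single h 1 : ℕ → ℕ) j :=
        Finset.sum_le_sum_of_subset (Finset.range_subset_range.2 (by omega))
      rw [if_pos (Nat.lt_succ_self h)] at hh'
      omega

lemma TanisakiVanish.sub_single {i : Fin d} (H : TanisakiVanish φ b (i + 1) ρ)
    (hρ : Antitone ρ) (hb : IsLeadingExponent φ b) {h : ℕ} (hlt : b i < ρ h)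
    (hle : ρ (h + 1) ≤ b i) : TanisakiVanish φ b i (ρ - Pi.single h 1) := by
  intro S hS c r hc hr a ha
  have ha' : ∀ j, i < j → a j = b j := fun j hj => ha j hj.le
  have hsum := sum_range_sub_single (Nat.zero_lt_of_lt hlt) c
  rcases lt_or_ge (∑ j ∈ Finset.range c, ρ j) (r + c) with hr' | hr'
  · have hinsert := H.shiftSum_insert_eq_zero hS hc hr' ha'
    cases r with
    | zero => rwa [shiftSum_zero] at hinsert ⊢
    | succ r =>
      rw [shiftSum_succ fun h => notMem_initSeg i (hS h), hinsert, zero_sub, neg_eq_zero]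
      refine Finset.sum_eq_zero fun T hT => hb.eq_zero (i := i) (fun j hj => ?_) ?_
      · have hjT : j ∉ T := fun hjT => by
          have := mem_initSeg.1 (hS ((Finset.mem_powersetCard.1 hT).1 hjT))
          exact absurd this (not_lt.2 (Fin.le_def.1 hj.le))
        simp [hjT, hj.ne', ha' j hj]
      · simp only [Pi.add_apply, Pi.single_eq_same, ha i le_rfl]
        omega
  · split_ifs at hsum with hhc
    · exact H.shiftSum_eq_zero hS hc (by omega) ha'
        ((hρ hhc).trans (hle.trans (ha i le_rfl).ge))
    · omega

lemma TanisakiVanish.exists_labels (hb : IsLeadingExponent φ b) {m : ℕ} (hm : m ≤ d)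
    (hρ : IsRowLengths m ρ) (H : TanisakiVanish φ b m ρ) :
    ∃ p : Fin d → ℕ, (∀ i : Fin d, (i : ℕ) < m → b i ≤ blockRank p i) ∧
      ∀ h, labelCount p m h = ρ h := by
  induction m generalizing ρ with
  | zero =>
    refine ⟨0, by simp, fun h => ?_⟩
    have := hρ.sum_le (h + 1)
    rw [Finset.sum_range_succ] at this
    rw [labelCount_zero]
    omega
  | succ m ih =>
    set i : Fin d := ⟨m, hm⟩
    obtain ⟨h, hlt, hle⟩ := TanisakiVanish.exists_row (i := i) H hρ hb.ne_zero
    obtain ⟨p, hp, hcount⟩ := ih (Nat.le_of_succ_le hm) (hρ.sub_single (hle.trans_lt hlt))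
      (TanisakiVanish.sub_single (i := i) H hρ.antitone hb hlt hle)
    set q := Function.update p i h
    have hqp : ∀ j : Fin d, (j : ℕ) < m → q j = p j := fun j hj =>
      Function.update_of_ne (by rintro rfl; exact lt_irrefl m hj) _ _
    have hqi : q i = h := Function.update_self ..
    refine ⟨q, fun j hj => ?_, fun h' => ?_⟩
    · rcases Nat.lt_succ_iff_lt_or_eq.1 hj with hj | hj
      · rw [blockRank, labelCount_congr fun l hl => hqp l (hl.trans hj), hqp j hj]
        exact hp j hj
      · obtain rfl : j = i := Fin.ext hj
        rw [blockRank, labelCount_congr hqp, hcount, hqi, Pi.sub_apply, Pi.single_eq_same]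
        omega
    · have hsucc := labelCount_succ q i h'
      rw [labelCount_congr hqp, hcount, hqi] at hsucc
      rw [hsucc]
      conv_rhs => rw [← sub_single_add_single (a := ρ) (Nat.one_le_of_lt hlt)]
      simp only [Pi.add_apply, Pi.single_apply, eq_comm]

/-- The row lengths of the partition of `d` with all rows of length `k + 1`, except the last. -/
def rowLength (d k h : ℕ) : ℕ := min d ((h + 1) * (k + 1)) - min d (h * (k + 1))

lemma rowLength_le (d k h : ℕ) : rowLength d k h ≤ k + 1 := by
  have := add_one_mul h (k + 1)
  unfold rowLength
  omega

lemma sum_rowLength (d k c : ℕ) :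
    ∑ h ∈ Finset.range c, rowLength d k h = min d (c * (k + 1)) := by
  induction c with
  | zero => simp
  | succ c ih =>
    have := add_one_mul c (k + 1)
    rw [Finset.sum_range_succ, ih, rowLength]
    omega

lemma isRowLengths_rowLength (d k : ℕ) : IsRowLengths d (rowLength d k) where
  antitone := antitone_nat_of_succ_le fun h => by
    have hmul := add_one_mul h (k + 1)
    have hmul_succ := add_one_mul (h + 1) (k + 1)
    unfold rowLength
    omega
  sum_le c := (sum_rowLength d k c).trans_le (min_le_left _ _)

lemma IsHarmonic.tanisakiVanish {k : ℕ} (hφ : IsHarmonic φ)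
    (hk : ∀ a, φ a ≠ 0 → ∀ i, a i ≤ k) (b : Fin d → ℕ) :
    TanisakiVanish φ b d (rowLength d k) := by
  intro S _ c r hc hr a _
  rw [sum_rowLength] at hr
  have := mul_add_one c k
  rcases min_lt_iff.1 hr with h | h
  · exact shiftSum_of_card_lt (by omega) _ _
  · exact hφ.shiftSum_eq_zero hk (hc.trans (Fintype.card_fin d).symm) (by omega) a

/-- The labels `h` with `rowLength d k h ≠ 0` cut `Fin d` into blocks of size `k + 1`, except the
last one. -/
def IsPacked (k : ℕ) (p : Fin d → ℕ) : Prop :=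
  ∀ h, (Finset.univ.filter fun i => p i = h).card = rowLength d k h

lemma IsPacked.blockRank_le {k : ℕ} {p : Fin d → ℕ} (hp : IsPacked k p) (i : Fin d) :
    blockRank p i ≤ k :=
  Nat.lt_succ_iff.1 <| (blockRank_lt_card p i).trans_le <| (hp _).trans_le (rowLength_le d k _)

theorem IsHarmonic.exists_isPacked {k : ℕ} (hφ : IsHarmonic φ)
    (hk : ∀ a, φ a ≠ 0 → ∀ i, a i ≤ k) (hb : IsLeadingExponent φ b) :
    ∃ p : Fin d → ℕ, IsPacked k p ∧ b ≤ blockRank p := by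
  obtain ⟨p, hp, hcount⟩ := TanisakiVanish.exists_labels hb le_rfl (isRowLengths_rowLength d k)
    (hφ.tanisakiVanish hk b)
  exact ⟨p, fun h => (labelCount_self p h).symm.trans (hcount h), fun i => hp i i.2⟩

end Tanisaki

section Straightening

variable {d : ℕ} {M : Type*} [AddCommGroup M] {ψ : (Fin d → ℕ) → M} {Q : AddSubgroup M}

lemma IsHarmonic.shiftSum_initSeg_mem (hψ : IsHarmonic ψ) (t : ℕ) {m : ℕ} (hm : m + t = d) (s : ℕ)
    {a : Fin d → ℕ}
    (h : ∀ b : Fin d → ℕ, (∀ i : Fin d, (i : ℕ) < m → b i = 0) → ∑ i, b i = s → ψ (a + b) ∈ Q) :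
    shiftSum (initSeg d m) s ψ a ∈ Q := by
  induction t generalizing m s a with
  | zero =>
    obtain rfl : m = d := hm
    cases s with
    | zero => simpa only [shiftSum_zero, add_zero] using h 0 (by simp) (by simp)
    | succ s =>
      rw [initSeg_self, hψ s a]
      exact Q.zero_mem
  | succ t iht =>
    obtain ⟨i, rfl⟩ : ∃ i : Fin d, (i : ℕ) = m := ⟨⟨m, by omega⟩, rfl⟩
    induction s generalizing a with
    | zero => simpa only [shiftSum_zero, add_zero] using h 0 (by simp) (by simp)
    | succ s ihs =>
      rw [shiftSum_succ (notMem_initSeg i), ← initSeg_succ]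
      refine Q.sub_mem (iht (by omega) _ fun b hb => h b fun j hj => hb j (by omega))
        (ihs fun b hb hs => ?_)
      rw [add_assoc]
      refine h _ (fun j hj => ?_) ?_
      · have : j ≠ i := by rintro rfl; exact lt_irrefl _ hj
        simp [this, hb j hj]
      · simp [Finset.sum_add_distrib, hs, add_comm]

lemma IsHarmonic.mem_of_shiftSum_mem (hψ : IsHarmonic ψ) {l : Fin d} {r : ℕ} {a : Fin d → ℕ}
    (h : shiftSum (initSeg d l) r ψ a ∈ Q)
    (hlt : ∀ c < r, ∀ b : Fin d → ℕ, (∀ i ≤ l, b i = 0) → ψ (a + Pi.single l c + b) ∈ Q) :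
    ψ (a + Pi.single l r) ∈ Q := by
  induction r generalizing a with
  | zero => simpa only [shiftSum_zero, Pi.single_zero, add_zero] using h
  | succ r ih =>
    have hsingle (c : ℕ) : a + Pi.single l (c + 1) = a + Pi.single l 1 + Pi.single l c := by
      rw [add_assoc, ← Pi.single_add, add_comm 1 c]
    rw [hsingle]
    refine ih ?_ fun c hc b hb => ?_
    · rw [shiftSum_add_single (notMem_initSeg l), ← initSeg_succ]
      refine Q.sub_mem (hψ.shiftSum_initSeg_mem (d - (l + 1)) (by omega) _ fun b hb _ => ?_) h
      simpa using hlt 0 (by omega) b fun i hi => hb i (Nat.lt_succ_of_le hi)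
    · rw [← hsingle]
      exact hlt (c + 1) (by omega) b hb

lemma IsHarmonic.mem_of_lex (hψ : IsHarmonic ψ) {l : Fin d} {r : ℕ} {a : Fin d → ℕ}
    (hr : r ≤ a l) (h : shiftSum (initSeg d l) r ψ (a - Pi.single l r) ∈ Q)
    (hlt : ∀ a' : Fin d → ℕ, toLex a' < toLex a → ψ a' ∈ Q) : ψ a ∈ Q := by
  rw [← sub_single_add_single hr]
  refine hψ.mem_of_shiftSum_mem h fun c hc b hb => hlt _ ⟨l, fun i hi => ?_, ?_⟩
  · simp [hi.ne, hb i hi.le]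
  · have := hb l le_rfl
    simp only [Pi.toLex_apply, Pi.add_apply, Pi.sub_apply, Pi.single_eq_same, this]
    omega

lemma IsHarmonic.mem_of_lt_apply (hψ : IsHarmonic ψ) {l : Fin d} {a : Fin d → ℕ}
    (hl : (l : ℕ) < a l) (hlt : ∀ a' : Fin d → ℕ, toLex a' < toLex a → ψ a' ∈ Q) : ψ a ∈ Q := by
  refine hψ.mem_of_lex hl ?_ hlt
  rw [shiftSum_of_card_lt (by rw [card_initSeg l.2.le]; omega)]
  exact Q.zero_mem

lemma IsHarmonic.mem_of_apply_eq (hψ : IsHarmonic ψ) {l : Fin d} {a : Fin d → ℕ} (hl : a l = l)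
    (h : ψ (a - Pi.single l (l : ℕ) + (initSeg d l : Set (Fin d)).indicator 1) ∈ Q)
    (hlt : ∀ a' : Fin d → ℕ, toLex a' < toLex a → ψ a' ∈ Q) : ψ a ∈ Q := by
  refine hψ.mem_of_lex hl.ge ?_ hlt
  have hcard := shiftSum_card (initSeg d l) ψ (a - Pi.single l (l : ℕ))
  rw [card_initSeg l.2.le] at hcard
  rwa [hcard]

lemma IsHarmonic.mem_of_lex_staircase (hψ : IsHarmonic ψ)
    (h : ∀ a : Fin d → ℕ, (∀ i, a i ≤ i) →
      (∀ a' : Fin d → ℕ, toLex a' < toLex a → ψ a' ∈ Q) → ψ a ∈ Q) (a : Fin d → ℕ) :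
    ψ a ∈ Q := by
  suffices ∀ a : Lex (Fin d → ℕ), ψ (ofLex a) ∈ Q from this (toLex a)
  intro a
  induction a using WellFoundedLT.induction with
  | ind a ih =>
    by_cases ha : ∀ i, ofLex a i ≤ i
    · exact h _ ha fun a' => ih (toLex a')
    · push Not at ha
      obtain ⟨l, hl⟩ := ha
      exact hψ.mem_of_lt_apply hl fun a' => ih (toLex a')

theorem IsHarmonic.mem_of_staircase (hψ : IsHarmonic ψ)
    (h : ∀ a : Fin d → ℕ, (∀ i, a i ≤ i) → ψ a ∈ Q) (a : Fin d → ℕ) : ψ a ∈ Q :=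
  hψ.mem_of_lex_staircase (fun a ha _ => h a ha) a

lemma exists_last_zero {a : Fin d → ℕ} (h : ∃ i, a i = 0) :
    ∃ i, a i = 0 ∧ ∀ j, i < j → a j ≠ 0 := by
  obtain ⟨i, hi, hmax⟩ := Set.exists_max_image {i | a i = 0} id (Set.toFinite _) h
  exact ⟨i, hi, fun j hij hj => absurd (hmax j hj) (not_le.2 hij)⟩

theorem IsHarmonic.mem_of_refined_staircase (hψ : IsHarmonic ψ)
    (hzeros : ∀ a : Fin d → ℕ, (∀ i j, a i = 0 → a j = 0 → i = j) → ψ a ∈ Q)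
    (hstair : ∀ (a : Fin d → ℕ) (i : Fin d), (∀ l, a l ≤ l) → a i = 0 → (∀ j, i < j → a j < j) →
      ψ a ∈ Q) (a : Fin d → ℕ) : ψ a ∈ Q := by
  refine hψ.mem_of_lex_staircase (fun a ha hlt => ?_) a
  by_cases hzero : ∃ i, a i = 0
  swap
  · exact hzeros a fun i _ hi => absurd ⟨i, hi⟩ hzero
  obtain ⟨i, hi, hlast⟩ := exists_last_zero hzero
  by_cases hstrict : ∀ j, i < j → a j < j
  · exact hstair a i ha hi hstrict
  push Not at hstrict
  obtain ⟨j, hij, hj⟩ := hstrict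
  refine hψ.mem_of_apply_eq (le_antisymm (ha j) hj) (hzeros _ ?_) hlt
  suffices honly : ∀ l,
      (a - Pi.single j (j : ℕ) + (initSeg d j : Set (Fin d)).indicator 1 : Fin d → ℕ) l = 0 →
        l = j from fun l l' hl hl' => (honly l hl).trans (honly l' hl').symm
  intro l hl
  by_contra hne
  rcases lt_or_gt_of_ne hne with hlj | hlj
  · simp [mem_initSeg, hlj] at hl
  · have := hlast l (hij.trans hlj)
    simp only [Pi.add_apply, Pi.sub_apply, Pi.single_eq_of_ne hne] at hl
    omega

end Straightening

section Determinants

open scoped Polynomial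

lemma multilinearMap_add_smul {R ι M M' : Type*} [CommSemiring R] [AddCommMonoid M] [Module R M]
    [AddCommMonoid M'] [Module R M'] [Fintype ι] [DecidableEq ι]
    (f : MultilinearMap R (fun _ : ι => M) M') (t : R) (u v : ι → M) :
    f (u + t • v) = ∑ T : Finset ι, t ^ T.card • f (T.piecewise v u) := by
  rw [add_comm, f.map_add_univ]
  refine Finset.sum_congr rfl fun T _ => ?_
  rw [← Finset.prod_const, ← f.map_piecewise_smul]
  congr 1
  funext i
  by_cases hi : i ∈ T <;> simp [hi]

lemma coeff_sum_X_pow_card_mul_C {ι A : Type*} [Fintype ι] [Semiring A] (f : Finset ι → A)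
    (r : ℕ) : (∑ T : Finset ι, Polynomial.X ^ T.card * Polynomial.C (f T)).coeff r =
      ∑ T ∈ Finset.powersetCard r Finset.univ, f T := by
  have hfilter : Finset.powersetCard r (Finset.univ : Finset ι) =
      Finset.univ.filter fun T => r = T.card := by
    ext T
    simp [Finset.mem_powersetCard, eq_comm]
  simp only [Polynomial.finsetSum_coeff, Polynomial.coeff_mul_C, Polynomial.coeff_X_pow, ite_mul,
    one_mul, zero_mul]
  rw [hfilter, Finset.sum_filter]

variable {n A : Type*} [Fintype n] [CommRing A]

lemma det_C_add_X_mul_C [DecidableEq n] (u v : n → n → A) :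
    (Matrix.of fun i j => Polynomial.C (u i j) + Polynomial.X * Polynomial.C (v i j)).det =
      ∑ T : Finset n, Polynomial.X ^ T.card * Polynomial.C (Matrix.of (T.piecewise v u)).det := by
  refine (multilinearMap_add_smul (Matrix.detRowAlternating (n := n) (R := A[X])).toMultilinearMap
    Polynomial.X (fun i j => Polynomial.C (u i j)) fun i j => Polynomial.C (v i j)).trans
    (Finset.sum_congr rfl fun T _ => ?_)
  rw [smul_eq_mul, RingHom.map_det]
  refine congrArg (Polynomial.X ^ T.card * Matrix.det ·) ?_
  ext1 i j
  by_cases hi : i ∈ T <;> simp [hi]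

variable [LinearOrder n]

lemma det_one_add_X_smul {B : Matrix n n A} (hB : ∀ i j, i ≤ j → B i j = 0) :
    (1 + (Polynomial.X : A[X]) • B.map Polynomial.C).det = 1 := by
  rw [Matrix.det_of_isLowerTriangular]
  · exact Finset.prod_eq_one fun i _ => by simp [hB i i le_rfl]
  · intro i j hij
    have hij : i < j := hij
    simp [hB i j hij.le, hij.ne]

/-- Since `1 + X B` is unipotent, the determinant with columns `c l (a l) + X c l (a l + 1)` does
not depend on `X`; the coefficients of its expansion are the sums to be shown to vanish. -/
theorem isHarmonic_det (c : n → ℕ → n → A) (B : Matrix n n A)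
    (hB : ∀ i j, i ≤ j → B i j = 0) (hc : ∀ l s, c l (s + 1) = B.mulVec (c l s)) :
    IsHarmonic fun a : n → ℕ => Matrix.det (Matrix.of fun i l => c l (a l) i) := by
  intro r a
  set M : Matrix n n A := Matrix.of fun l => c l (a l)
  set M' : Matrix n n A := Matrix.of fun l => c l (a l + 1)
  have hM' : M' = M * B.transpose := by
    ext l i
    simp [M, M', hc, Matrix.mul_apply, Matrix.mulVec, dotProduct, mul_comm]
  have hdet :
      (Matrix.of fun l i => Polynomial.C (M l i) + Polynomial.X * Polynomial.C (M' l i)).det =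
        Polynomial.C M.det := by
    have hfactor :
        (Matrix.of fun l i => Polynomial.C (M l i) + Polynomial.X * Polynomial.C (M' l i)) =
          M.map Polynomial.C * (1 + (Polynomial.X : A[X]) • B.map Polynomial.C).transpose := by
      rw [Matrix.transpose_add, Matrix.transpose_one, Matrix.transpose_smul, mul_add, mul_one,
        Matrix.mul_smul, hM', ← Matrix.transpose_map, ← Matrix.map_mul]
      rfl
    rw [hfactor, Matrix.det_mul, Matrix.det_transpose, det_one_add_X_smul hB, mul_one,
      RingHom.map_det, RingHom.mapMatrix_apply]
  have hcoeff := congrArg (fun q => q.coeff (r + 1)) ((det_C_add_X_mul_C M M').symm.trans hdet)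
  rw [coeff_sum_X_pow_card_mul_C, Polynomial.coeff_C_succ] at hcoeff
  refine Eq.trans (Finset.sum_congr rfl fun T _ => ?_) hcoeff
  rw [← Matrix.det_transpose]
  refine congrArg Matrix.det (Matrix.ext fun i l => ?_)
  change _ = T.piecewise (fun l => c l (a l + 1)) (fun l => c l (a l)) l i
  by_cases hl : l ∈ T <;> simp [hl]

end Determinants

section BlockDeterminants

variable {κ A : Type*} [CommRing A] {d : ℕ}

/-- The determinant of the block diagonal matrix with blocks the fibres of `p` and with column `l`,
in its block, equal to `J^(a l) v_(w l)`, where `v_i = (x i 0, x i 1, …)ᵀ` and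
`J (x i j) = j • x i (j - 1)`. -/
def blockDet (x : κ → ℕ → A) (p : Fin d → ℕ) (w : Fin d → κ) (a : Fin d → ℕ) : A :=
  Matrix.det (Matrix.of fun i l : Fin d => if p i = p l then
    (blockRank p i).descFactorial (a l) • x (w l) (blockRank p i - a l) else 0)

/-- The case of a single block: the determinant with columns `J^(a l) v_(w l)`. -/
def colDet (x : κ → ℕ → A) (w : Fin d → κ) (a : Fin d → ℕ) : A :=
  Matrix.det (Matrix.of fun j l : Fin d => (j : ℕ).descFactorial (a l) • x (w l) (j - a l))

lemma blockRank_const (h : ℕ) (i : Fin d) : blockRank (fun _ => h) i = i := by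
  simp only [blockRank, labelCount, and_true, Fin.card_filter_val_lt, min_eq_right i.2.le]

lemma blockDet_const (x : κ → ℕ → A) (h : ℕ) (w : Fin d → κ) (a : Fin d → ℕ) :
    blockDet x (fun _ => h) w a = colDet x w a := by
  simp only [blockDet, colDet, blockRank_const, if_true]

theorem isHarmonic_blockDet (x : κ → ℕ → A) (p : Fin d → ℕ) (w : Fin d → κ) :
    IsHarmonic (blockDet x p w) := by
  refine isHarmonic_det
    (fun l s i => if p i = p l then (blockRank p i).descFactorial s • x (w l) (blockRank p i - s)
      else 0)
    (Matrix.of fun i j => if p i = p j ∧ blockRank p i = blockRank p j + 1 then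
      (blockRank p i : A) else 0) (fun i j hij => if_neg ?_) fun l s => funext fun i => ?_
  · rintro ⟨hp, hrank⟩
    rcases hij.lt_or_eq with h | rfl
    · have := blockRank_lt hp h
      omega
    · omega
  simp only [Matrix.mulVec, dotProduct, Matrix.of_apply]
  rcases hi : blockRank p i with - | m
  · simp
  obtain ⟨j, hpj, hj⟩ := exists_blockRank_add_one_eq (p := p) (i := i) (by omega)
  obtain rfl : blockRank p j = m := by omega
  rw [Finset.sum_eq_single j]
  · have hentry : p i = p j ∧ blockRank p j + 1 = blockRank p j + 1 := ⟨hpj.symm, rfl⟩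
    rw [if_pos hentry, hpj, mul_ite, mul_zero, Nat.succ_descFactorial_succ,
      Nat.add_sub_add_right, mul_smul, nsmul_eq_mul]
  · intro j' _ hj'
    rw [if_neg, zero_mul]
    rintro ⟨hpj', hrank⟩
    exact hj' (eq_of_blockRank_eq (hpj'.symm.trans hpj.symm) (by omega))
  · simp

theorem isHarmonic_colDet (x : κ → ℕ → A) (w : Fin d → κ) : IsHarmonic (colDet x w) := by
  simpa only [funext (blockDet_const x 0 w)] using isHarmonic_blockDet x (fun _ => 0) w

end BlockDeterminants

section BlockVandermonde

variable {d : ℕ}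

/-- Up to the factor `∏ l, (a l)!`, the coefficient of `∏ l, t_l ^ (a l)` in the product of the
derivatives `∂^c` of the Vandermonde determinants of the blocks of `p`. -/
def blockVandermonde (A : Type*) [CommRing A] (p c a : Fin d → ℕ) : A :=
  Matrix.det (Matrix.of fun i l : Fin d =>
    if p i = p l ∧ blockRank p i = a l + c l then ((blockRank p i).factorial : A) else 0)

section CommRing

variable {A : Type*} [CommRing A]

lemma descFactorial_smul_ite (m n : ℕ) :
    n.descFactorial m • (if n - m = 0 then (1 : A) else 0) =
      if n = m then (n.factorial : A) else 0 := by
  rcases lt_trichotomy n m with h | rfl | h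
  · rw [Nat.descFactorial_of_lt h, zero_smul, if_neg h.ne]
  · simp [Nat.descFactorial_self]
  · rw [if_neg (Nat.sub_ne_zero_of_lt h), if_neg h.ne', smul_zero]

lemma blockVandermonde_eq_blockDet (p c a : Fin d → ℕ) :
    blockVandermonde A p c a =
      blockDet (fun (_ : Unit) j => if j = 0 then 1 else 0) p (fun _ => ()) (a + c) := by
  simp only [blockVandermonde, blockDet, descFactorial_smul_ite, ite_and, Pi.add_apply]

lemma isHarmonic_blockVandermonde (p c : Fin d → ℕ) : IsHarmonic (blockVandermonde A p c) := by
  intro r a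
  have h := isHarmonic_blockDet (fun (_ : Unit) j => if j = 0 then (1 : A) else 0) p
    (fun _ => ()) r (a + c)
  simpa only [shiftSum, blockVandermonde_eq_blockDet, add_right_comm] using h

lemma exists_perm_of_blockVandermonde_ne_zero {p c a : Fin d → ℕ}
    (h : blockVandermonde A p c a ≠ 0) :
    ∃ σ : Equiv.Perm (Fin d), ∀ l, p (σ l) = p l ∧ blockRank p (σ l) = a l + c l := by
  rw [blockVandermonde, Matrix.det_apply] at h
  obtain ⟨σ, -, hσ⟩ := Finset.exists_ne_zero_of_sum_ne_zero h
  refine ⟨σ, fun l => ?_⟩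
  by_contra hl
  refine hσ ?_
  rw [Finset.prod_eq_zero (Finset.mem_univ l) (by rw [Matrix.of_apply, if_neg hl]), smul_zero]

lemma le_of_blockVandermonde_ne_zero {p c a : Fin d → ℕ} {k : ℕ} (hp : ∀ i, blockRank p i ≤ k)
    (h : blockVandermonde A p c a ≠ 0) (i : Fin d) : a i ≤ k := by
  obtain ⟨σ, hσ⟩ := exists_perm_of_blockVandermonde_ne_zero h
  exact (Nat.le_add_right _ _).trans ((hσ i).2.symm.trans_le (hp _))

lemma toColex_le_of_blockVandermonde_ne_zero {p c a b : Fin d → ℕ} (hb : b + c = blockRank p)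
    (h : blockVandermonde A p c a ≠ 0) : toColex a ≤ toColex b := by
  obtain ⟨σ, hσ⟩ := exists_perm_of_blockVandermonde_ne_zero h
  by_contra hlt
  obtain ⟨i, hi, hlt⟩ : ∃ i : Fin d, (∀ j, i < j → b j = a j) ∧ b i < a i := not_le.1 hlt
  have hbc (j : Fin d) : b j + c j = blockRank p j := congrFun hb j
  have hfix : ∀ j, i < j → σ j = j := fun j hj =>
    eq_of_blockRank_eq (hσ j).1 (by rw [(hσ j).2, ← hi j hj, hbc])
  have hle : σ i ≤ i := by
    by_contra! hσi
    exact hσi.ne' (σ.injective (hfix _ hσi))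
  have hrank : blockRank p (σ i) ≤ blockRank p i := by
    rcases hle.lt_or_eq with h | h
    · exact (blockRank_lt (hσ i).1 h).le
    · rw [h]
  have := hbc i
  have := (hσ i).2
  omega

lemma blockVandermonde_of_add_eq {p c a : Fin d → ℕ} (h : a + c = blockRank p) :
    blockVandermonde A p c a = ∏ i, ((blockRank p i).factorial : A) := by
  rw [blockVandermonde, ← Matrix.det_diagonal]
  congr 1
  ext i l
  rw [Matrix.of_apply, ← Pi.add_apply, h, Matrix.diagonal_apply]
  refine if_congr ⟨fun h => eq_of_blockRank_eq h.1 h.2, ?_⟩ rfl rfl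
  rintro rfl
  exact ⟨rfl, rfl⟩

lemma isLeadingExponent_blockVandermonde [IsDomain A] [CharZero A] {p c b : Fin d → ℕ}
    (h : b + c = blockRank p) : IsLeadingExponent (blockVandermonde A p c) b where
  ne_zero := by
    rw [blockVandermonde_of_add_eq h]
    exact Finset.prod_ne_zero_iff.2 fun i _ => Nat.cast_ne_zero.2 (Nat.factorial_ne_zero _)
  le _ := toColex_le_of_blockVandermonde_ne_zero h

end CommRing

section Span

variable {K : Type*} [Field K]

lemma exists_isLeadingExponent {φ : (Fin d → ℕ) → K} (hfin : φ.support.Finite) (hφ : φ ≠ 0) :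
    ∃ b, IsLeadingExponent φ b := by
  obtain ⟨b, hb, hmax⟩ := Set.exists_max_image _ toColex hfin (Function.support_nonempty_iff.2 hφ)
  exact ⟨b, hb, hmax⟩

lemma IsLeadingExponent.toColex_lt {φ ψ : (Fin d → ℕ) → K} {b : Fin d → ℕ}
    (hφ : IsLeadingExponent φ b) (hψ : IsLeadingExponent ψ b) {a : Fin d → ℕ}
    (ha : (φ - (φ b / ψ b) • ψ) a ≠ 0) : toColex a < toColex b := by
  refine lt_of_le_of_ne ?_ ?_
  · by_contra hle
    have hφa : φ a = 0 := by_contra fun h => hle (hφ.le a h)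
    have hψa : ψ a = 0 := by_contra fun h => hle (hψ.le a h)
    simp [hφa, hψa] at ha
  · intro hab
    obtain rfl : a = b := hab
    simp [div_mul_cancel₀ _ hψ.ne_zero] at ha

theorem le_span_of_isLeadingExponent {E : Submodule K ((Fin d → ℕ) → K)}
    {B : Set ((Fin d → ℕ) → K)} (hfin : ∀ φ ∈ E, φ.support.Finite) (hBE : B ⊆ E)
    (hB : ∀ φ ∈ E, ∀ b, IsLeadingExponent φ b → ∃ ψ ∈ B, IsLeadingExponent ψ b) :
    E ≤ Submodule.span K B := by
  suffices ∀ b : Colex (Fin d → ℕ), ∀ φ ∈ E, IsLeadingExponent φ (ofColex b) →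
      φ ∈ Submodule.span K B by
    intro φ hφ
    rcases eq_or_ne φ 0 with rfl | hne
    · exact Submodule.zero_mem _
    · obtain ⟨b, hb⟩ := exists_isLeadingExponent (hfin φ hφ) hne
      exact this (toColex b) φ hφ hb
  intro b
  induction b using WellFoundedLT.induction with
  | ind b ih =>
    intro φ hφ hb
    obtain ⟨ψ, hψB, hψ⟩ := hB φ hφ _ hb
    set c := φ (ofColex b) / ψ (ofColex b)
    have hsub : φ - c • ψ ∈ E := E.sub_mem hφ (E.smul_mem c (hBE hψB))
    rw [← sub_add_cancel φ (c • ψ)]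
    refine Submodule.add_mem _ ?_ (Submodule.smul_mem _ c (Submodule.subset_span hψB))
    rcases eq_or_ne (φ - c • ψ) 0 with h | hne
    · rw [h]
      exact Submodule.zero_mem _
    · obtain ⟨b', hb'⟩ := exists_isLeadingExponent (hfin _ hsub) hne
      exact ih (toColex b') (hb.toColex_lt hψ hb'.ne_zero) _ hsub hb'

/-- The space of harmonic functions of order at most `k` in each variable. -/
def harmonicLE (K : Type*) [Field K] (d k : ℕ) : Submodule K ((Fin d → ℕ) → K) where
  carrier := {φ | IsHarmonic φ ∧ ∀ a, φ a ≠ 0 → ∀ i, a i ≤ k}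
  zero_mem' := ⟨fun _ _ => by simp [shiftSum], by simp⟩
  add_mem' {φ ψ} hφ hψ := by
    refine ⟨fun r a => ?_, fun a ha => ?_⟩
    · simpa [shiftSum, Finset.sum_add_distrib] using congrArg₂ (· + ·) (hφ.1 r a) (hψ.1 r a)
    · rcases eq_or_ne (φ a) 0 with h | h
      · exact hψ.2 a fun h' => ha (by simp [h, h'])
      · exact hφ.2 a h
  smul_mem' c φ hφ := by
    refine ⟨fun r a => ?_, fun a ha => hφ.2 a fun h => ha (by simp [h])⟩
    simpa [shiftSum, Finset.mul_sum] using congrArg (c * ·) (hφ.1 r a)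

theorem harmonicLE_eq_span [CharZero K] (d k : ℕ) :
    harmonicLE K d k = Submodule.span K
      {φ | ∃ p c : Fin d → ℕ, IsPacked k p ∧ φ = blockVandermonde K p c} := by
  have hmem : {φ | ∃ p c : Fin d → ℕ, IsPacked k p ∧ φ = blockVandermonde K p c} ⊆
      (harmonicLE K d k : Set ((Fin d → ℕ) → K)) := by
    rintro _ ⟨p, c, hp, rfl⟩
    exact ⟨isHarmonic_blockVandermonde p c,
      fun a => le_of_blockVandermonde_ne_zero hp.blockRank_le⟩
  refine le_antisymm (le_span_of_isLeadingExponent (fun φ hφ => ?_) hmem fun φ hφ b hb => ?_)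
    (Submodule.span_le.2 hmem)
  · exact (Set.finite_Iic fun _ : Fin d => k).subset hφ.2
  · obtain ⟨p, hp, hbp⟩ := hφ.1.exists_isPacked hφ.2 hb
    exact ⟨_, ⟨p, blockRank p - b, hp, rfl⟩,
      isLeadingExponent_blockVandermonde (add_tsub_cancel_of_le hbp)⟩

end Span

end BlockVandermonde

section ColumnDeterminants

variable {κ A : Type*} [CommRing A] {d : ℕ}

lemma map_colDet {B : Type*} [CommRing B] (f : A →+* B) (x : κ → ℕ → A) (w : Fin d → κ)
    (a : Fin d → ℕ) : f (colDet x w a) = colDet (fun i j => f (x i j)) w a := by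
  rw [colDet, RingHom.map_det, colDet]
  congr 1
  ext j l
  simp

lemma colDet_comp_perm (x : κ → ℕ → A) (w : Fin d → κ) (a : Fin d → ℕ)
    (σ : Equiv.Perm (Fin d)) :
    colDet x (w ∘ σ) (a ∘ σ) = ((Equiv.Perm.sign σ : ℤ) : A) * colDet x w a := by
  rw [colDet, colDet, ← Matrix.det_permute']
  rfl

lemma colDet_eq_zero {x : κ → ℕ → A} {w : Fin d → κ} {a : Fin d → ℕ} {l l' : Fin d}
    (h : l ≠ l') (hw : w l = w l') (ha : a l = a l') : colDet x w a = 0 :=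
  Matrix.det_zero_of_column_eq h fun j => by simp only [Matrix.of_apply, hw, ha]

lemma colDet_eq_zero_of_forall_ne_zero {x : κ → ℕ → A} {w : Fin (d + 1) → κ}
    {a : Fin (d + 1) → ℕ} (h : ∀ l, a l ≠ 0) : colDet x w a = 0 := by
  refine Matrix.det_eq_zero_of_row_eq_zero 0 fun l => ?_
  obtain ⟨m, hm⟩ := Nat.exists_eq_succ_of_ne_zero (h l)
  simp [hm]

lemma succ_descFactorial_smul (f : ℕ → A) (n : ℕ) {m : ℕ} (hm : m ≠ 0) :
    (n + 1).descFactorial m • f (n + 1 - m) =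
      ((n : A) + 1) * n.descFactorial (m - 1) • f (n - (m - 1)) := by
  obtain ⟨m, rfl⟩ := Nat.exists_eq_succ_of_ne_zero hm
  simp only [Nat.succ_eq_add_one, Nat.succ_descFactorial_succ, Nat.add_sub_cancel,
    Nat.add_sub_add_right, nsmul_eq_mul, Nat.cast_mul, Nat.cast_add, Nat.cast_one, mul_assoc]

lemma colDet_eq_mul {x : κ → ℕ → A} {w : Fin (d + 1) → κ} {a : Fin (d + 1) → ℕ}
    {l : Fin (d + 1)} (hl : a l = 0) (h : ∀ l', l' ≠ l → a l' ≠ 0) :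
    ∃ n : ℤ, colDet x w a = n • (x (w l) 0 *
      colDet x (fun l' => w (l.succAbove l')) fun l' => a (l.succAbove l') - 1) := by
  have hminor : (Matrix.of fun j l : Fin (d + 1) =>
      (j : ℕ).descFactorial (a l) • x (w l) (j - a l)).submatrix Fin.succ l.succAbove =
        Matrix.of fun j l' : Fin d => ((j : A) + 1) *
          (j : ℕ).descFactorial (a (l.succAbove l') - 1) •
            x (w (l.succAbove l')) (j - (a (l.succAbove l') - 1)) := by
    ext j l'
    exact succ_descFactorial_smul (x (w (l.succAbove l'))) j (h _ (l.succAbove_ne l'))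
  refine ⟨(-1) ^ (l : ℕ) * ∏ j : Fin d, ((j : ℤ) + 1), ?_⟩
  rw [colDet, Matrix.det_succ_row_zero, Finset.sum_eq_single l, hminor]
  · have hdet := Matrix.det_mul_column (fun j : Fin d => (j : A) + 1) (Matrix.of fun j l' : Fin d =>
      (j : ℕ).descFactorial (a (l.succAbove l') - 1) •
        x (w (l.succAbove l')) (j - (a (l.succAbove l') - 1)))
    rw [← colDet] at hdet
    refine (congrArg _ hdet).trans ?_
    simp only [Matrix.of_apply, hl, Nat.descFactorial_zero, one_smul, Fin.val_zero, zsmul_eq_mul,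
      Int.cast_mul, Int.cast_pow, Int.cast_neg, Int.cast_one, Int.cast_prod, Int.cast_add,
      Int.cast_natCast, Nat.sub_zero]
    ring
  · intro l' _ hl'
    obtain ⟨m, hm⟩ := Nat.exists_eq_succ_of_ne_zero (h _ hl')
    simp [hm]
  · simp

lemma blockRank_orderIso (p : Fin d → ℕ) (h : ℕ) {m : ℕ} (e : Fin m ≃o {i // p i = h})
    (j : Fin m) : blockRank p (e j) = j := by
  have hinj : Function.Injective fun j => (e j : Fin d) := Subtype.val_injective.comp e.injective
  rw [blockRank, labelCount, ← Fin.card_Iio j, ← Finset.card_image_of_injective _ hinj]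
  congr 1
  ext i
  simp only [Finset.mem_filter, Finset.mem_univ, true_and, Finset.mem_image, Finset.mem_Iio]
  constructor
  · rintro ⟨hlt, hi⟩
    refine ⟨e.symm ⟨i, hi.trans (e j).2⟩, ?_, by rw [e.apply_symm_apply]⟩
    rw [← e.lt_iff_lt, e.apply_symm_apply]
    exact hlt
  · rintro ⟨j', hj', rfl⟩
    exact ⟨e.lt_iff_lt.2 hj', (e j').2.trans (e j).2.symm⟩

lemma blockDet_mem {R : Type*} [CommSemiring R] [Algebra R A] (S : Subalgebra R A)
    {x : κ → ℕ → A} {p : Fin d → ℕ} (w : Fin d → κ) (a : Fin d → ℕ)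
    (hS : ∀ h m, (Finset.univ.filter fun i => p i = h).card = m →
      ∀ (w' : Fin m → κ) (a' : Fin m → ℕ), colDet x w' a' ∈ S) : blockDet x p w a ∈ S := by
  have hblock : Matrix.BlockTriangular (Matrix.of fun i l : Fin d => if p i = p l then
      (blockRank p i).descFactorial (a l) • x (w l) (blockRank p i - a l) else 0) p :=
    fun i l hil => if_neg hil.ne'
  rw [blockDet, hblock.det]
  refine S.prod_mem fun h _ => ?_
  have hcard : Fintype.card {i // p i = h} = (Finset.univ.filter fun i => p i = h).card :=
    Fintype.card_subtype _
  set e := Fintype.orderIsoFinOfCardEq _ hcard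
  rw [← Matrix.det_submatrix_equiv_self e.toEquiv]
  convert hS h _ rfl (fun l => w (e l)) (fun l => a (e l)) using 1
  refine congrArg Matrix.det (Matrix.ext fun j l => ?_)
  have hp : p (e j) = p (e l) := (e j).2.trans (e l).2.symm
  change (if p (e j) = p (e l) then (blockRank p (e j)).descFactorial (a (e l)) •
    x (w (e l)) (blockRank p (e j) - a (e l)) else 0) = _
  rw [if_pos hp, blockRank_orderIso p h e j]
  rfl

end ColumnDeterminants

section Contraction

lemma det_of_sum_mul {n ι A : Type*} [Fintype n] [DecidableEq n] [Fintype ι] [CommRing A]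
    (x : n → ι → A) (t : n → ι → n → A) :
    (Matrix.of fun i l => ∑ s, x l s * t l s i).det =
      ∑ a : n → ι, (∏ l, x l (a l)) * (Matrix.of fun i l => t l (a l) i).det := by
  classical
  have hsum := (Matrix.detRowAlternating (n := n) (R := A)).toMultilinearMap.map_sum
    fun l s i => x l s * t l s i
  have hrow (l i : n) : (∑ s, fun i => x l s * t l s i) i = ∑ s, x l s * t l s i :=
    Finset.sum_apply _ _ _
  rw [← Matrix.det_transpose]
  refine (congrArg Matrix.det (Matrix.ext fun l i => (hrow l i).symm)).trans
    (hsum.trans (Finset.sum_congr rfl fun a _ => ?_))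
  rw [← Matrix.det_transpose (Matrix.of _)]
  exact Matrix.det_mul_column _ _

variable {K κ : Type*} [Field K] {d : ℕ}

/-- The polynomial `∑_a φ(a) ∏_l X (w l, a l) / (a l)!`, summed over the exponents `a` with
entries at most `k`. -/
def contract (k : ℕ) (w : Fin d → κ) :
    ((Fin d → ℕ) → K) →ₗ[K] MvPolynomial (κ × ℕ) K where
  toFun φ := ∑ a : Fin d → Fin (k + 1),
    (φ (fun l => a l) / ∏ l, ((a l : ℕ).factorial : K)) • ∏ l, X (w l, (a l : ℕ))
  map_add' φ φ' := by
    simp only [Pi.add_apply, add_div, add_smul, Finset.sum_add_distrib]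
  map_smul' r φ := by
    simp only [Pi.smul_apply, smul_eq_mul, mul_div_assoc, mul_smul, Finset.smul_sum,
      RingHom.id_apply]

lemma descFactorial_smul_X_eq_sum [CharZero K] (i : κ) (m : ℕ) {k n : ℕ} (hn : n ≤ k) :
    n.descFactorial m • (X (i, n - m) : MvPolynomial (κ × ℕ) K) = ∑ s : Fin (k + 1),
      X (i, (s : ℕ)) * C (((s : ℕ).factorial : K)⁻¹ *
        if n = s + m then (n.factorial : K) else 0) := by
  rcases lt_or_ge n m with hm | hm
  · rw [Nat.descFactorial_of_lt hm, zero_smul, Finset.sum_eq_zero]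
    intro s _
    rw [if_neg (by omega), mul_zero, C_0, mul_zero]
  · rw [Finset.sum_eq_single (⟨n - m, by omega⟩ : Fin (k + 1))]
    · have hfact : (((n - m).factorial : K)) ≠ 0 := Nat.cast_ne_zero.2 (Nat.factorial_ne_zero _)
      rw [if_pos (Nat.sub_add_cancel hm).symm, ← Nat.factorial_mul_descFactorial hm, Nat.cast_mul,
        inv_mul_cancel_left₀ hfact, map_natCast, mul_comm, nsmul_eq_mul]
    · intro s _ hs
      rw [if_neg, mul_zero, C_0, mul_zero]
      rintro rfl
      exact hs (Fin.ext (Nat.add_sub_cancel _ _).symm)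
    · simp

theorem contract_blockVandermonde [CharZero K] {k : ℕ} {p : Fin d → ℕ}
    (hp : ∀ i, blockRank p i ≤ k) (w : Fin d → κ) (c : Fin d → ℕ) :
    contract k w (blockVandermonde K p c) =
      blockDet (fun i j => (X (i, j) : MvPolynomial (κ × ℕ) K)) p w c := by
  set t : Fin d → Fin (k + 1) → Fin d → K := fun l s i =>
    ((s : ℕ).factorial : K)⁻¹ *
      if p i = p l ∧ blockRank p i = s + c l then ((blockRank p i).factorial : K) else 0 with ht
  have hcolumn (i l : Fin d) : (if p i = p l then (blockRank p i).descFactorial (c l) •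
      (X (w l, blockRank p i - c l) : MvPolynomial (κ × ℕ) K) else 0) =
        ∑ s : Fin (k + 1), X (w l, (s : ℕ)) * C (t l s i) := by
    by_cases hpl : p i = p l
    · simp only [ht, hpl, true_and, if_true, descFactorial_smul_X_eq_sum (w l) (c l) (hp i)]
    · simp only [ht, hpl, false_and, if_false, mul_zero, C_0, Finset.sum_const_zero]
  simp only [blockDet, hcolumn]
  rw [det_of_sum_mul (fun l (s : Fin (k + 1)) => X (w l, (s : ℕ))) fun l s i => C (t l s i)]
  refine Finset.sum_congr rfl fun a _ => ?_
  have hcoeff : (Matrix.of fun i l => t l (a l) i).det =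
      blockVandermonde K p c (fun l => a l) / ∏ l, ((a l : ℕ).factorial : K) := by
    rw [div_eq_inv_mul, ← Finset.prod_inv_distrib]
    exact Matrix.det_mul_row _ _
  rw [← hcoeff, smul_eq_C_mul, mul_comm, RingHom.map_det]
  rfl

end Contraction

section Action

variable {N : ℕ}

lemma act_X (α : (PowerSeries ℂ)ˣ) (i : Fin (N + 1)) (m : ℕ) :
    act α (X (i, m) : V N) = ∑ l ∈ Finset.range (m + 1),
      ((m.descFactorial l : ℂ) * PowerSeries.coeff l (α : PowerSeries ℂ)) •
        (X (i, m - l) : V N) := by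
  rw [act, aeval_X, ← Finset.sum_range_reflect]
  refine Finset.sum_congr rfl fun l hl => ?_
  have hl : l ≤ m := Nat.lt_succ_iff.1 (Finset.mem_range.1 hl)
  simp only [show m + 1 - 1 - l = m - l by omega, Nat.sub_sub_self hl,
    PowerSeries.constantCoeff_iterate_derivative, Nat.choose_symm hl,
    Nat.descFactorial_eq_factorial_mul_choose, Nat.cast_mul]
  ring_nf

/-- The unit `1 + z T`. -/
def onePlus (z : ℂ) : (PowerSeries ℂ)ˣ :=
  (PowerSeries.isUnit_iff_constantCoeff.2
    (by simp : IsUnit (PowerSeries.constantCoeff (1 + PowerSeries.C z * PowerSeries.X)))).unit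

lemma coe_onePlus (z : ℂ) : (onePlus z : PowerSeries ℂ) = 1 + PowerSeries.C z * PowerSeries.X :=
  rfl

lemma act_onePlus_eq_self {d : ℕ} {P : V N} (hP : P ∈ diffHom N d) (z : ℂ) :
    act (onePlus z) P = P := by
  simpa [coe_onePlus] using hP (onePlus z)

lemma act_onePlus_X (z : ℂ) (i : Fin (N + 1)) (m : ℕ) :
    act (onePlus z) (X (i, m) : V N) = X (i, m) + (z * m) • X (i, m - 1) := by
  have hcoeff (l : ℕ) : PowerSeries.coeff l (onePlus z : PowerSeries ℂ) =
      if l = 0 then 1 else if l = 1 then z else 0 := by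
    rw [coe_onePlus, map_add, PowerSeries.coeff_one, PowerSeries.coeff_C_mul, PowerSeries.coeff_X]
    rcases l with _ | _ | l <;> simp
  rw [act_X]
  rcases m with - | m
  · simp [hcoeff]
  · rw [Finset.sum_range_succ', Finset.sum_range_succ', Finset.sum_eq_zero]
    · simp [hcoeff, add_comm, mul_comm]
    · intro l _
      simp [hcoeff]

lemma pderiv_act_onePlus_X (z : ℂ) (i : Fin (N + 1)) (j : ℕ) (v : Fin (N + 1) × ℕ) :
    pderiv (i, j) (act (onePlus z) (X v : V N)) = act (onePlus z) (pderiv (i, j) (X v)) +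
      (z * ((j : ℂ) + 1)) • act (onePlus z) (pderiv (i, j + 1) (X v)) := by
  obtain ⟨i', m⟩ := v
  simp only [act_onePlus_X, map_add, Derivation.map_smul, pderiv_X]
  rcases eq_or_ne i' i with rfl | hi
  · rcases m with - | m
    · rcases eq_or_ne j 0 with rfl | hj
      · simp
      · simp [hj]
    · rcases eq_or_ne m j with rfl | hmj
      · simp
      · rcases eq_or_ne j (m + 1) with rfl | hj
        · simp
        · simp [hmj.symm, hj]
  · simp [hi.symm]

lemma pderiv_act_onePlus (z : ℂ) (i : Fin (N + 1)) (j : ℕ) (P : V N) :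
    pderiv (i, j) (act (onePlus z) P) = act (onePlus z) (pderiv (i, j) P) +
      (z * ((j : ℂ) + 1)) • act (onePlus z) (pderiv (i, j + 1) P) := by
  induction P using MvPolynomial.induction_on with
  | C r => simp [act, algHom_C, MvPolynomial.algebraMap_eq]
  | add P Q hP hQ =>
    simp only [map_add, hP, hQ, smul_add]
    abel
  | mul_X P v hP =>
    simp only [map_mul, Derivation.leibniz, hP, pderiv_act_onePlus_X, smul_eq_mul, map_add, mul_add,
      smul_add, mul_smul_comm]
    abel

lemma coeff_aeval_smul_X {σ R : Type*} [CommSemiring R] (c : R) (P : MvPolynomial σ R)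
    (m : σ →₀ ℕ) : coeff m (aeval (fun v => c • (X v : MvPolynomial σ R)) P) =
      c ^ m.degree * coeff m P := by
  classical
  induction P using MvPolynomial.induction_on' with
  | monomial n r =>
    have hprod : ∏ v ∈ n.support, (X v : MvPolynomial σ R) ^ n v = monomial n 1 := by
      rw [monomial_eq, C_1, one_mul, Finsupp.prod]
    simp only [aeval_monomial, Finsupp.prod, smul_pow, Finset.prod_smul, Finset.prod_pow_eq_pow_sum]
    rw [hprod, algebraMap_eq, mul_smul_comm, C_mul_monomial, mul_one, coeff_smul, coeff_monomial,
      smul_eq_mul]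
    split_ifs with h
    · rw [h]
      rfl
    · simp
  | add p q hp hq => rw [map_add, coeff_add, hp, hq, coeff_add, mul_add]

lemma isHomogeneous_of_mem_diffHom {d : ℕ} {P : V N} (hP : P ∈ diffHom N d) :
    P.IsHomogeneous d := by
  have hu : IsUnit (PowerSeries.C (2 : ℂ)) := (isUnit_iff_ne_zero.2 two_ne_zero).map _
  have hact : (act hu.unit : V N →ₐ[ℂ] V N) = aeval fun v => (2 : ℂ) • (X v : V N) := by
    ext1 v
    rw [aeval_X, act_X, Finset.sum_range_succ', Finset.sum_eq_zero]
    · simp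
    · intro l _
      simp
  intro m hm
  have hpow := congrArg (coeff m) (hP hu.unit)
  rw [hact, coeff_aeval_smul_X, coeff_smul, IsUnit.unit_spec, PowerSeries.constantCoeff_C,
    smul_eq_mul] at hpow
  have hpow : (2 : ℕ) ^ m.degree = 2 ^ d := by exact_mod_cast mul_right_cancel₀ hm hpow
  rw [← Nat.pow_right_injective le_rfl hpow, Finsupp.degree_eq_weight_one]
  rfl

end Action

section Polarization

variable {N : ℕ}

/-- The full polarization of a differential polynomial, as a function of the exponents `a`: the
value at `0` of the derivative with respect to the divided variables `X (w l, a l) / (a l)!`. -/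
def polar : (d : ℕ) → (Fin d → Fin (N + 1)) → (Fin d → ℕ) → V N →ₗ[ℂ] ℂ
  | 0, _, _ => lcoeff ℂ 0
  | d + 1, w, a => ((a 0).factorial : ℂ) •
      polar d (Fin.tail w) (Fin.tail a) ∘ₗ (pderiv (w 0, a 0)).toLinearMap

lemma polar_succ {d : ℕ} (w : Fin (d + 1) → Fin (N + 1)) (a : Fin (d + 1) → ℕ) (P : V N) :
    polar (d + 1) w a P =
      ((a 0).factorial : ℂ) * polar d (Fin.tail w) (Fin.tail a) (pderiv (w 0, a 0) P) :=
  rfl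

lemma sum_finset_fin_succ {d : ℕ} {M : Type*} [AddCommMonoid M] (f : Finset (Fin (d + 1)) → M) :
    ∑ T, f T = ∑ T : Finset (Fin d), (f (T.map (Fin.succEmb d)) +
      f (insert 0 (T.map (Fin.succEmb d)))) := by
  have hmap (g : Finset (Fin (d + 1)) → M) :
      ∑ T ∈ (Finset.univ.map (Fin.succEmb d)).powerset, g T =
        ∑ T : Finset (Fin d), g (T.map (Fin.succEmb d)) := by
    refine (Finset.sum_nbij (Finset.map (Fin.succEmb d)) ?_ ?_ ?_ fun _ _ => rfl).symm
    · intro T _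
      exact Finset.mem_powerset.2 (Finset.map_subset_map.2 (Finset.subset_univ T))
    · exact (Finset.map_injective _).injOn
    · intro T hT
      obtain ⟨T', -, rfl⟩ := Finset.subset_map_iff.1 (Finset.mem_powerset.1 hT)
      exact ⟨T', Finset.mem_coe.2 (Finset.mem_univ _), rfl⟩
  rw [Finset.sum_add_distrib, ← hmap, ← hmap fun T => f (insert 0 T),
    ← Finset.sum_powerset_insert (by simp [Fin.succ_ne_zero]), ← Finset.powerset_univ,
    Fin.univ_succ, Finset.cons_eq_insert]
  rfl

lemma constantCoeff_act_onePlus (z : ℂ) (P : V N) :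
    constantCoeff (act (onePlus z) P) = constantCoeff P := by
  suffices constantCoeff.comp (act (N := N) (onePlus z)).toRingHom = constantCoeff from
    congrArg (· P) this
  ext v
  · simp
  · obtain ⟨i, m⟩ := v
    simp [act_onePlus_X]

lemma polar_act_onePlus (z : ℂ) {d : ℕ} (w : Fin d → Fin (N + 1)) (a : Fin d → ℕ) (P : V N) :
    polar d w a (act (onePlus z) P) =
      ∑ T : Finset (Fin d), z ^ T.card * polar d w (a + (T : Set (Fin d)).indicator 1) P := by
  induction d generalizing P with
  | zero =>
    rw [Fintype.sum_subsingleton _ ∅, Finset.card_empty, pow_zero, one_mul]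
    exact constantCoeff_act_onePlus z P
  | succ d ih =>
    have htail (T : Finset (Fin d)) (S : Finset (Fin (d + 1)))
        (hS : ∀ l, l.succ ∈ S ↔ l ∈ T) : Fin.tail (a + (S : Set (Fin (d + 1))).indicator 1) =
          Fin.tail a + (T : Set (Fin d)).indicator 1 := by
      funext l
      simp [Fin.tail, Set.indicator_apply, hS]
    have hcard (T : Finset (Fin d)) : (insert 0 (T.map (Fin.succEmb d))).card = T.card + 1 := by
      rw [Finset.card_insert_of_notMem (by simp [Fin.succ_ne_zero]), Finset.card_map]
    rw [sum_finset_fin_succ, Finset.sum_add_distrib, polar_succ, pderiv_act_onePlus, map_add,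
      map_smul, ih, ih, mul_add, smul_eq_mul, Finset.mul_sum, Finset.mul_sum, Finset.mul_sum]
    congr 1 <;> refine Finset.sum_congr rfl fun T _ => ?_
    · rw [polar_succ, htail T _ (by simp), Finset.card_map]
      simp [Fin.succ_ne_zero, mul_left_comm]
    · rw [polar_succ, htail T _ (by simp [Fin.succ_ne_zero]), hcard]
      simp [Nat.factorial_succ]
      ring

lemma sum_powersetCard_succ_eq_zero {ι K : Type*} [Fintype ι] [Field K] [Infinite K]
    {f : Finset ι → K} {c : K} (h : ∀ z : K, ∑ T, z ^ T.card * f T = c) (r : ℕ) :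
    ∑ T ∈ Finset.univ.powersetCard (r + 1), f T = 0 := by
  have hpoly : ∑ T, Polynomial.X ^ T.card * Polynomial.C (f T) = Polynomial.C c :=
    Polynomial.funext fun z => by
      simp [Polynomial.eval_finsetSum, ← h z, -Polynomial.X_pow_mul_C]
  rw [← coeff_sum_X_pow_card_mul_C, hpoly, Polynomial.coeff_C_succ]

theorem isHarmonic_polar {d e : ℕ} {P : V N} (hP : P ∈ diffHom N e) (w : Fin d → Fin (N + 1)) :
    IsHarmonic fun a : Fin d → ℕ => polar d w a P := fun r a =>
  sum_powersetCard_succ_eq_zero (fun z => by rw [← polar_act_onePlus, act_onePlus_eq_self hP z]) r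

lemma mem_orderLE {k : ℕ} {P : V N} : P ∈ orderLE N k ↔ ∀ v ∈ P.vars, v.2 ≤ k := by
  rw [orderLE, mem_supported]
  rfl

lemma prodMap_val_injective (N k : ℕ) : Function.Injective
    (Prod.map id Fin.val : Fin (N + 1) × Fin (k + 1) → Fin (N + 1) × ℕ) :=
  Function.injective_id.prodMap Fin.val_injective

lemma mem_orderLE_iff_exists_rename {k : ℕ} {P : V N} : P ∈ orderLE N k ↔
    ∃ Q : MvPolynomial (Fin (N + 1) × Fin (k + 1)) ℂ,
      rename (Prod.map id Fin.val) Q = P := by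
  constructor
  · intro h
    refine exists_rename_eq_of_vars_subset_range P _ (prodMap_val_injective N k) fun v hv => ?_
    exact ⟨(v.1, ⟨v.2, Nat.lt_succ_of_le (mem_orderLE.1 h v hv)⟩), rfl⟩
  · rintro ⟨Q, rfl⟩
    rw [mem_orderLE]
    intro v hv
    obtain ⟨u, -, rfl⟩ := mem_vars_rename _ _ hv
    exact Nat.lt_succ_iff.1 u.2.2

lemma pderiv_eq_zero_of_mem_orderLE {k : ℕ} {P : V N} (h : P ∈ orderLE N k)
    {v : Fin (N + 1) × ℕ} (hv : k < v.2) : pderiv v P = 0 :=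
  pderiv_eq_zero_of_notMem_vars fun hm => hv.not_ge (mem_orderLE.1 h v hm)

lemma pderiv_mem_orderLE {k : ℕ} {P : V N} (h : P ∈ orderLE N k) (v : Fin (N + 1) × ℕ) :
    pderiv v P ∈ orderLE N k := by
  rcases lt_or_ge k v.2 with hv | hv
  · rw [pderiv_eq_zero_of_mem_orderLE h hv]
    exact zero_mem _
  · obtain ⟨Q, rfl⟩ := mem_orderLE_iff_exists_rename.1 h
    have := pderiv_rename (prodMap_val_injective N k) (v.1, ⟨v.2, Nat.lt_succ_of_le hv⟩) Q
    exact mem_orderLE_iff_exists_rename.2 ⟨_, this.symm⟩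

lemma polar_mem_harmonicLE {k d e : ℕ} {P : V N} (hP : P ∈ diffHom N e) (h : P ∈ orderLE N k)
    (w : Fin d → Fin (N + 1)) : (fun a => polar d w a P) ∈ harmonicLE ℂ d k := by
  refine ⟨isHarmonic_polar hP w, fun a ha => ?_⟩
  clear hP
  induction d generalizing P with
  | zero => exact fun i => i.elim0
  | succ d ih =>
    simp only [polar_succ] at ha
    refine Fin.cases ?_ (ih (pderiv_mem_orderLE h _) _ _ (right_ne_zero_of_mul ha))
    by_contra! hlt
    rw [pderiv_eq_zero_of_mem_orderLE h hlt, map_zero, mul_zero] at ha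
    exact ha rfl

lemma sum_X_mul_pderiv_of_mem_orderLE {k d : ℕ} {P : V N} (h : P ∈ orderLE N k)
    (hP : P.IsHomogeneous d) : ∑ i : Fin (N + 1), ∑ s : Fin (k + 1),
      X (i, (s : ℕ)) * pderiv (i, (s : ℕ)) P = d • P := by
  obtain ⟨Q, rfl⟩ := mem_orderLE_iff_exists_rename.1 h
  rw [IsHomogeneous.rename_isHomogeneous_iff (prodMap_val_injective N k)] at hP
  rw [← map_nsmul, ← hP.sum_X_mul_pderiv, map_sum, Fintype.sum_prod_type]
  refine Finset.sum_congr rfl fun i _ => Finset.sum_congr rfl fun s _ => ?_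
  rw [map_mul, rename_X, ← pderiv_rename (prodMap_val_injective N k)]
  rfl

lemma contract_polar_succ (k : ℕ) {d : ℕ} (w : Fin (d + 1) → Fin (N + 1)) (P : V N) :
    contract k w (fun a => polar (d + 1) w a P) = ∑ s : Fin (k + 1), X (w 0, (s : ℕ)) *
      contract k (Fin.tail w) fun a => polar d (Fin.tail w) a (pderiv (w 0, (s : ℕ)) P) := by
  simp only [contract, LinearMap.coe_mk, AddHom.coe_mk, Finset.mul_sum]
  rw [← (Fin.consEquiv fun _ => Fin (k + 1)).sum_comp, Fintype.sum_prod_type]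
  refine Finset.sum_congr rfl fun s _ => Finset.sum_congr rfl fun a _ => ?_
  have hs : ((s : ℕ).factorial : ℂ) ≠ 0 := Nat.cast_ne_zero.2 (Nat.factorial_ne_zero _)
  rw [Fin.prod_univ_succ, Fin.prod_univ_succ, mul_smul_comm]
  exact congrArg (· • _) (mul_div_mul_left _ _ hs)

theorem sum_contract_polar {k d : ℕ} {P : V N} (h : P ∈ orderLE N k) (hP : P.IsHomogeneous d) :
    ∑ w : Fin d → Fin (N + 1), contract k w (fun a => polar d w a P) =
      (d.factorial : ℂ) • P := by
  induction d generalizing P with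
  | zero =>
    obtain ⟨r, rfl⟩ : ∃ r, P = C r := ⟨_, (totalDegree_eq_zero_iff_eq_C.1
      ((totalDegree_zero_iff_isHomogeneous _).2 hP))⟩
    simp [contract, polar, smul_eq_C_mul]
  | succ d ih =>
    have hpartial (i : Fin (N + 1)) (s : Fin (k + 1)) :
        ∑ w : Fin d → Fin (N + 1), contract k w (fun a => polar d w a (pderiv (i, (s : ℕ)) P)) =
          (d.factorial : ℂ) • pderiv (i, (s : ℕ)) P :=
      ih (pderiv_mem_orderLE h _) hP.pderiv
    calc _ = ∑ i : Fin (N + 1), ∑ w : Fin d → Fin (N + 1), ∑ s : Fin (k + 1), X (i, (s : ℕ)) *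
          contract k w (fun a => polar d w a (pderiv (i, (s : ℕ)) P)) := by
          rw [← (Fin.consEquiv fun _ => Fin (N + 1)).sum_comp, Fintype.sum_prod_type]
          exact Finset.sum_congr rfl fun i _ => Finset.sum_congr rfl fun w _ =>
            contract_polar_succ k _ P
      _ = (d.factorial : ℂ) • ∑ i : Fin (N + 1), ∑ s : Fin (k + 1),
          X (i, (s : ℕ)) * pderiv (i, (s : ℕ)) P := by
        simp only [Finset.sum_comm (s := (Finset.univ : Finset (Fin d → Fin (N + 1)))),
          ← Finset.mul_sum, hpartial, mul_smul_comm, ← Finset.smul_sum]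
      _ = ((d + 1).factorial : ℂ) • P := by
        rw [sum_X_mul_pderiv_of_mem_orderLE h hP, ← Nat.cast_smul_eq_nsmul ℂ, smul_smul,
          Nat.factorial_succ, mul_comm, Nat.cast_mul]

theorem mem_span_blockDet {k d : ℕ} {P : V N} (hP : P ∈ diffHom N d) (h : P ∈ orderLE N k) :
    P ∈ Submodule.span ℂ {Q : V N | ∃ (p : Fin d → ℕ) (w : Fin d → Fin (N + 1)) (c : Fin d → ℕ),
      IsPacked k p ∧ Q = blockDet (fun i j => X (i, j)) p w c} := by
  have hd : (d.factorial : ℂ) ≠ 0 := Nat.cast_ne_zero.2 d.factorial_ne_zero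
  rw [← Submodule.smul_mem_iff _ hd, ← sum_contract_polar h (isHomogeneous_of_mem_diffHom hP)]
  refine Submodule.sum_mem _ fun w _ => ?_
  have hpolar := polar_mem_harmonicLE hP h w
  rw [harmonicLE_eq_span] at hpolar
  refine (Submodule.map_span_le _ _ _).2 ?_ (Submodule.mem_map_of_mem hpolar)
  rintro _ ⟨p, c, hp, rfl⟩
  exact Submodule.subset_span ⟨p, w, c, hp, contract_blockVandermonde hp.blockRank_le w c⟩

end Polarization

section Membership

lemma descFactorial_mul_descFactorial_comm (n a s : ℕ) :
    n.descFactorial a * (n - a).descFactorial s = n.descFactorial s * (n - s).descFactorial a := by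
  have has := Nat.descFactorial_mul_descFactorial (n := n) (Nat.le_add_right a s)
  have hsa := Nat.descFactorial_mul_descFactorial (n := n) (Nat.le_add_left s a)
  rw [Nat.add_sub_cancel_left] at has
  rw [Nat.add_sub_cancel] at hsa
  rw [mul_comm, has, ← hsa, mul_comm]

variable {R κ A : Type*} [CommRing R] [CommRing A] [Algebra R A] {d : ℕ}

lemma descFactorial_smul_sum (c : ℕ → R) (f : ℕ → A) (n a : ℕ) :
    n.descFactorial a • ∑ s ∈ Finset.range (n - a + 1),
      ((n - a).descFactorial s * c s : R) • f (n - a - s) =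
    ∑ s ∈ Finset.range (n + 1),
      (n.descFactorial s * c s : R) • (n - s).descFactorial a • f (n - s - a) := by
  rw [Finset.smul_sum, Finset.sum_subset (Finset.range_subset_range.2
    (Nat.succ_le_succ (Nat.sub_le n a))) fun s _ hs => ?_]
  · refine Finset.sum_congr rfl fun s _ => ?_
    rw [← Nat.cast_smul_eq_nsmul R, ← Nat.cast_smul_eq_nsmul R, smul_smul, smul_smul, ← mul_assoc,
      mul_right_comm _ (c s), ← Nat.cast_mul, ← Nat.cast_mul,
      ← descFactorial_mul_descFactorial_comm, Nat.sub_right_comm]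
  · have hs : n - a < s := by
      rwa [Finset.mem_range, Nat.lt_succ_iff, not_le] at hs
    rw [Nat.descFactorial_of_lt hs, Nat.cast_zero, zero_mul, zero_smul R, smul_zero]

lemma sum_ite_le_smul (g : ℕ → R) (h : ℕ → A) (j : Fin d) :
    ∑ j' : Fin d, (if j' ≤ j then g (j - j') else 0) • h j' =
      ∑ s ∈ Finset.range (j + 1), g s • h (j - s) := by
  simp only [ite_smul, zero_smul R, ← Finset.sum_filter]
  refine Finset.sum_bij' (fun j' _ => (j : ℕ) - j') (fun s _ => ⟨j - s, by omega⟩)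
    (fun _ _ => by simp only [Finset.mem_range]; omega)
    (fun _ _ => Finset.mem_filter.2 ⟨Finset.mem_univ _, Nat.sub_le _ _⟩)
    (fun j' hj' => Fin.ext ?_) (fun s hs => ?_) fun j' hj' => ?_
  · exact Nat.sub_sub_self (Finset.mem_filter.1 hj').2
  · exact Nat.sub_sub_self (Nat.lt_succ_iff.1 (Finset.mem_range.1 hs))
  · rw [Nat.sub_sub_self (Finset.mem_filter.1 hj').2]

-- The new matrix is the old one times a lower triangular matrix with diagonal entries `c 0`.
theorem colDet_sum_descFactorial_mul_smul (c : ℕ → R) (x : κ → ℕ → A) (w : Fin d → κ)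
    (a : Fin d → ℕ) :
    colDet (fun i n => ∑ s ∈ Finset.range (n + 1), (n.descFactorial s * c s : R) • x i (n - s))
      w a = c 0 ^ d • colDet x w a := by
  set L : Matrix (Fin d) (Fin d) R := Matrix.of fun j j' =>
    if j' ≤ j then ((j : ℕ).descFactorial (j - j') * c (j - j') : R) else 0 with hL
  have hdet : L.det = c 0 ^ d := by
    have htri : L.IsLowerTriangular := fun i j hij => if_neg (not_le.2 hij)
    rw [Matrix.det_of_isLowerTriangular _ htri]
    simp [hL]
  rw [← hdet, Algebra.smul_def, RingHom.map_det, colDet, colDet, ← Matrix.det_mul]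
  congr 1
  ext j l
  simp only [Matrix.of_apply, descFactorial_smul_sum, Matrix.mul_apply, RingHom.mapMatrix_apply,
    Matrix.map_apply, ← Algebra.smul_def, hL]
  exact (sum_ite_le_smul (fun s => ((j : ℕ).descFactorial s * c s : R))
    (fun n => n.descFactorial (a l) • x (w l) (n - a l)) j).symm

variable {N : ℕ}

theorem colDet_mem_diffHom (w : Fin d → Fin (N + 1)) (a : Fin d → ℕ) :
    colDet (fun i j => (X (i, j) : V N)) w a ∈ diffHom N d := by
  intro α
  refine (map_colDet (act α : V N →ₐ[ℂ] V N).toRingHom _ w a).trans ?_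
  simp only [AlgHom.toRingHom_eq_coe, RingHom.coe_coe, act_X]
  rw [← PowerSeries.coeff_zero_eq_constantCoeff_apply]
  exact colDet_sum_descFactorial_mul_smul (fun s => PowerSeries.coeff s (α : PowerSeries ℂ))
    (fun i n => X (i, n)) w a

lemma colDet_mem_orderLE {k : ℕ} (h : d ≤ k + 1) (w : Fin d → Fin (N + 1)) (a : Fin d → ℕ) :
    colDet (fun i j => (X (i, j) : V N)) w a ∈ orderLE N k := by
  rw [colDet, Matrix.det_apply]
  refine sum_mem fun σ _ => zsmul_mem (prod_mem fun l _ => nsmul_mem ?_ _) _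
  refine X_mem_supported.2 ?_
  simp only [Set.mem_ofPred_eq]
  omega

end Membership

section Sorting

variable {N d : ℕ}

/-- The conditions of `IsIndex` other than `exists_head_zero`; they index the determinants left
after straightening without the products of determinants of smaller size. -/
structure IsPreIndex (d : ℕ) (α : Fin (N + 1) → List ℕ) : Prop where
  increasing : ∀ i, (α i).Pairwise (· < ·)
  lt_partialLength : ∀ i, ∀ a ∈ α i, a < partialLength α i
  length_eq : ∑ i, (α i).length = d

/-- The index collecting the columns `(w l, a l)`: its `i`-th tuple lists in increasing order the
exponents of the columns carrying the letter `i`. -/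
def indexOf (w : Fin d → Fin (N + 1)) (a : Fin d → ℕ) (i : Fin (N + 1)) : List ℕ :=
  ((Finset.univ.filter fun l => w l = i).image a).sort (· ≤ ·)

variable {w : Fin d → Fin (N + 1)} {a : Fin d → ℕ}

lemma mem_indexOf {i : Fin (N + 1)} {s : ℕ} : s ∈ indexOf w a i ↔ ∃ l, w l = i ∧ a l = s := by
  simp [indexOf]

lemma pairwise_lt_indexOf (i : Fin (N + 1)) : (indexOf w a i).Pairwise (· < ·) :=
  (Finset.sortedLT_sort _).pairwise

lemma length_indexOf (h : Function.Injective fun l => (w l, a l)) (i : Fin (N + 1)) :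
    (indexOf w a i).length = (Finset.univ.filter fun l => w l = i).card := by
  rw [indexOf, Finset.length_sort, Finset.card_image_of_injOn]
  intro l hl l' hl' hll
  exact h (Prod.ext (((Finset.mem_filter.1 hl).2).trans (Finset.mem_filter.1 hl').2.symm) hll)

lemma sum_length_indexOf (h : Function.Injective fun l => (w l, a l)) :
    ∑ i, (indexOf w a i).length = d := by
  simp only [length_indexOf h]
  rw [← Finset.card_eq_sum_card_fiberwise (f := w) (t := Finset.univ) (by simp), Finset.card_univ,
    Fintype.card_fin]

lemma partialLength_indexOf (h : Function.Injective fun l => (w l, a l)) (i : Fin (N + 1)) :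
    partialLength (indexOf w a) i = (Finset.univ.filter fun l => w l ≤ i).card := by
  rw [partialLength, Finset.card_eq_sum_card_fiberwise (f := w) (t := Finset.Iic i)
    fun l hl => by simpa using hl]
  refine Finset.sum_congr rfl fun j hj => ?_
  rw [length_indexOf h, Finset.filter_filter]
  congr 1
  ext l
  simp only [Finset.mem_filter, Finset.mem_univ, true_and, iff_and_self]
  rintro rfl
  exact Finset.mem_Iic.1 hj

lemma lt_partialLength_indexOf (h : Function.Injective fun l => (w l, a l)) (hw : Monotone w)
    (l : Fin d) : (l : ℕ) < partialLength (indexOf w a) (w l) := by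
  rw [partialLength_indexOf h, Nat.lt_iff_add_one_le, ← Fin.card_Iic l]
  exact Finset.card_le_card fun l' hl' => by simpa using hw (Finset.mem_Iic.1 hl')

lemma isPreIndex_indexOf (h : Function.Injective fun l => (w l, a l)) (hw : Monotone w)
    (ha : ∀ l, a l ≤ l) : IsPreIndex d (indexOf w a) where
  increasing := pairwise_lt_indexOf
  lt_partialLength i s hs := by
    obtain ⟨l, rfl, rfl⟩ := mem_indexOf.1 hs
    exact (ha l).trans_lt (lt_partialLength_indexOf h hw l)
  length_eq := sum_length_indexOf h

lemma head?_eq_some_zero {L : List ℕ} (hL : L.Pairwise (· < ·)) (h0 : 0 ∈ L) :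
    L.head? = some 0 := by
  cases L with
  | nil => exact absurd h0 List.not_mem_nil
  | cons b L =>
    rcases List.mem_cons.1 h0 with rfl | h0
    · rfl
    · exact absurd (List.rel_of_pairwise_cons hL h0) (Nat.not_lt_zero b)

lemma isIndex_indexOf (h : Function.Injective fun l => (w l, a l)) (hw : Monotone w)
    (ha : ∀ l, a l ≤ l) {i : Fin d} (hi : a i = 0) (hlt : ∀ j, i < j → a j < j) :
    IsIndex d (indexOf w a) where
  increasing := pairwise_lt_indexOf
  lt_partialLength := (isPreIndex_indexOf h hw ha).lt_partialLength
  length_eq := sum_length_indexOf h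
  exists_head_zero := by
    have hafter : ∀ l, i < l → a l + 1 < partialLength (indexOf w a) (w l) := fun l hl =>
      (Nat.succ_le_of_lt (hlt l hl)).trans_lt (lt_partialLength_indexOf h hw l)
    refine ⟨w i, head?_eq_some_zero (pairwise_lt_indexOf _) (mem_indexOf.2 ⟨i, rfl, hi⟩), ?_, ?_⟩
    · intro hlen s hs
      obtain ⟨l, hl, rfl⟩ := mem_indexOf.1 (List.mem_of_getLast? hs)
      rcases lt_trichotomy l i with hli | rfl | hil
      · exact (Nat.succ_le_of_lt ((ha l).trans_lt hli)).trans_lt (lt_partialLength_indexOf h hw i)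
      · rw [hi]
        exact hlen.trans_le (Finset.single_le_sum (f := fun j => (indexOf w a j).length)
          (fun _ _ => Nat.zero_le _) (Finset.mem_Iic.2 le_rfl))
      · exact hl ▸ hafter l hil
    · intro j hj s hs
      obtain ⟨l, rfl, rfl⟩ := mem_indexOf.1 (List.mem_of_getLast? hs)
      exact hafter l (hw.reflect_lt hj)

lemma mem_columns {α : Fin (N + 1) → List ℕ} {v : Fin (N + 1) × ℕ} :
    v ∈ columns α ↔ v.2 ∈ α v.1 := by
  obtain ⟨i, a⟩ := v
  simp [columns]

lemma nodup_columns {α : Fin (N + 1) → List ℕ} (h : ∀ i, (α i).Nodup) : (columns α).Nodup := by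
  rw [columns, List.nodup_flatMap]
  refine ⟨fun i _ => (h i).map (Prod.mk_right_injective i), ?_⟩
  refine List.Pairwise.imp (fun {i j} hij => ?_) (List.nodup_finRange (N + 1))
  rw [Function.onFun, List.disjoint_left]
  rintro ⟨i', a⟩ hi hj
  simp only [List.mem_map, Prod.mk.injEq] at hi hj
  obtain ⟨_, _, rfl, _⟩ := hi
  obtain ⟨_, _, rfl, _⟩ := hj
  exact hij rfl

lemma length_columns (α : Fin (N + 1) → List ℕ) :
    (columns α).length = ∑ i, (α i).length := by
  simp only [columns, List.length_flatMap, List.length_map]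
  rw [← List.ofFn_eq_map, List.sum_ofFn]

lemma exists_perm_get_eq {ι : Type*} {L : List ι} (hL : L.Nodup) {v : Fin L.length → ι}
    (hv : ∀ u ∈ L, ∃ l, v l = u) : ∃ σ : Equiv.Perm (Fin L.length), L.get = v ∘ σ := by
  choose f hf using fun c : Fin L.length => hv (L.get c) (L.get_mem c)
  have hf_inj : Function.Injective f := fun c c' hcc =>
    List.nodup_iff_injective_get.1 hL (by rw [← hf, ← hf, hcc])
  exact ⟨Equiv.ofBijective f (Finite.injective_iff_bijective.1 hf_inj),
    funext fun c => (hf c).symm⟩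

section Ring

variable {A : Type*} [CommRing A] {x : Fin (N + 1) → ℕ → A}

lemma W_eq_colDet (x : Fin (N + 1) → ℕ → A) (α : Fin (N + 1) → List ℕ) :
    W x α = colDet x (fun c => ((columns α).get c).1) fun c => ((columns α).get c).2 := rfl

lemma exists_colDet_eq_smul_W (x : Fin (N + 1) → ℕ → A)
    (h : Function.Injective fun l => (w l, a l)) :
    ∃ n : ℤ, colDet x w a = n • W x (indexOf w a) := by
  have hnodup : (columns (indexOf w a)).Nodup := nodup_columns fun i => Finset.sort_nodup _ _
  have hmem : ∀ v ∈ columns (indexOf w a), ∃ l, (w l, a l) = v := by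
    rintro ⟨i, s⟩ hv
    simpa [mem_columns, mem_indexOf] using hv
  have hlength : (columns (indexOf w a)).length = d := by
    rw [length_columns, sum_length_indexOf h]
  rw [W_eq_colDet]
  generalize columns (indexOf w a) = L at hnodup hmem hlength
  subst hlength
  obtain ⟨σ, hσ⟩ := exists_perm_get_eq hnodup hmem
  refine ⟨Equiv.Perm.sign σ, ?_⟩
  have hperm : (colDet x (fun c => (L.get c).1) fun c => (L.get c).2) =
      colDet x (w ∘ σ) (a ∘ σ) := by
    rw [hσ]
    rfl
  rw [hperm, colDet_comp_perm, zsmul_eq_mul, ← mul_assoc, ← Int.cast_mul, ← Units.val_mul,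
    Int.units_mul_self, Units.val_one, Int.cast_one, one_mul]

variable {Q : AddSubgroup A}

lemma colDet_mem_of_monotone
    (hQ : ∀ w : Fin d → Fin (N + 1), Monotone w → ∀ a : Fin d → ℕ, colDet x w a ∈ Q)
    (w : Fin d → Fin (N + 1)) (a : Fin d → ℕ) : colDet x w a ∈ Q := by
  have hsorted := hQ _ (Tuple.monotone_sort w) (a ∘ Tuple.sort w)
  rw [colDet_comp_perm] at hsorted
  rcases Int.units_eq_one_or (Equiv.Perm.sign (Tuple.sort w)) with hsign | hsign <;>
    simpa [hsign] using hsorted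

lemma colDet_mem_of_W_indexOf_mem
    (hQ : (Function.Injective fun l => (w l, a l)) → W x (indexOf w a) ∈ Q) :
    colDet x w a ∈ Q := by
  by_cases h : Function.Injective fun l => (w l, a l)
  · obtain ⟨n, hn⟩ := exists_colDet_eq_smul_W x h
    exact hn ▸ zsmul_mem (hQ h) n
  · obtain ⟨l, l', heq, hne⟩ := Function.not_injective_iff.1 h
    rw [colDet_eq_zero hne (Prod.ext_iff.1 heq).1 (Prod.ext_iff.1 heq).2]
    exact Q.zero_mem

theorem colDet_mem_of_isPreIndex
    (hQ : ∀ α : Fin (N + 1) → List ℕ, IsPreIndex d α → W x α ∈ Q)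
    (w : Fin d → Fin (N + 1)) (a : Fin d → ℕ) : colDet x w a ∈ Q :=
  colDet_mem_of_monotone (fun w hw => (isHarmonic_colDet x w).mem_of_staircase fun _ ha =>
    colDet_mem_of_W_indexOf_mem fun h => hQ _ (isPreIndex_indexOf h hw ha)) w a

theorem colDet_mem_of_isIndex
    (hQ : ∀ α : Fin (N + 1) → List ℕ, IsIndex (d + 1) α → W x α ∈ Q)
    (hQ_mul : ∀ (i : Fin (N + 1)) (w : Fin d → Fin (N + 1)) (a : Fin d → ℕ),
      x i 0 * colDet x w a ∈ Q)
    (w : Fin (d + 1) → Fin (N + 1)) (a : Fin (d + 1) → ℕ) : colDet x w a ∈ Q := by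
  refine colDet_mem_of_monotone (fun w hw =>
    (isHarmonic_colDet x w).mem_of_refined_staircase (fun a ha => ?_) fun a i ha hi hlt =>
      colDet_mem_of_W_indexOf_mem fun h => hQ _ (isIndex_indexOf h hw ha hi hlt)) w a
  by_cases hzero : ∃ l, a l = 0
  · obtain ⟨l, hl⟩ := hzero
    obtain ⟨n, hn⟩ := colDet_eq_mul (x := x) (w := w) hl fun l' hne h0 => hne (ha _ _ h0 hl)
    exact hn ▸ zsmul_mem (hQ_mul _ _ _) n
  · rw [colDet_eq_zero_of_forall_ne_zero fun l hl => hzero ⟨l, hl⟩]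
    exact Q.zero_mem

lemma mem_genFamily_one (x : Fin (N + 1) → ℕ → A) (i : Fin (N + 1)) :
    x i 0 ∈ AddSubgroup.closure (genFamily x 1) := by
  have hindex : IsIndex 1 (indexOf (fun _ : Fin 1 => i) fun _ => 0) :=
    isIndex_indexOf (fun _ _ _ => Subsingleton.elim _ _) (fun _ _ _ => le_rfl) (by simp)
      (i := 0) rfl fun j hj => absurd hj (by simp [Subsingleton.elim j 0])
  have hmem : colDet x (fun _ : Fin 1 => i) (fun _ => 0) ∈ AddSubgroup.closure (genFamily x 1) :=
    colDet_mem_of_W_indexOf_mem fun _ => AddSubgroup.subset_closure ⟨_, hindex, rfl⟩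
  simpa [colDet] using hmem

theorem colDet_mem_of_genFamily_subset {S : Subring A} {e : ℕ}
    (hS : ∀ i ∈ Finset.Icc 1 e, genFamily x i ⊆ S) (hd : d ≤ e) (w : Fin d → Fin (N + 1))
    (a : Fin d → ℕ) : colDet x w a ∈ S := by
  induction d with
  | zero => simp [colDet]
  | succ d ih =>
    have hx : ∀ i, x i 0 ∈ S := fun i => (AddSubgroup.closure_le S.toAddSubgroup).2
      (hS 1 (Finset.mem_Icc.2 ⟨le_rfl, by omega⟩)) (mem_genFamily_one x i)
    exact colDet_mem_of_isIndex (Q := S.toAddSubgroup)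
      (fun α hα => hS (d + 1) (Finset.mem_Icc.2 ⟨Nat.succ_pos d, hd⟩) ⟨α, hα, rfl⟩)
      (fun i w a => S.mul_mem (hx i) (ih (by omega) w a)) w a

end Ring

end Sorting

section Generation

variable {N d : ℕ}

lemma W_mem_diffHom {α : Fin (N + 1) → List ℕ} (h : ∑ i, (α i).length = d) :
    W (fun i j => (X (i, j) : V N)) α ∈ diffHom N d := by
  rw [← h, ← length_columns]
  exact colDet_mem_diffHom _ _

lemma W_mem_orderLE {k : ℕ} {α : Fin (N + 1) → List ℕ} (h : ∑ i, (α i).length = d)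
    (hd : d ≤ k + 1) : W (fun i j => (X (i, j) : V N)) α ∈ orderLE N k :=
  colDet_mem_orderLE (by rwa [length_columns, h]) _ _

theorem mem_adjoin_of_mem_diffHom {k : ℕ} {P : V N} (hP : P ∈ diffHom N d)
    (hk : P ∈ orderLE N k) :
    P ∈ Algebra.adjoin ℂ (⋃ i ∈ Finset.Icc 1 (k + 1), G N i) := by
  set S := Algebra.adjoin ℂ (⋃ i ∈ Finset.Icc 1 (k + 1), G N i)
  refine (Submodule.span_le (p := Subalgebra.toSubmodule S)).2 ?_ (mem_span_blockDet hP hk)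
  rintro _ ⟨p, w, c, hp, rfl⟩
  refine blockDet_mem S w c fun h m hm w' c' => ?_
  refine colDet_mem_of_genFamily_subset (S := S.toSubring) (e := k + 1) (fun i hi g hg => ?_) ?_
    w' c'
  · exact Algebra.subset_adjoin (Set.mem_biUnion hi hg)
  · rw [← hm, hp]
    exact rowLength_le d k h

lemma IsPacked.eq_zero {k : ℕ} {p : Fin d → ℕ} (hp : IsPacked k p) (hd : d ≤ k + 1) : p = 0 := by
  funext i
  by_contra hne
  have hle : k + 1 ≤ p i * (k + 1) := Nat.le_mul_of_pos_left _ (Nat.pos_of_ne_zero hne)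
  have hlt := blockRank_lt_card p i
  rw [hp (p i), rowLength] at hlt
  omega

lemma exists_mem_orderLE (P : V N) (d : ℕ) : ∃ k, d ≤ k + 1 ∧ P ∈ orderLE N k :=
  ⟨max (P.vars.sup Prod.snd) d, by omega, mem_orderLE.2 fun _ hv =>
    le_max_of_le_left (Finset.le_sup (f := Prod.snd) hv)⟩

theorem mem_span_W {P : V N} (hP : P ∈ diffHom N d) :
    P ∈ Submodule.span ℂ {Q : V N | ∃ α, IsPreIndex d α ∧ Q = W (fun i j => X (i, j)) α} := by
  obtain ⟨k, hdk, hk⟩ := exists_mem_orderLE P d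
  refine Submodule.span_le.2 ?_ (mem_span_blockDet hP hk)
  rintro _ ⟨p, w, c, hp, rfl⟩
  rw [hp.eq_zero hdk, show (0 : Fin d → ℕ) = fun _ => 0 from rfl, blockDet_const]
  exact colDet_mem_of_isPreIndex (A := V N) (Q := (Submodule.span ℂ
    {Q : V N | ∃ α, IsPreIndex d α ∧ Q = W (fun i j => X (i, j)) α}).toAddSubgroup)
    (fun α hα => Submodule.subset_span ⟨α, hα, rfl⟩) w c

lemma homogeneousComponent_of_mem_diffHom {P : V N} (hP : P ∈ diffHom N d) (e : ℕ) :
    homogeneousComponent e P = if e = d then P else 0 :=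
  homogeneousComponent_of_mem (isHomogeneous_of_mem_diffHom hP)

lemma mem_diffAlg_of_mem_diffHom {P : V N} (hP : P ∈ diffHom N d) : P ∈ diffAlg N :=
  ⟨DirectSum.of (fun i => diffHom N i) d ⟨P, hP⟩, DirectSum.coeAlgHom_of _ _ _⟩

lemma mem_diffAlg_iff {P : V N} :
    P ∈ diffAlg N ↔ ∀ d, homogeneousComponent d P ∈ diffHom N d := by
  refine ⟨?_, fun h => ?_⟩
  · rintro ⟨x, rfl⟩ d
    rw [AlgHom.toRingHom_eq_coe, RingHom.coe_coe]
    induction x using DirectSum.induction_on with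
    | zero => simp
    | of i p =>
      rw [DirectSum.coeAlgHom_of, homogeneousComponent_of_mem_diffHom p.2]
      split_ifs with h
      · exact h ▸ p.2
      · exact zero_mem _
    | add x y hx hy =>
      rw [map_add, map_add]
      exact add_mem hx hy
  · rw [← sum_homogeneousComponent P]
    exact sum_mem fun i _ => mem_diffAlg_of_mem_diffHom (h i)

lemma homogeneousComponent_mem_orderLE {k : ℕ} {P : V N} (h : P ∈ orderLE N k) (d : ℕ) :
    homogeneousComponent d P ∈ orderLE N k := by
  rw [mem_orderLE] at h ⊢
  intro v hv
  obtain ⟨m, hm, hv⟩ := (mem_vars_iff_mem_support v).1 hv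
  rw [support_homogeneousComponent] at hm
  exact h v ((mem_vars_iff_mem_support v).2 ⟨m, (Finset.mem_filter.1 hm).1, hv⟩)

theorem adjoin_G (N k : ℕ) :
    Algebra.adjoin ℂ (⋃ i ∈ Finset.Icc 1 (k + 1), G N i) = diffAlgLE N k := by
  refine le_antisymm (Algebra.adjoin_le (Set.iUnion₂_subset fun i hi => ?_)) fun P hP => ?_
  · rintro _ ⟨α, hα, rfl⟩
    exact ⟨mem_diffAlg_of_mem_diffHom (W_mem_diffHom hα.length_eq),
      W_mem_orderLE hα.length_eq (Finset.mem_Icc.1 hi).2⟩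
  · rw [← sum_homogeneousComponent P]
    exact sum_mem fun i _ => mem_adjoin_of_mem_diffHom (mem_diffAlg_iff.1 hP.1 i)
      (homogeneousComponent_mem_orderLE hP.2 i)

end Generation

section Words

variable {N d : ℕ}

/-- The index attached to a word, whose letters are read from right to left: the tuple `i` lists
the positions of the letter `i` in the subword of the letters `≤ i`. -/
def ofWord : List (Fin (N + 1)) → Fin (N + 1) → List ℕ
  | [] => fun _ => []
  | i :: w => Function.update (ofWord w) i (ofWord w i ++ [partialLength (ofWord w) i])

lemma partialLength_update_concat (α : Fin (N + 1) → List ℕ) (i : Fin (N + 1)) (L : List ℕ)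
    (b : ℕ) (j : Fin (N + 1)) : partialLength (Function.update α i (L ++ [b])) j =
      partialLength (Function.update α i L) j + if i ≤ j then 1 else 0 := by
  have happly : ∀ L', partialLength (Function.update α i L') j =
      ∑ l ∈ Finset.Iic j, Function.update (fun l => (α l).length) i L'.length l := fun L' =>
    Finset.sum_congr rfl fun l _ => Function.apply_update (fun _ => List.length) α i L' l
  rw [happly, happly]
  by_cases hij : i ≤ j
  · rw [Finset.sum_update_of_mem (Finset.mem_Iic.2 hij),
      Finset.sum_update_of_mem (Finset.mem_Iic.2 hij), if_pos hij, List.length_append,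
      List.length_singleton, add_right_comm]
  · rw [Finset.sum_update_of_notMem (mt Finset.mem_Iic.1 hij),
      Finset.sum_update_of_notMem (mt Finset.mem_Iic.1 hij), if_neg hij, add_zero]

lemma partialLength_ofWord_cons (i : Fin (N + 1)) (w : List (Fin (N + 1))) :
    partialLength (ofWord (i :: w)) i = partialLength (ofWord w) i + 1 := by
  rw [ofWord, partialLength_update_concat, Function.update_eq_self, if_pos le_rfl]

lemma partialLength_last (α : Fin (N + 1) → List ℕ) :
    partialLength α (Fin.last N) = ∑ i, (α i).length := by
  rw [partialLength, ← Fin.top_eq_last, Finset.Iic_top]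

lemma length_le_partialLength (α : Fin (N + 1) → List ℕ) {i j : Fin (N + 1)} (h : i ≤ j) :
    (α i).length ≤ partialLength α j :=
  Finset.single_le_sum (f := fun j => (α j).length) (fun _ _ => Nat.zero_le _)
    (Finset.mem_Iic.2 h)

lemma length_ofWord (w : List (Fin (N + 1))) (i : Fin (N + 1)) :
    (ofWord w i).length = w.count i := by
  induction w with
  | nil => simp [ofWord]
  | cons j w ih =>
    rw [ofWord, List.count_cons]
    by_cases h : i = j
    · subst h
      simp [ih]
    · rw [Function.update_of_ne h, ih]
      simp [Ne.symm h]

lemma length_le_of_pairwise_lt {L : List ℕ} {b : ℕ} (h : L.Pairwise (· < ·))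
    (hb : ∀ a ∈ L, a < b) : L.length ≤ b := by
  have hsub : L.toFinset ⊆ Finset.range b := fun a ha => by simpa using hb a (by simpa using ha)
  simpa [List.toFinset_card_of_nodup h.nodup] using Finset.card_le_card hsub

lemma exists_eq_concat_of_pairwise_lt {L : List ℕ} {a : ℕ} (h : L.Pairwise (· < ·)) (ha : a ∈ L)
    (hmax : ∀ b ∈ L, b ≤ a) : ∃ L', L = L' ++ [a] := by
  obtain rfl | ⟨L', b, rfl⟩ := List.eq_nil_or_concat L
  · exact absurd ha List.not_mem_nil
  · rw [List.concat_eq_append] at h ha hmax ⊢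
    rcases List.mem_append.1 ha with haL | hab
    · exact absurd ((List.pairwise_append.1 h).2.2 a haL b (List.mem_singleton_self b))
        (not_lt.2 (hmax b (by simp)))
    · exact ⟨L', by rw [List.mem_singleton.1 hab]⟩

lemma IsPreIndex.exists_add_one_eq_partialLength {α : Fin (N + 1) → List ℕ}
    (h : IsPreIndex (d + 1) α) : ∃ i, ∃ a ∈ α i, a + 1 = partialLength α i := by
  have hne : (Finset.univ.filter fun i => α i ≠ []).Nonempty := by
    by_contra hempty
    have := h.length_eq
    simp_all
  -- For the first nonempty tuple the partial length is its length, so it is `0, 1, …, r - 1`.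
  obtain ⟨i, hi, hmin⟩ := Finset.exists_min_image _ id hne
  simp only [Finset.mem_filter, Finset.mem_univ, true_and, id] at hi hmin
  have hlength : partialLength α i = (α i).length := by
    refine Finset.sum_eq_single i (fun j hj hji => ?_) (by simp)
    by_contra hlen
    exact hji (le_antisymm (Finset.mem_Iic.1 hj) (hmin j fun hnil => hlen (by simp [hnil])))
  have hpos := List.length_pos_iff.2 hi
  by_contra! hlast
  have hle := length_le_of_pairwise_lt (b := (α i).length - 1) (h.increasing i) fun a ha => by
    have hlt := h.lt_partialLength i a ha
    have hne := hlast i a ha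
    omega
  omega

lemma IsPreIndex.exists_last {α : Fin (N + 1) → List ℕ} (h : IsPreIndex (d + 1) α) :
    ∃ i L a, α i = L ++ [a] ∧ a + 1 = partialLength α i ∧
      ∀ j, i < j → ∀ b ∈ α j, b + 1 < partialLength α j := by
  classical
  obtain ⟨i₀, hi₀⟩ := h.exists_add_one_eq_partialLength
  obtain ⟨i, hi, hmax⟩ := Finset.exists_max_image
    (Finset.univ.filter fun i => ∃ a ∈ α i, a + 1 = partialLength α i) id
    ⟨i₀, Finset.mem_filter.2 ⟨Finset.mem_univ _, hi₀⟩⟩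
  obtain ⟨a, hai, ha⟩ := (Finset.mem_filter.1 hi).2
  obtain ⟨L, hL⟩ := exists_eq_concat_of_pairwise_lt (h.increasing i) hai fun b hb => by
    have := h.lt_partialLength i b hb
    omega
  refine ⟨i, L, a, hL, ha, fun j hj b hb => ?_⟩
  refine lt_of_le_of_ne (h.lt_partialLength j b hb) fun hbj => ?_
  exact not_le.2 hj (hmax j (Finset.mem_filter.2 ⟨Finset.mem_univ _, b, hb, hbj⟩))

lemma IsPreIndex.update_of_eq_concat {α : Fin (N + 1) → List ℕ} (h : IsPreIndex (d + 1) α)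
    {i : Fin (N + 1)} {L : List ℕ} {a : ℕ} (hL : α i = L ++ [a])
    (hlast : ∀ j, i < j → ∀ b ∈ α j, b + 1 < partialLength α j) :
    IsPreIndex d (Function.update α i L) := by
  have hpartial := partialLength_update_concat α i L a
  rw [← hL, Function.update_eq_self] at hpartial
  have hinc := h.increasing i
  rw [hL, List.pairwise_append] at hinc
  refine ⟨fun j => ?_, fun j b hb => ?_, ?_⟩
  · rcases eq_or_ne j i with rfl | hj
    · rw [Function.update_self]
      exact hinc.1
    · rw [Function.update_of_ne hj]
      exact h.increasing j
  · have hj := hpartial j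
    rcases lt_trichotomy i j with hij | rfl | hji
    · rw [Function.update_of_ne hij.ne'] at hb
      rw [if_pos hij.le] at hj
      have := hlast j hij b hb
      omega
    · rw [Function.update_self] at hb
      rw [if_pos le_rfl] at hj
      have hba := hinc.2.2 b hb a (List.mem_singleton_self a)
      have ha := h.lt_partialLength i a (by simp [hL])
      omega
    · rw [Function.update_of_ne hji.ne] at hb
      rw [if_neg (not_le.2 hji), add_zero] at hj
      exact hj ▸ h.lt_partialLength j b hb
  · have htotal := hpartial (Fin.last N)
    rw [if_pos (Fin.le_last i), partialLength_last, h.length_eq, partialLength_last] at htotal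
    exact (Nat.add_right_cancel htotal).symm

lemma IsPreIndex.exists_word {α : Fin (N + 1) → List ℕ} (h : IsPreIndex d α) :
    ∃ w : List (Fin (N + 1)), w.length = d ∧ ofWord w = α := by
  induction d generalizing α with
  | zero =>
    refine ⟨[], rfl, funext fun i => ?_⟩
    have hlength := Finset.sum_eq_zero_iff.1 h.length_eq i (Finset.mem_univ i)
    exact (List.length_eq_zero_iff.1 hlength).symm
  | succ d ih =>
    obtain ⟨i, L, a, hL, ha, hlast⟩ := h.exists_last
    obtain ⟨w, hw, hα⟩ := ih (h.update_of_eq_concat hL hlast)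
    have hpartial := partialLength_update_concat α i L a i
    rw [← hL, Function.update_eq_self, if_pos le_rfl, ← ha] at hpartial
    refine ⟨i :: w, by rw [List.length_cons, hw], ?_⟩
    rw [ofWord, hα, Function.update_self, Function.update_idem,
      ← Nat.add_right_cancel hpartial, ← hL, Function.update_eq_self]

lemma le_getLast_of_head?_ofWord {w : List (Fin (N + 1))} (hw : w ≠ []) {j : Fin (N + 1)}
    (hj : (ofWord w j).head? = some 0) : j ≤ w.getLast hw := by
  induction w generalizing j with
  | nil => exact absurd rfl hw
  | cons i w ih =>
    rcases eq_or_ne w [] with rfl | hw'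
    · by_cases hji : j = i
      · simp [hji]
      · simp [ofWord, Function.update_of_ne hji] at hj
    · rw [List.getLast_cons hw']
      rcases eq_or_ne j i with rfl | hji
      · rw [ofWord, Function.update_self] at hj
        rcases eq_or_ne (ofWord w j) [] with hnil | hne
        · simp only [hnil, List.nil_append, List.head?_cons, Option.some.injEq] at hj
          by_contra hlt
          have hcount := length_le_partialLength (ofWord w) (not_le.1 hlt).le
          rw [hj, length_ofWord] at hcount
          exact (List.count_pos_iff.2 (List.getLast_mem hw')).not_ge hcount
        · rw [List.head?_append_of_ne_nil _ hne] at hj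
          exact ih hw' hj
      · rw [ofWord, Function.update_of_ne hji] at hj
        exact ih hw' hj

lemma IsIndex.isPreIndex {α : Fin (N + 1) → List ℕ} (h : IsIndex d α) : IsPreIndex d α :=
  ⟨h.increasing, h.lt_partialLength, h.length_eq⟩

lemma head_lt_getLast_of_isIndex {i : Fin (N + 1)} {w : List (Fin (N + 1))} (hw : w ≠ [])
    (h : IsIndex d (ofWord (i :: w))) : i < w.getLast hw := by
  obtain ⟨i₀, hhead, hself, hafter⟩ := h.exists_head_zero
  have hi₀ := le_getLast_of_head?_ofWord (List.cons_ne_nil i w) hhead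
  rw [List.getLast_cons hw] at hi₀
  have hlast : partialLength (ofWord w) i ∈ (ofWord (i :: w) i).getLast? := by
    rw [ofWord, Function.update_self]
    simp
  have hpartial := partialLength_ofWord_cons i w
  have hle : i ≤ i₀ := by
    by_contra hlt
    exact (hafter i (not_le.1 hlt) _ hlast).ne hpartial.symm
  refine lt_of_le_of_ne (hle.trans hi₀) fun heq => ?_
  obtain rfl : i = i₀ := le_antisymm hle (hi₀.trans heq.ge)
  have hcount : 0 < w.count i := List.count_pos_iff.2 (heq ▸ List.getLast_mem hw)
  have hlength : 1 < (ofWord (i :: w) i).length := by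
    rw [length_ofWord, List.count_cons_self]
    omega
  exact (hself hlength _ hlast).ne hpartial.symm

lemma diffHom_le_span_ofWord (N d : ℕ) : diffHom N d ≤ Submodule.span ℂ (Set.range
    fun w : Fin d → Fin (N + 1) => W (fun i j => (X (i, j) : V N)) (ofWord (List.ofFn w))) := by
  intro P hP
  refine Submodule.span_le.2 ?_ (mem_span_W hP)
  rintro _ ⟨α, hα, rfl⟩
  obtain ⟨w, rfl, rfl⟩ := hα.exists_word
  exact Submodule.subset_span ⟨w.get, by simp⟩

lemma card_pairs_lt (n : ℕ) :
    Fintype.card {p : Fin n × Fin n // p.1 < p.2} = n * (n - 1) / 2 := by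
  have hcard : ∀ b : Fin n, (Finset.univ.filter fun a : Fin n => a < b).card = b := fun b => by
    rw [← Fin.card_Iio b]
    congr 1
    ext
    simp
  rw [Fintype.card_subtype, Finset.card_filter, ← Finset.univ_product_univ,
    Finset.sum_product_right]
  simp_rw [← Finset.card_filter, hcard]
  rw [Fin.sum_univ_eq_sum_range (fun i => i), Finset.sum_range_id]

lemma encard_le_of_subset_range {ι M : Type*} [Fintype ι] {s : Set M} {f : ι → M}
    (h : s ⊆ Set.range f) : s.encard ≤ Fintype.card ι := by
  rw [← ENat.card_eq_coe_fintype_card, ← Set.encard_univ]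
  exact (Set.encard_le_encard (h.trans Set.image_univ.ge)).trans (Set.encard_image_le f Set.univ)

theorem encard_genFamily_le {A : Type*} [CommRing A] (x : Fin (N + 1) → ℕ → A)
    (hd : 1 ≤ d) : (genFamily x d).encard ≤ (numGen N d : ℕ∞) := by
  obtain rfl | ⟨e, rfl⟩ : d = 1 ∨ ∃ e, d = e + 2 := by
    obtain hd | hd := hd.eq_or_lt
    exacts [.inl hd.symm, .inr ⟨d - 2, by omega⟩]
  · have hrange : genFamily x 1 ⊆ Set.range fun i => W x (ofWord [i]) := by
      rintro _ ⟨α, hα, rfl⟩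
      obtain ⟨w, hw, rfl⟩ := hα.isPreIndex.exists_word
      obtain ⟨i, rfl⟩ := List.length_eq_one_iff.1 hw
      exact ⟨i, rfl⟩
    simpa [numGen] using encard_le_of_subset_range hrange
  -- The word of a generator is determined by its middle part and its two extreme letters.
  · have hrange : genFamily x (e + 2) ⊆ Set.range
        fun t : {p : Fin (N + 1) × Fin (N + 1) // p.1 < p.2} × (Fin e → Fin (N + 1)) =>
          W x (ofWord (t.1.1.1 :: (List.ofFn t.2 ++ [t.1.1.2]))) := by
      rintro _ ⟨α, hα, rfl⟩
      obtain ⟨w, hw, rfl⟩ := hα.isPreIndex.exists_word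
      obtain ⟨i, w, rfl⟩ := List.exists_cons_of_length_eq_add_one hw
      have hne : w ≠ [] := by
        rintro rfl
        simp at hw
      obtain rfl : w.dropLast.length = e := by simp_all
      refine ⟨(⟨(i, w.getLast hne), head_lt_getLast_of_isIndex hne hα⟩, w.dropLast.get), ?_⟩
      simp only [List.ofFn_get, List.dropLast_append_getLast]
    refine (encard_le_of_subset_range hrange).trans (le_of_eq ?_)
    simp [card_pairs_lt, numGen, mul_comm]

end Words

section Limits

section CommRing

variable {R A : Type*} [CommRing R] [CommRing A] [Algebra R A]

lemma algebraMap_series (k : PowerSeries R) :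
    algebraMap (PowerSeries R) (PowerSeries A) k = PowerSeries.map (algebraMap R A) k := rfl

lemma coeff_series_smul (k : PowerSeries R) (p : PowerSeries A) (n : ℕ) :
    PowerSeries.coeff n (k • p) = ∑ x ∈ Finset.HasAntidiagonal.antidiagonal n,
      PowerSeries.coeff x.1 k • PowerSeries.coeff x.2 p := by
  simp only [Algebra.smul_def, algebraMap_series, PowerSeries.coeff_mul, PowerSeries.coeff_map]

lemma constantCoeff_series_smul (k : PowerSeries R) (p : PowerSeries A) :
    PowerSeries.constantCoeff (k • p) =
      PowerSeries.constantCoeff k • PowerSeries.constantCoeff p := by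
  simpa using coeff_series_smul k p 0

lemma X_pow_series_smul (m : ℕ) (p : PowerSeries A) :
    (PowerSeries.X : PowerSeries R) ^ m • p = PowerSeries.X ^ m * p := by
  rw [Algebra.smul_def, algebraMap_series, map_pow, PowerSeries.map_X]

lemma map_series_smul {B : Type*} [CommRing B] [Algebra R B] (f : A →ₐ[R] B) (k : PowerSeries R)
    (p : PowerSeries A) :
    PowerSeries.map (f : A →+* B) (k • p) = k • PowerSeries.map (f : A →+* B) p := by
  ext1 n
  simp only [PowerSeries.coeff_map, coeff_series_smul, map_sum, RingHom.coe_coe, map_smul]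

lemma map_series_smul_eq_mul (f : A →ₐ[R] R) (k : PowerSeries R) (p : PowerSeries A) :
    PowerSeries.map (f : A →+* R) (k • p) = k * PowerSeries.map (f : A →+* R) p := by
  ext1 n
  simp only [coeff_series_smul, PowerSeries.coeff_map, map_sum, RingHom.coe_coe, map_smul,
    PowerSeries.coeff_mul, smul_eq_mul]

/-- The limit at the closed point of a family of vectors over `R⟦ε⟧`: the constant
coefficients of the elements of the saturation. -/
def limitSpace (E : Submodule (PowerSeries R) (PowerSeries A)) : Submodule R A where
  carrier := {v | ∃ (p : PowerSeries A) (m : ℕ),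
    (PowerSeries.X : PowerSeries R) ^ m • p ∈ E ∧ PowerSeries.constantCoeff p = v}
  add_mem' := by
    rintro _ _ ⟨p, m, hp, rfl⟩ ⟨q, l, hq, rfl⟩
    refine ⟨p + q, m + l, ?_, map_add _ _ _⟩
    have hsplit : (PowerSeries.X : PowerSeries R) ^ (m + l) • (p + q) =
        (PowerSeries.X : PowerSeries R) ^ l • ((PowerSeries.X : PowerSeries R) ^ m • p) +
        (PowerSeries.X : PowerSeries R) ^ m • ((PowerSeries.X : PowerSeries R) ^ l • q) := by
      rw [smul_smul, smul_smul, ← pow_add, ← pow_add, add_comm l m, smul_add]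
    rw [hsplit]
    exact add_mem (E.smul_mem _ hp) (E.smul_mem _ hq)
  zero_mem' := ⟨0, 0, by simp, map_zero _⟩
  smul_mem' := by
    rintro c _ ⟨p, m, hp, rfl⟩
    refine ⟨PowerSeries.C c • p, m, ?_, ?_⟩
    · rw [smul_comm]
      exact E.smul_mem _ hp
    · rw [constantCoeff_series_smul, PowerSeries.constantCoeff_C]

lemma limitSpace_mono {E E' : Submodule (PowerSeries R) (PowerSeries A)} (h : E ≤ E') :
    limitSpace E ≤ limitSpace E' := by
  rintro _ ⟨p, m, hp, rfl⟩
  exact ⟨p, m, h hp, rfl⟩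

lemma mul_mem_limitSpace {E E' : Submodule (PowerSeries R) (PowerSeries A)} {v v' : A}
    (hv : v ∈ limitSpace E) (hv' : v' ∈ limitSpace E') : v * v' ∈ limitSpace (E * E') := by
  obtain ⟨p, m, hp, rfl⟩ := hv
  obtain ⟨q, l, hq, rfl⟩ := hv'
  refine ⟨p * q, m + l, ?_, map_mul _ _ _⟩
  rw [pow_add, ← smul_mul_smul_comm]
  exact Submodule.mul_mem_mul hp hq

lemma linearIndependent_of_constantCoeff {ι : Type*} {p : ι → PowerSeries A}
    (h : LinearIndependent R fun i => PowerSeries.constantCoeff (p i)) :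
    LinearIndependent (PowerSeries R) p := by
  rw [linearIndependent_iff'] at h ⊢
  intro s k hk i hi
  ext n
  induction n using Nat.strong_induction_on generalizing i with
  | _ n ih =>
    refine h s (fun i => PowerSeries.coeff n (k i)) ?_ i hi
    have hcoeff : ∀ i ∈ s, PowerSeries.coeff n (k i • p i) =
        PowerSeries.coeff n (k i) • PowerSeries.constantCoeff (p i) := fun i hi => by
      rw [coeff_series_smul, Finset.sum_eq_single (n, 0) ?_ (by simp),
        PowerSeries.coeff_zero_eq_constantCoeff_apply]
      rintro ⟨a, b⟩ hab hne
      rw [Finset.HasAntidiagonal.mem_antidiagonal] at hab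
      rw [ih a (by grind) i hi, map_zero, zero_smul R]
    rw [← Finset.sum_congr rfl hcoeff, ← map_sum, hk, map_zero]

/-- A linear form applied to all coefficients of a power series. -/
def coeffwise (l : A →ₗ[R] R) : PowerSeries A →ₗ[PowerSeries R] PowerSeries R where
  toFun p := PowerSeries.mk fun n => l (PowerSeries.coeff n p)
  map_add' p q := by ext n; simp
  map_smul' k p := by
    ext n
    simp only [PowerSeries.coeff_mk, coeff_series_smul, map_sum, map_smul, RingHom.id_apply,
      smul_eq_mul, PowerSeries.coeff_mul]

lemma coeff_coeffwise (l : A →ₗ[R] R) (p : PowerSeries A) (n : ℕ) :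
    PowerSeries.coeff n (coeffwise l p) = l (PowerSeries.coeff n p) :=
  PowerSeries.coeff_mk n fun n => l (PowerSeries.coeff n p)

/-- Otherwise the leading coefficient of `f` would be a nonzero element of the limit space on which
all the forms vanish. -/
lemma eq_zero_of_coeffwise_eq_zero {E : Submodule (PowerSeries R) (PowerSeries A)} {ι : Type*}
    {l : ι → A →ₗ[R] R} (hl : ∀ v ∈ limitSpace E, (∀ i, l i v = 0) → v = 0)
    {f : PowerSeries A} (hf : f ∈ E) (h : ∀ i, coeffwise (l i) f = 0) : f = 0 := by
  rw [← PowerSeries.constantCoeff_divXPowOrder_eq_zero_iff]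
  refine hl _ ⟨f.divXPowOrder, f.order.toNat, ?_, rfl⟩ fun i => ?_
  · rwa [X_pow_series_smul, PowerSeries.X_pow_order_mul_divXPowOrder]
  · rw [PowerSeries.constantCoeff_divXPowOrder, ← coeff_coeffwise, h i, map_zero]

lemma linearIndependent_smul [IsDomain R] {M ι : Type*} [AddCommGroup M] [Module R M]
    {v : ι → M} (hv : LinearIndependent R v) {a : ι → R} (ha : ∀ i, a i ≠ 0) :
    LinearIndependent R fun i => a i • v i := by
  rw [linearIndependent_iff'] at hv ⊢
  intro s k hk i hi
  simp only [smul_smul] at hk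
  exact (mul_eq_zero.1 (hv s _ hk i hi)).resolve_right (ha i)

end CommRing

variable {K A T : Type*} [Field K] [CommRing A] [Algebra K A] [Fintype T]
  {E : Submodule (PowerSeries K) (PowerSeries A)} {g : T → PowerSeries A}

lemma finrank_le_of_le_limitSpace (hE : E ≤ Submodule.span _ (Set.range g)) {D : Submodule K A}
    [FiniteDimensional K D] (hD : D ≤ limitSpace E) : Module.finrank K D ≤ Fintype.card T := by
  classical
  let b := Module.finBasis K D
  choose p m hp hpb using fun i => hD (b i).2
  have hb : LinearIndependent K fun i => (b i : A) :=
    b.linearIndependent.map' D.subtype D.ker_subtype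
  have hXp : LinearIndependent (PowerSeries K)
      fun i => (PowerSeries.X : PowerSeries K) ^ m i • p i :=
    linearIndependent_smul (linearIndependent_of_constantCoeff (by simpa only [hpb] using hb))
      fun i => pow_ne_zero _ PowerSeries.X_ne_zero
  have hle := linearIndependent_le_span_aux' _ hXp (Set.range g)
    (Set.range_subset_iff.2 fun i => hE (hp i))
  rw [Fintype.card_fin] at hle
  exact hle.trans (Fintype.card_range_le g)

lemma card_le_finrank_limitSpace (hg : LinearIndependent (PowerSeries K) g) (hE : ∀ t, g t ∈ E)
    [FiniteDimensional K (limitSpace E)] :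
    Fintype.card T ≤ Module.finrank K (limitSpace E) := by
  let b := Module.finBasis K (limitSpace E)
  obtain ⟨l, hl⟩ := LinearMap.exists_extend b.equivFun.toLinearMap
  have hsep : ∀ v ∈ limitSpace E, (∀ i, (LinearMap.proj i ∘ₗ l) v = 0) → v = 0 :=
    fun v hv hlv => by
      have hbv : b.equivFun ⟨v, hv⟩ = 0 :=
        (LinearMap.congr_fun hl ⟨v, hv⟩).symm.trans (funext hlv)
      exact congrArg Subtype.val (b.equivFun.map_eq_zero_iff.1 hbv)
  let L : PowerSeries A →ₗ[PowerSeries K] (Fin (Module.finrank K (limitSpace E)) → PowerSeries K) :=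
    LinearMap.pi fun i => coeffwise (LinearMap.proj i ∘ₗ l)
  have hinj : Function.Injective (L ∘ₗ Fintype.linearCombination (PowerSeries K) g) := by
    rw [← LinearMap.ker_eq_bot, LinearMap.ker_eq_bot']
    intro k hk
    rw [LinearMap.comp_apply, Fintype.linearCombination_apply] at hk
    refine funext fun t => Fintype.linearIndependent_iff.1 hg k ?_ t
    exact eq_zero_of_coeffwise_eq_zero hsep (sum_mem fun t _ => E.smul_mem _ (hE t))
      (congrFun hk)
  simpa using card_le_of_injective (PowerSeries K) _ hinj

end Limits

section ExpSeries

variable {N : ℕ}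

/-- The series `∑_j (c ε)^j / j! X_i^{(j)}`, the value at `c ε` of the generic power series. -/
def expSeries (i : Fin (N + 1)) (c : ℂ) : PowerSeries (V N) :=
  PowerSeries.mk fun j => (c ^ j / (j.factorial : ℂ)) • X (i, j)

lemma map_act_expSeries (α : (PowerSeries ℂ)ˣ) (i : Fin (N + 1)) (c : ℂ) :
    PowerSeries.map (act (N := N) α : V N →+* V N) (expSeries i c) =
      PowerSeries.rescale c (α : PowerSeries ℂ) • expSeries i c := by
  ext1 n
  rw [coeff_series_smul, PowerSeries.coeff_map, expSeries, PowerSeries.coeff_mk,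
    Finset.Nat.sum_antidiagonal_eq_sum_range_succ_mk, RingHom.coe_coe, map_smul, act_X,
    Finset.smul_sum]
  refine Finset.sum_congr rfl fun l hl => ?_
  have hln : l ≤ n := Nat.lt_succ_iff.1 (Finset.mem_range.1 hl)
  rw [PowerSeries.coeff_rescale, PowerSeries.coeff_mk, smul_smul, smul_smul]
  congr 1
  have hfact : ((n - l).factorial : ℂ) ≠ 0 := mod_cast (n - l).factorial_ne_zero
  have hdesc : (n.descFactorial l : ℂ) ≠ 0 :=
    Nat.cast_ne_zero.2 (by rw [Ne, Nat.descFactorial_eq_zero_iff_lt]; omega)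
  rw [← Nat.factorial_mul_descFactorial hln, ← Nat.add_sub_cancel' hln, pow_add,
    Nat.add_sub_cancel' hln]
  push_cast
  field_simp

variable {ι : Type*} [Fintype ι]

/-- The product of the values at `c l ε` of the components `w l` of the generic power series. -/
def prodSeries (c : ι → ℂ) (w : ι → Fin (N + 1)) : PowerSeries (V N) :=
  ∏ l, expSeries (w l) (c l)

/-- The space of multilinear expressions in the values of the generic power series. -/
def valueSpan (N : ℕ) (c : ι → ℂ) : Submodule (PowerSeries ℂ) (PowerSeries (V N)) :=
  Submodule.span _ (Set.range (prodSeries c))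

lemma map_act_of_mem_valueSpan {c : ι → ℂ} {q : PowerSeries (V N)} (hq : q ∈ valueSpan N c)
    (α : (PowerSeries ℂ)ˣ) : PowerSeries.map (act (N := N) α : V N →+* V N) q =
      (∏ l, PowerSeries.rescale (c l) (α : PowerSeries ℂ)) • q := by
  induction hq using Submodule.span_induction with
  | mem q hq =>
    obtain ⟨w, rfl⟩ := hq
    rw [prodSeries, map_prod, ← Finset.prod_smul]
    exact Finset.prod_congr rfl fun l _ => map_act_expSeries α (w l) (c l)
  | zero => rw [map_zero, smul_zero]
  | add p q _ _ hp hq => rw [map_add, hp, hq, smul_add]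
  | smul k q _ hq => rw [map_series_smul, hq, smul_comm]

lemma constantCoeff_rescale {R : Type*} [CommSemiring R] (c : R) (f : PowerSeries R) :
    PowerSeries.constantCoeff (PowerSeries.rescale c f) = PowerSeries.constantCoeff f := by
  rw [← PowerSeries.coeff_zero_eq_constantCoeff_apply, PowerSeries.coeff_rescale, pow_zero,
    one_mul, PowerSeries.coeff_zero_eq_constantCoeff_apply]

lemma limitSpace_valueSpan_le (c : ι → ℂ) :
    limitSpace (valueSpan N c) ≤ diffHom N (Fintype.card ι) := by
  rintro _ ⟨p, m, hp, rfl⟩ α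
  have hmap : PowerSeries.map (act (N := N) α : V N →+* V N) p =
      (∏ l, PowerSeries.rescale (c l) (α : PowerSeries ℂ)) • p := by
    have hX := map_act_of_mem_valueSpan hp α
    rw [map_series_smul, smul_comm, X_pow_series_smul, X_pow_series_smul] at hX
    exact mul_left_cancel₀ (pow_ne_zero m PowerSeries.X_ne_zero) hX
  have hconst := congrArg PowerSeries.constantCoeff hmap
  simp only [constantCoeff_series_smul, map_prod, constantCoeff_rescale, Finset.prod_const,
    Finset.card_univ] at hconst
  rwa [← PowerSeries.coeff_zero_eq_constantCoeff_apply, PowerSeries.coeff_map,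
    PowerSeries.coeff_zero_eq_constantCoeff_apply] at hconst

/-- The value at `c ε` of the `i`-th component of the power series of degree at most `d` with
coefficients `x (i, j) / j!`. Unlike in `expSeries`, the coefficients may depend on `ε`. -/
def truncExp (d : ℕ) (x : Fin (N + 1) × ℕ → PowerSeries ℂ) (i : Fin (N + 1)) (c : ℂ) :
    PowerSeries ℂ :=
  ∑ j ∈ Finset.range (d + 1), PowerSeries.monomial j (c ^ j / (j.factorial : ℂ)) * x (i, j)

lemma map_aeval_expSeries (d : ℕ) (y : Fin (N + 1) × ℕ → ℂ) (i : Fin (N + 1)) (c : ℂ) :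
    PowerSeries.map
        ((aeval fun v => if v.2 < d + 1 then y v else 0 : V N →ₐ[ℂ] ℂ) : V N →+* ℂ)
        (expSeries i c) =
      truncExp d (fun v => PowerSeries.C (y v)) i c := by
  ext n
  rw [PowerSeries.coeff_map, expSeries, PowerSeries.coeff_mk, truncExp, map_sum, RingHom.coe_coe,
    map_smul, aeval_X]
  simp only [PowerSeries.coeff_mul_C, PowerSeries.coeff_monomial, ite_mul, zero_mul,
    Finset.sum_ite_eq, Finset.mem_range, smul_eq_mul, mul_ite, mul_zero]

/-- The left-hand side is polynomial in `x`, and for constant `x` the identity is obtained by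
specializing the variables. -/
lemma sum_mul_prod_truncExp_eq_zero [DecidableEq ι] {c : ι → ℂ}
    {k : (ι → Fin (N + 1)) → PowerSeries ℂ}
    (hk : ∑ w, k w • prodSeries c w = 0) (d : ℕ) (x : Fin (N + 1) × ℕ → PowerSeries ℂ) :
    ∑ w, k w * ∏ l, truncExp d x (w l) (c l) = 0 := by
  let R : MvPolynomial (Fin (N + 1) × ℕ) (PowerSeries ℂ) := ∑ w, C (k w) * ∏ l,
    ∑ j ∈ Finset.range (d + 1),
      C (PowerSeries.monomial j (c l ^ j / (j.factorial : ℂ))) * X (w l, j)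
  have eval_R : ∀ x, eval x R = ∑ w, k w * ∏ l, truncExp d x (w l) (c l) := fun x => by
    simp only [R, truncExp, map_sum, map_mul, map_prod, eval_C, eval_X]
  suffices R = 0 by rw [← eval_R, this, map_zero]
  refine MvPolynomial.funext_set (fun _ => Set.range PowerSeries.C)
    (fun _ => Set.infinite_range_of_injective PowerSeries.C_injective) fun x hx => ?_
  choose y hy using fun v => hx v (Set.mem_univ v)
  obtain rfl : (fun v => PowerSeries.C (y v)) = x := funext hy
  have hmap := congrArg (PowerSeries.map
    ((aeval fun v => if v.2 < d + 1 then y v else 0 : V N →ₐ[ℂ] ℂ) : V N →+* ℂ)) hk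
  rw [map_zero, eval_R]
  simpa only [prodSeries, map_sum, map_zero, map_series_smul_eq_mul, map_prod,
    map_aeval_expSeries] using hmap

/-- The `i`-th component is the Lagrange interpolation polynomial at the nodes `c l`, made
homogeneous in `ε`. -/
lemma exists_truncExp_eq_ite {c : ι → ℂ} (hc : Function.Injective c) (w : ι → Fin (N + 1)) :
    ∃ x : Fin (N + 1) × ℕ → PowerSeries ℂ, ∀ i l,
      truncExp (Fintype.card ι) x i (c l) =
        if w l = i then PowerSeries.X ^ Fintype.card ι else 0 := by
  classical
  set d := Fintype.card ι
  let f : Fin (N + 1) → Polynomial ℂ := fun i =>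
    Lagrange.interpolate Finset.univ c fun l => if w l = i then 1 else 0
  have eval_f : ∀ i l, (f i).eval (c l) = if w l = i then 1 else 0 := fun i l =>
    Lagrange.eval_interpolate_at_node _ hc.injOn (Finset.mem_univ l)
  have natDegree_f : ∀ i, (f i).natDegree < d + 1 := fun i => Nat.lt_succ_of_le
    (Polynomial.natDegree_le_of_degree_le (Lagrange.degree_interpolate_lt _ hc.injOn).le)
  refine ⟨fun v => PowerSeries.monomial (d - v.2) ((v.2.factorial : ℂ) * (f v.1).coeff v.2),
    fun i l => ?_⟩
  have hterm : ∀ j ∈ Finset.range (d + 1),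
      PowerSeries.monomial j (c l ^ j / (j.factorial : ℂ)) *
        PowerSeries.monomial (d - j) ((j.factorial : ℂ) * (f i).coeff j) =
      PowerSeries.monomial d ((f i).coeff j * c l ^ j) := fun j hj => by
    have hfact : (j.factorial : ℂ) ≠ 0 := mod_cast j.factorial_ne_zero
    rw [PowerSeries.monomial_mul_monomial,
      Nat.add_sub_cancel' (Nat.lt_succ_iff.1 (Finset.mem_range.1 hj))]
    congr 1
    field_simp
  rw [truncExp, Finset.sum_congr rfl hterm, ← map_sum,
    ← Polynomial.eval_eq_sum_range' (natDegree_f i), eval_f]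
  split_ifs
  · rw [PowerSeries.X_pow_eq]
  · rw [map_zero]

lemma linearIndependent_prodSeries {c : ι → ℂ} (hc : Function.Injective c) :
    LinearIndependent (PowerSeries ℂ) (prodSeries (N := N) c) := by
  classical
  rw [Fintype.linearIndependent_iff]
  intro k hk w
  obtain ⟨x, hx⟩ := exists_truncExp_eq_ite hc w
  have hsum := sum_mul_prod_truncExp_eq_zero hk (Fintype.card ι) x
  simp only [hx] at hsum
  rw [Finset.sum_eq_single w ?_ (by simp)] at hsum
  · simp only [if_true, Finset.prod_const] at hsum
    exact (mul_eq_zero.1 hsum).resolve_right (pow_ne_zero _ (pow_ne_zero _ PowerSeries.X_ne_zero))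
  · intro w' _ hw
    obtain ⟨l, hl⟩ := Function.ne_iff.1 hw
    rw [Finset.prod_eq_zero (Finset.mem_univ l) (if_neg (Ne.symm hl)), mul_zero]

instance finiteDimensional_diffHom (N d : ℕ) : FiniteDimensional ℂ (diffHom N d) :=
  have := FiniteDimensional.span_of_finite ℂ (Set.finite_range
    fun w : Fin d → Fin (N + 1) => W (fun i j => (X (i, j) : V N)) (ofWord (List.ofFn w)))
  Submodule.finiteDimensional_of_le (diffHom_le_span_ofWord N d)

lemma finrank_diffHom_le (N d : ℕ) : Module.finrank ℂ (diffHom N d) ≤ (N + 1) ^ d := by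
  classical
  have := FiniteDimensional.span_of_finite ℂ (Set.finite_range
    fun w : Fin d → Fin (N + 1) => W (fun i j => (X (i, j) : V N)) (ofWord (List.ofFn w)))
  have hle := (Submodule.finrank_mono (diffHom_le_span_ofWord N d)).trans
    (finrank_range_le_card _)
  rwa [Fintype.card_fun, Fintype.card_fin, Fintype.card_fin] at hle

lemma card_le_finrank_limitSpace_valueSpan {c : ι → ℂ} (hc : Function.Injective c) :
    (N + 1) ^ Fintype.card ι ≤ Module.finrank ℂ (limitSpace (valueSpan N c)) := by
  classical
  have := Submodule.finiteDimensional_of_le (limitSpace_valueSpan_le (N := N) c)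
  have hle := card_le_finrank_limitSpace (linearIndependent_prodSeries (N := N) hc)
    (E := valueSpan N c) fun w => Submodule.subset_span ⟨w, rfl⟩
  rwa [Fintype.card_fun, Fintype.card_fin] at hle

lemma diffHom_le_limitSpace {c : ι → ℂ} (hc : Function.Injective c) :
    diffHom N (Fintype.card ι) ≤ limitSpace (valueSpan N c) :=
  (Submodule.eq_of_le_of_finrank_le (limitSpace_valueSpan_le c)
    ((finrank_diffHom_le N _).trans (card_le_finrank_limitSpace_valueSpan hc))).ge

theorem finrank_diffHom (N d : ℕ) : Module.finrank ℂ (diffHom N d) = (N + 1) ^ d := by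
  refine le_antisymm (finrank_diffHom_le N d) ?_
  let c : Fin d → ℂ := fun i => (i : ℕ)
  have hc : Function.Injective c := Nat.cast_injective.comp Fin.val_injective
  have hle := (card_le_finrank_limitSpace_valueSpan (N := N) hc).trans
    (Submodule.finrank_mono (limitSpace_valueSpan_le c))
  rwa [Fintype.card_fin] at hle

lemma mul_mem_limitSpace_valueSpan {c : ι → ℂ} (s : Finset ι)
    (hs : Set.InjOn c s) (hs' : Set.InjOn c (s : Set ι)ᶜ) {p q : V N}
    (hp : p ∈ diffHom N s.card) (hq : q ∈ diffHom N (Fintype.card ι - s.card)) :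
    p * q ∈ limitSpace (valueSpan N c) := by
  classical
  have hp_lim : p ∈ limitSpace (valueSpan N fun l : {l // l ∈ s} => c l) := by
    refine diffHom_le_limitSpace (c := fun l : {l // l ∈ s} => c l)
      (fun l l' h => Subtype.ext (hs l.2 l'.2 h)) ?_
    rwa [Fintype.card_coe]
  have hq_lim : q ∈ limitSpace (valueSpan N fun l : {l // ¬ l ∈ s} => c l) := by
    refine diffHom_le_limitSpace (c := fun l : {l // ¬ l ∈ s} => c l)
      (fun l l' h => Subtype.ext (hs' l.2 l'.2 h)) ?_
    rwa [Fintype.card_subtype_compl, Fintype.card_coe]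
  refine limitSpace_mono ?_ (mul_mem_limitSpace hp_lim hq_lim)
  rw [valueSpan, valueSpan, Submodule.span_mul_span, Submodule.span_le]
  rintro _ ⟨_, ⟨w, rfl⟩, _, ⟨w', rfl⟩, rfl⟩
  refine Submodule.subset_span ⟨fun l => if h : l ∈ s then w ⟨l, h⟩ else w' ⟨l, h⟩, ?_⟩
  simp only [prodSeries]
  rw [← Fintype.prod_subtype_mul_prod_subtype (fun l => l ∈ s)]
  congr 1
  · exact Finset.prod_congr (Finset.ext fun _ => by simp) fun l _ => by rw [dif_pos l.2]
  · exact Finset.prod_congr (Finset.ext fun _ => by simp) fun l _ => by rw [dif_neg l.2]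

end ExpSeries

section Decomposable

variable {N : ℕ}

/-- The decomposable elements of degree `d`: sums of products of differentially homogeneous
polynomials of positive degrees. -/
def decomposable (N d : ℕ) : Submodule ℂ (V N) :=
  Submodule.span ℂ {P | ∃ a b, a + b = d ∧ 1 ≤ a ∧ 1 ≤ b ∧
    ∃ p ∈ diffHom N a, ∃ q ∈ diffHom N b, P = p * q}

lemma decomposable_le (N d : ℕ) : decomposable N d ≤ diffHom N d := by
  refine Submodule.span_le.2 ?_
  rintro _ ⟨a, b, rfl, -, -, p, hp, q, hq, rfl⟩
  exact SetLike.GradedMul.mul_mem hp hq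

lemma decomposable_of_le_one {d : ℕ} (hd : d ≤ 1) : decomposable N d = ⊥ := by
  rw [decomposable, Submodule.span_eq_bot]
  rintro _ ⟨a, b, h, ha, hb, -⟩
  omega

/-- The products `prodSeries c w` with `c 1 = c 0`: they depend only on the unordered pair of the
first two letters of `w`. -/
def symProdSeries {e : ℕ} (c : Fin (e + 2) → ℂ)
    (t : Sym2 (Fin (N + 1)) × (Fin e → Fin (N + 1))) : PowerSeries (V N) :=
  Sym2.lift ⟨fun i j => expSeries i (c 0) * expSeries j (c 0), fun _ _ => mul_comm _ _⟩ t.1 *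
    ∏ l : Fin e, expSeries (t.2 l) (c l.succ.succ)

lemma valueSpan_le_span_symProdSeries {e : ℕ} {c : Fin (e + 2) → ℂ} (hc : c 1 = c 0) :
    valueSpan N c ≤ Submodule.span _ (Set.range (symProdSeries c)) := by
  refine Submodule.span_mono ?_
  rintro _ ⟨w, rfl⟩
  refine ⟨(s(w 0, w 1), fun l => w l.succ.succ), ?_⟩
  rw [prodSeries, Fin.prod_univ_succ, Fin.prod_univ_succ, ← mul_assoc, Fin.succ_zero_eq_one, hc,
    symProdSeries, Sym2.lift_mk]

lemma decomposable_le_limitSpace {e : ℕ} {c : Fin (e + 2) → ℂ}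
    (hc : ∀ i j, c i = c j → i = j ∨ (i = 0 ∧ j = 1) ∨ (i = 1 ∧ j = 0)) :
    decomposable N (e + 2) ≤ limitSpace (valueSpan N c) := by
  refine Submodule.span_le.2 ?_
  rintro _ ⟨a, b, hab, ha, hb, p, hp, q, hq, rfl⟩
  obtain ⟨s, hs_zero, hs_one, rfl⟩ := Finset.exists_subsuperset_card_eq
    (s := {(0 : Fin (e + 2))}) (t := Finset.univ.erase 1) (n := a) (by simp) (by simpa using ha)
    (by rw [Finset.card_erase_of_mem (Finset.mem_univ _), Finset.card_univ, Fintype.card_fin]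
        omega)
  have h_zero : (0 : Fin (e + 2)) ∈ s := hs_zero (Finset.mem_singleton_self _)
  have h_one : (1 : Fin (e + 2)) ∉ s := fun h => Finset.ne_of_mem_erase (hs_one h) rfl
  refine mul_mem_limitSpace_valueSpan s (fun i hi j hj h => ?_) (fun i hi j hj h => ?_) hp
    (by rwa [show Fintype.card (Fin (e + 2)) - s.card = b by rw [Fintype.card_fin]; omega])
  · rcases hc i j h with h | ⟨-, rfl⟩ | ⟨rfl, -⟩
    · exact h
    · exact absurd hj h_one
    · exact absurd hi h_one
  · rcases hc i j h with h | ⟨rfl, -⟩ | ⟨-, rfl⟩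
    · exact h
    · exact absurd h_zero hi
    · exact absurd h_zero hj

/-- Any product of two factors is a limit of values at `d` points of which the first two
coincide. -/
lemma finrank_decomposable_le (N e : ℕ) :
    Module.finrank ℂ (decomposable N (e + 2)) ≤ (N + 2).choose 2 * (N + 1) ^ e := by
  let c : Fin (e + 2) → ℂ := fun i => ((i : ℕ) - 1 : ℕ)
  have hc01 : c 1 = c 0 := by simp [c]
  have hc : ∀ i j : Fin (e + 2), c i = c j → i = j ∨ (i = 0 ∧ j = 1) ∨ (i = 1 ∧ j = 0) := by
    intro i j h
    have hij : (i : ℕ) - 1 = (j : ℕ) - 1 := Nat.cast_injective h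
    simp only [Fin.ext_iff, Fin.val_zero, Fin.val_one]
    omega
  have := Submodule.finiteDimensional_of_le (decomposable_le N (e + 2))
  have hle := finrank_le_of_le_limitSpace (valueSpan_le_span_symProdSeries (N := N) hc01)
    (decomposable_le_limitSpace hc)
  rwa [Fintype.card_prod, Sym2.card, Fintype.card_fun, Fintype.card_fin, Fintype.card_fin] at hle

lemma div_two_mul_pow_add_choose_two_mul_pow (n e : ℕ) :
    n * (n + 1) / 2 * (n + 1) ^ e + (n + 2).choose 2 * (n + 1) ^ e = (n + 1) ^ (e + 2) := by
  have hchoose : (n + 2).choose 2 = n + 1 + n * (n + 1) / 2 := by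
    rw [Nat.choose_succ_succ' (n + 1) 1, Nat.choose_one_right, Nat.choose_two_right,
      Nat.add_sub_cancel, mul_comm]
  have heven : n * (n + 1) / 2 * 2 = n * (n + 1) :=
    Nat.div_mul_cancel (Nat.even_mul_succ_self n).two_dvd
  calc _ = (n * (n + 1) / 2 * 2 + (n + 1)) * (n + 1) ^ e := by rw [hchoose]; ring
    _ = (n + 1) ^ (e + 2) := by rw [heven]; ring

lemma numGen_add_finrank_decomposable_le {d : ℕ} (hd : 1 ≤ d) :
    numGen N d + Module.finrank ℂ (decomposable N d) ≤ (N + 1) ^ d := by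
  obtain rfl | ⟨e, rfl⟩ : d = 1 ∨ ∃ e, d = e + 2 := by
    obtain rfl | h := hd.eq_or_lt
    exacts [.inl rfl, .inr (Nat.exists_eq_add_of_le' h)]
  · rw [decomposable_of_le_one le_rfl, finrank_bot, numGen, if_pos rfl, pow_one]
  · rw [numGen, if_neg (by omega), Nat.add_sub_cancel, ← div_two_mul_pow_add_choose_two_mul_pow]
    exact Nat.add_le_add_left (finrank_decomposable_le N e) _

theorem numGen_le_card {d : ℕ} (hd : 1 ≤ d) (T : Finset (V N))
    (h : diffHom N d ≤ Submodule.span ℂ (T : Set (V N)) ⊔ decomposable N d) :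
    numGen N d ≤ T.card := by
  have := Submodule.finiteDimensional_of_le (decomposable_le N d)
  have := FiniteDimensional.span_of_finite ℂ T.finite_toSet
  have hle : numGen N d + Module.finrank ℂ (decomposable N d) ≤
      T.card + Module.finrank ℂ (decomposable N d) := calc
    _ ≤ Module.finrank ℂ (diffHom N d) :=
      (numGen_add_finrank_decomposable_le hd).trans_eq (finrank_diffHom N d).symm
    _ ≤ _ := Submodule.finrank_mono h
    _ ≤ Module.finrank ℂ (Submodule.span ℂ (T : Set (V N))) + _ :=
      Submodule.finrank_add_le_finrank_add_finrank _ _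
    _ ≤ _ := Nat.add_le_add_right (finrank_span_finset_le_card T) _
  exact Nat.le_of_add_le_add_right hle

end Decomposable

section Minimality

variable {N : ℕ}

lemma mem_diffHom_of_mem_G {d : ℕ} {P : V N} (hP : P ∈ G N d) : P ∈ diffHom N d := by
  obtain ⟨α, hα, rfl⟩ := hP
  exact W_mem_diffHom hα.length_eq

lemma X_mem_diffHom_one (i : Fin (N + 1)) : (X (i, 0) : V N) ∈ diffHom N 1 := by
  simpa [colDet] using colDet_mem_diffHom (N := N) (fun _ : Fin 1 => i) fun _ => 0

lemma X_mem_span_G_one (i : Fin (N + 1)) : (X (i, 0) : V N) ∈ Submodule.span ℂ (G N 1) :=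
  (AddSubgroup.closure_le (Submodule.span ℂ (G N 1)).toAddSubgroup).2 Submodule.subset_span
    (mem_genFamily_one (x := fun i j => (X (i, j) : V N)) i)

lemma X_mul_colDet_mem_span_G_sup {d : ℕ} (i : Fin (N + 1)) (w : Fin d → Fin (N + 1))
    (a : Fin d → ℕ) : X (i, 0) * colDet (fun i j => (X (i, j) : V N)) w a ∈
      Submodule.span ℂ (G N (d + 1)) ⊔ decomposable N (d + 1) := by
  rcases Nat.eq_zero_or_pos d with rfl | hd
  · rw [colDet, Matrix.det_fin_zero, mul_one]
    exact Submodule.mem_sup_left (X_mem_span_G_one i)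
  · exact Submodule.mem_sup_right (Submodule.subset_span ⟨1, d, add_comm _ _, le_rfl, hd,
      _, X_mem_diffHom_one i, _, colDet_mem_diffHom w a, rfl⟩)

lemma colDet_mem_span_G_sup {d : ℕ} (hd : 1 ≤ d) (w : Fin d → Fin (N + 1)) (a : Fin d → ℕ) :
    colDet (fun i j => (X (i, j) : V N)) w a ∈
      Submodule.span ℂ (G N d) ⊔ decomposable N d := by
  obtain ⟨e, rfl⟩ := Nat.exists_eq_add_of_le' hd
  exact colDet_mem_of_isIndex (A := V N)
    (Q := (Submodule.span ℂ (G N (e + 1)) ⊔ decomposable N (e + 1)).toAddSubgroup)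
    (fun α hα => Submodule.mem_sup_left (Submodule.subset_span ⟨α, hα, rfl⟩))
    X_mul_colDet_mem_span_G_sup w a

lemma diffHom_le_span_G_sup {d : ℕ} (hd : 1 ≤ d) :
    diffHom N d ≤ Submodule.span ℂ (G N d) ⊔ decomposable N d := by
  intro P hP
  refine Submodule.span_le.2 ?_ (mem_span_W hP)
  rintro _ ⟨α, hα, rfl⟩
  obtain rfl : (columns α).length = d := by rw [length_columns, hα.length_eq]
  exact colDet_mem_span_G_sup hd _ _

lemma finite_G {d : ℕ} (hd : 1 ≤ d) : (G N d).Finite :=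
  Set.finite_of_encard_le_coe (encard_genFamily_le _ hd)

theorem encard_G {d : ℕ} (hd : 1 ≤ d) : (G N d).encard = (numGen N d : ℕ∞) := by
  refine le_antisymm (encard_genFamily_le _ hd) ?_
  rw [(finite_G hd).encard_eq_coe_toFinset_card, Nat.cast_le]
  refine numGen_le_card hd _ ?_
  rw [Set.Finite.coe_toFinset]
  exact diffHom_le_span_G_sup hd

lemma notMem_span_sup_decomposable {d : ℕ} (hd : 1 ≤ d) {g : V N} (hg : g ∈ G N d) :
    g ∉ Submodule.span ℂ (G N d \ {g}) ⊔ decomposable N d := by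
  classical
  intro h
  have hle : diffHom N d ≤ Submodule.span ℂ (G N d \ {g}) ⊔ decomposable N d := by
    refine (diffHom_le_span_G_sup hd).trans (sup_le (Submodule.span_le.2 fun P hP => ?_)
      le_sup_right)
    by_cases hPg : P = g
    · rwa [hPg]
    · exact Submodule.mem_sup_left (Submodule.subset_span ⟨hP, hPg⟩)
  have hfin := finite_G (N := N) hd
  have hcard : hfin.toFinset.card = numGen N d := by
    rw [← Nat.cast_inj (R := ℕ∞), ← hfin.encard_eq_coe_toFinset_card, encard_G hd]
  refine (Finset.card_erase_lt_of_mem (hfin.mem_toFinset.2 hg)).not_ge ?_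
  rw [hcard]
  exact numGen_le_card hd _ (by simpa using hle)

lemma ne_zero_of_mem_G {d : ℕ} (hd : 1 ≤ d) {g : V N} (hg : g ∈ G N d) : g ≠ 0 := by
  rintro rfl
  exact notMem_span_sup_decomposable hd hg (zero_mem _)

lemma span_G_sup_decomposable_le (S : Set (V N)) (e : ℕ) :
    Submodule.span ℂ (S ∩ G N e) ⊔ decomposable N e ≤ diffHom N e :=
  sup_le (Submodule.span_le.2 fun _ hP => mem_diffHom_of_mem_G hP.2) (decomposable_le N e)

lemma eq_one_or_mem_span_sup_decomposable {k : ℕ} {S : Set (V N)}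
    (hS : S ⊆ ⋃ i ∈ Finset.Icc 1 k, G N i) {P : V N} (hP : P ∈ Submonoid.closure S) :
    P = 1 ∨ ∃ e, 1 ≤ e ∧ P ∈ Submodule.span ℂ (S ∩ G N e) ⊔ decomposable N e := by
  induction hP using Submonoid.closure_induction with
  | mem P hP =>
    obtain ⟨i, hi, hPi⟩ := Set.mem_iUnion₂.1 (hS hP)
    exact Or.inr ⟨i, (Finset.mem_Icc.1 hi).1,
      Submodule.mem_sup_left (Submodule.subset_span ⟨hP, hPi⟩)⟩
  | one => exact Or.inl rfl
  | mul P Q _ _ hP hQ =>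
    rcases hP with rfl | ⟨a, ha, hP⟩
    · rwa [one_mul]
    rcases hQ with rfl | ⟨b, hb, hQ⟩
    · rw [mul_one]
      exact Or.inr ⟨a, ha, hP⟩
    · exact Or.inr ⟨a + b, by omega, Submodule.mem_sup_right (Submodule.subset_span
        ⟨a, b, rfl, ha, hb, P, span_G_sup_decomposable_le S a hP, Q,
          span_G_sup_decomposable_le S b hQ, rfl⟩)⟩

lemma homogeneousComponent_mem_of_mem_adjoin {k : ℕ} {S : Set (V N)}
    (hS : S ⊆ ⋃ i ∈ Finset.Icc 1 k, G N i) {P : V N} (hP : P ∈ Algebra.adjoin ℂ S) {d : ℕ}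
    (hd : 1 ≤ d) :
    homogeneousComponent d P ∈ Submodule.span ℂ (S ∩ G N d) ⊔ decomposable N d := by
  rw [← Subalgebra.mem_toSubmodule, Algebra.adjoin_eq_span] at hP
  induction hP using Submodule.span_induction with
  | mem P hP =>
    rcases eq_one_or_mem_span_sup_decomposable hS hP with rfl | ⟨e, -, hP⟩
    · rw [homogeneousComponent_of_mem_diffHom (SetLike.GradedOne.one_mem (A := diffHom N)),
        if_neg (by omega)]
      exact zero_mem _
    · rw [homogeneousComponent_of_mem_diffHom (span_G_sup_decomposable_le S e hP)]
      split_ifs with hde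
      · rwa [hde]
      · exact zero_mem _
  | zero => rw [map_zero]; exact zero_mem _
  | add P Q _ _ hP hQ => rw [map_add]; exact add_mem hP hQ
  | smul c P _ hP => rw [map_smul]; exact Submodule.smul_mem _ c hP

lemma mem_of_mem_adjoin {k d : ℕ} {S : Set (V N)} (hS : S ⊆ ⋃ i ∈ Finset.Icc 1 k, G N i)
    (hd : 1 ≤ d) {g : V N} (hg : g ∈ G N d) (h : g ∈ Algebra.adjoin ℂ S) : g ∈ S := by
  by_contra hgS
  have hcomp := homogeneousComponent_mem_of_mem_adjoin hS h hd
  rw [homogeneousComponent_of_mem_diffHom (mem_diffHom_of_mem_G hg), if_pos rfl] at hcomp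
  have hsub : S ∩ G N d ⊆ G N d \ {g} := fun P hP => ⟨hP.2, fun hPg => hgS (hPg ▸ hP.1)⟩
  have hle : Submodule.span ℂ (S ∩ G N d) ⊔ decomposable N d ≤
      Submodule.span ℂ (G N d \ {g}) ⊔ decomposable N d :=
    sup_le_sup_right (Submodule.span_mono hsub) _
  exact notMem_span_sup_decomposable hd hg (hle hcomp)

theorem minimal_G (N k : ℕ) :
    Minimal (fun S : Set (V N) => Algebra.adjoin ℂ S = diffAlgLE N k)
      (⋃ i ∈ Finset.Icc 1 (k + 1), G N i) := by
  refine ⟨adjoin_G N k, fun S (hS : Algebra.adjoin ℂ S = _) hSle g hg => ?_⟩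
  obtain ⟨d, hd, hgd⟩ := Set.mem_iUnion₂.1 hg
  refine mem_of_mem_adjoin hSle (Finset.mem_Icc.1 hd).1 hgd ?_
  rw [hS, ← adjoin_G]
  exact Algebra.subset_adjoin hg

lemma finite_iUnion_G (N k : ℕ) : (⋃ i ∈ Finset.Icc 1 k, G N i).Finite :=
  (Finset.finite_toSet _).biUnion fun _ hi => finite_G (Finset.mem_Icc.1 hi).1

theorem fg_diffAlgLE (N k : ℕ) : (diffAlgLE N k).FG :=
  Subalgebra.fg_def.2 ⟨_, finite_iUnion_G N (k + 1), adjoin_G N k⟩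

theorem totalDegree_of_mem_G {d : ℕ} (hd : 1 ≤ d) {g : V N} (hg : g ∈ G N d) :
    g.totalDegree = d :=
  (isHomogeneous_of_mem_diffHom (mem_diffHom_of_mem_G hg)).totalDegree (ne_zero_of_mem_G hd hg)

lemma mem_orderLE_iff_order_le {k : ℕ} {P : V N} : P ∈ orderLE N k ↔ order P ≤ k := by
  rw [mem_orderLE, order, Finset.sup_le_iff]

/-- If `g` had order at most `d - 2`, it would be generated by the `G N i` with `i < d`, against
minimality. -/
theorem order_of_mem_G {d : ℕ} (hd : 1 ≤ d) {g : V N} (hg : g ∈ G N d) : order g = d - 1 := by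
  have hle : order g ≤ d - 1 := by
    obtain ⟨α, hα, rfl⟩ := hg
    exact mem_orderLE_iff_order_le.1 (W_mem_orderLE hα.length_eq (by omega))
  refine le_antisymm hle (not_lt.1 fun hlt => ?_)
  have hg_order : g ∈ orderLE N (d - 2) := mem_orderLE_iff_order_le.2 (by omega)
  obtain ⟨i, hi, hgi⟩ := Set.mem_iUnion₂.1 (mem_of_mem_adjoin subset_rfl hd hg
    (mem_adjoin_of_mem_diffHom (mem_diffHom_of_mem_G hg) hg_order))
  have hid : i = d := by
    rw [← totalDegree_of_mem_G (Finset.mem_Icc.1 hi).1 hgi, totalDegree_of_mem_G hd hg]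
  rw [Finset.mem_Icc] at hi
  omega

end Minimality

section Nilpotent

section Field

variable {K F : Type*} [Field K] [AddCommGroup F] [Module K F] {k : ℕ} {J : Module.End K F}

lemma pow_eq_zero_of_isNilpotent (hF : Module.finrank K F = k + 1) (hJ : IsNilpotent J) :
    J ^ (k + 1) = 0 := by
  have : FiniteDimensional K F := FiniteDimensional.of_finrank_pos (by omega)
  have hcharpoly := LinearMap.aeval_self_charpoly J
  rwa [hJ.charpoly_eq_X_pow_finrank, map_pow, Polynomial.aeval_X, hF] at hcharpoly

lemma linearIndependent_pow_apply (hJ : J ^ (k + 1) = 0) {v : F} (hv : (J ^ k) v ≠ 0) :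
    LinearIndependent K fun l : Fin (k + 1) => (J ^ (l : ℕ)) v := by
  rw [Fintype.linearIndependent_iff]
  intro c hc l
  induction l using WellFoundedLT.induction with
  | ind l ih =>
    have happly := congrArg (J ^ (k - l)) hc
    rw [map_sum, map_zero, Fintype.sum_eq_single l] at happly
    · rw [map_smul, ← Module.End.mul_apply, ← pow_add, Nat.sub_add_cancel l.is_le] at happly
      exact (smul_eq_zero.1 happly).resolve_right hv
    · intro m hml
      rcases hml.lt_or_gt with hlt | hgt
      · rw [ih m hlt, zero_smul, map_zero]
      · rw [map_smul, ← Module.End.mul_apply, ← pow_add,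
          pow_eq_zero_of_le (by have := l.is_le; have := Fin.lt_def.1 hgt; omega) hJ,
          LinearMap.zero_apply, smul_zero]

lemma minpoly_eq_X_pow (hJ : J ^ (k + 1) = 0) (hJk : J ^ k ≠ 0) :
    minpoly K J = Polynomial.X ^ (k + 1) := by
  have hdvd : minpoly K J ∣ Polynomial.X ^ (k + 1) := by
    rw [minpoly.dvd_iff, map_pow, Polynomial.aeval_X, hJ]
  have hmonic : (minpoly K J).Monic := minpoly.monic ⟨_, Polynomial.monic_X_pow (k + 1), by
    rw [← Polynomial.aeval_def, map_pow, Polynomial.aeval_X, hJ]⟩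
  obtain ⟨i, hi, hassoc⟩ := (dvd_prime_pow Polynomial.prime_X (k + 1)).1 hdvd
  have heq := Polynomial.eq_of_monic_of_associated hmonic (Polynomial.monic_X_pow i) hassoc
  have hJi : J ^ i = 0 := by
    rw [← Polynomial.aeval_X (R := K) J, ← map_pow, ← heq, minpoly.aeval]
  have hki : ¬ i ≤ k := fun hik => hJk (pow_eq_zero_of_le hik hJi)
  rw [heq, show i = k + 1 by omega]

lemma ker_aeval_eq_span (hJ : J ^ (k + 1) = 0) (hJk : J ^ k ≠ 0) :
    RingHom.ker (Polynomial.aeval J : Polynomial K →ₐ[K] Module.End K F) =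
      Ideal.span {Polynomial.X ^ (k + 1)} := by
  rw [minpoly.ker_aeval_eq_span_minpoly, minpoly_eq_X_pow hJ hJk]

/-- Evaluation at `J`, as an isomorphism `K[T]/(T^{k+1}) ≃ K[J]`. -/
def evalEquiv (hJ : J ^ (k + 1) = 0) (hJk : J ^ k ≠ 0) :
    (Polynomial K ⧸ Ideal.span {(Polynomial.X : Polynomial K) ^ (k + 1)}) ≃ₐ[K]
      Algebra.adjoin K {J} :=
  (Ideal.quotientEquivAlgOfEq K (ker_aeval_eq_span hJ hJk).symm).trans
    ((Ideal.quotientKerEquivRange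
        (Polynomial.aeval J : Polynomial K →ₐ[K] Module.End K F)).trans
      (Subalgebra.equivOfEq _ _ (Algebra.adjoin_singleton_eq_range_aeval K J).symm))

lemma coe_evalEquiv_mk (hJ : J ^ (k + 1) = 0) (hJk : J ^ k ≠ 0) (P : Polynomial K) :
    (evalEquiv hJ hJk (Ideal.Quotient.mk _ P) : Module.End K F) = Polynomial.aeval J P := rfl

lemma exists_units_equiv (hJ : J ^ (k + 1) = 0) (hJk : J ^ k ≠ 0) :
    ∃ e : (Polynomial K ⧸ Ideal.span {(Polynomial.X : Polynomial K) ^ (k + 1)})ˣ ≃*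
        (Algebra.adjoin K {J})ˣ,
      ∀ (u : (Polynomial K ⧸ Ideal.span {(Polynomial.X : Polynomial K) ^ (k + 1)})ˣ)
        (P : Polynomial K),
        (u : Polynomial K ⧸ Ideal.span {(Polynomial.X : Polynomial K) ^ (k + 1)}) =
          Ideal.Quotient.mk _ P →
        ((e u : Algebra.adjoin K {J}) : Module.End K F) = Polynomial.aeval J P := by
  refine ⟨Units.mapEquiv (evalEquiv hJ hJk).toMulEquiv, fun u P hu => ?_⟩
  rw [← coe_evalEquiv_mk hJ hJk, ← hu]
  rfl

lemma exists_unit_of_eval_ne_zero (hJ : J ^ (k + 1) = 0) {P : Polynomial K} (hP : P.eval 0 ≠ 0) :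
    ∃ g : (Algebra.adjoin K {J})ˣ,
      Polynomial.aeval J P = ((g : Algebra.adjoin K {J}) : Module.End K F) := by
  have hcoprime : IsCoprime P (Polynomial.X ^ (k + 1)) := by
    refine ((Polynomial.irreducible_X.coprime_iff_not_dvd).2 fun hdvd => hP ?_).symm.pow_right
    rwa [Polynomial.X_dvd_iff, Polynomial.coeff_zero_eq_eval_zero] at hdvd
  obtain ⟨A, B, hAB⟩ := hcoprime
  have hinv : Polynomial.aeval J (A * P) = 1 := by
    rw [eq_sub_of_add_eq hAB, map_sub, map_one, map_mul, map_pow, Polynomial.aeval_X, hJ, mul_zero,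
      sub_zero]
  refine ⟨⟨⟨Polynomial.aeval J P, Polynomial.aeval_mem_adjoin_singleton K J⟩,
    ⟨Polynomial.aeval J A, Polynomial.aeval_mem_adjoin_singleton K J⟩,
    Subtype.ext ?_, Subtype.ext ?_⟩, rfl⟩
  · exact ((map_mul _ P A).symm.trans (congrArg _ (mul_comm P A))).trans hinv
  · exact (map_mul _ A P).symm.trans hinv

end Field

variable {F : Type*} [AddCommGroup F] [Module ℂ F] {k : ℕ} {J : Module.End ℂ F}

lemma exists_isAdapted (hF : Module.finrank ℂ F = k + 1) (hJ : IsNilpotent J) (hJk : J ^ k ≠ 0) :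
    ∃ f : Module.Basis (Fin (k + 1)) ℂ F, IsAdapted J f := by
  have hJ_pow := pow_eq_zero_of_isNilpotent hF hJ
  obtain ⟨v, hv⟩ := DFunLike.ne_iff.1 hJk
  let f (j : Fin (k + 1)) : F := ((j : ℕ).factorial : ℂ) • (J ^ ((Fin.rev j : Fin (k + 1)) : ℕ)) v
  have hf : LinearIndependent ℂ f :=
    linearIndependent_smul ((linearIndependent_pow_apply hJ_pow hv).comp _ Fin.rev_injective)
      fun j => Nat.cast_ne_zero.2 (j : ℕ).factorial_ne_zero
  refine ⟨basisOfLinearIndependentOfCardEqFinrank hf (by rw [Fintype.card_fin, hF]), fun j => ?_⟩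
  simp only [coe_basisOfLinearIndependentOfCardEqFinrank, f, map_smul]
  rw [← Module.End.mul_apply, ← pow_succ']
  rcases eq_or_ne j 0 with rfl | hj
  · rw [Fin.rev_zero, Fin.val_last, hJ_pow, LinearMap.zero_apply, smul_zero, Fin.val_zero,
      Nat.cast_zero, zero_smul]
  · have hj0 : (j : ℕ) ≠ 0 := Fin.val_ne_zero_iff.2 hj
    have hjk := j.is_le
    have hexp : (Fin.rev j : ℕ) + 1 = Fin.rev (j - 1) := by
      rw [Fin.val_rev, Fin.val_rev, Fin.val_sub_one_of_ne_zero hj]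
      omega
    rw [smul_smul, hexp, Fin.val_sub_one_of_ne_zero hj, ← Nat.cast_mul,
      Nat.mul_factorial_pred hj0]

end Nilpotent

section Transfer

variable {N k : ℕ} {F : Type*} [AddCommGroup F] [Module ℂ F] {J : Module.End ℂ F}

/-- The substitution of the vectors `f_j` of the copies of `F` for the variables. -/
def toSym (N : ℕ) (f : Module.Basis (Fin (k + 1)) ℂ F) : V N →ₐ[ℂ] SymCopies N F :=
  aeval fun v => copyVar N f v.1 v.2

/-- The basis of `F^{N+1}` formed by the vectors of `f` in each copy of `F`. -/
def copiesBasis (N : ℕ) (f : Module.Basis (Fin (k + 1)) ℂ F) :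
    Module.Basis (Fin (N + 1) × Fin (k + 1)) ℂ (Fin (N + 1) → F) :=
  (Pi.basis fun _ : Fin (N + 1) => f).reindex (Equiv.sigmaEquivProd _ _)

lemma copiesBasis_apply (f : Module.Basis (Fin (k + 1)) ℂ F) (v : Fin (N + 1) × Fin (k + 1)) :
    copiesBasis N f v = Pi.single v.1 (f v.2) := by
  rw [copiesBasis, Module.Basis.reindex_apply, Pi.basis_apply]
  rfl

lemma toSym_X (f : Module.Basis (Fin (k + 1)) ℂ F) (i : Fin (N + 1)) {j : ℕ} (hj : j < k + 1) :
    toSym N f (X (i, j)) =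
      SymmetricAlgebra.ι ℂ (Fin (N + 1) → F) (LinearMap.single ℂ (fun _ => F) i (f ⟨j, hj⟩)) := by
  rw [toSym, aeval_X, copyVar, LinearMap.single_apply]
  exact dif_pos hj

lemma toSym_rename (f : Module.Basis (Fin (k + 1)) ℂ F)
    (q : MvPolynomial (Fin (N + 1) × Fin (k + 1)) ℂ) :
    toSym N f (rename (Prod.map id Fin.val) q) =
      (SymmetricAlgebra.equivMvPolynomial (copiesBasis N f)).symm q := by
  have hcomp : (toSym N f).comp (rename (Prod.map id Fin.val)) =
      (SymmetricAlgebra.equivMvPolynomial (copiesBasis N f)).symm.toAlgHom := by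
    refine MvPolynomial.algHom_ext fun v => ?_
    rw [AlgHom.comp_apply, rename_X, AlgEquiv.toAlgHom_apply,
      SymmetricAlgebra.equivMvPolynomial_symm_X, copiesBasis_apply]
    exact toSym_X f v.1 v.2.2
  exact DFunLike.congr_fun hcomp q

lemma injOn_toSym (f : Module.Basis (Fin (k + 1)) ℂ F) :
    Set.InjOn (toSym N f) (orderLE N k) := by
  intro P hP Q hQ hPQ
  obtain ⟨p, rfl⟩ := mem_orderLE_iff_exists_rename.1 hP
  obtain ⟨q, rfl⟩ := mem_orderLE_iff_exists_rename.1 hQ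
  rw [toSym_rename, toSym_rename] at hPQ
  rw [(AlgEquiv.injective _) hPQ]

lemma exists_toSym_eq (f : Module.Basis (Fin (k + 1)) ℂ F) (v : SymCopies N F) :
    ∃ P ∈ orderLE N k, toSym N f P = v := by
  refine ⟨_, mem_orderLE_iff_exists_rename.2
    ⟨SymmetricAlgebra.equivMvPolynomial (copiesBasis N f) v, rfl⟩, ?_⟩
  rw [toSym_rename, AlgEquiv.symm_apply_apply]

lemma toSym_W (f : Module.Basis (Fin (k + 1)) ℂ F) (α : Fin (N + 1) → List ℕ) :
    toSym N f (W (fun i j => X (i, j)) α) = W (copyVar N f) α := by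
  rw [W_eq_colDet, W_eq_colDet]
  refine (map_colDet (toSym N f : V N →+* SymCopies N F) _ _ _).trans ?_
  simp only [toSym, RingHom.coe_coe, aeval_X]

lemma genFamily_copyVar (f : Module.Basis (Fin (k + 1)) ℂ F) (d : ℕ) :
    genFamily (copyVar N f) d = toSym N f '' G N d := by
  ext v
  constructor
  · rintro ⟨α, hα, rfl⟩
    exact ⟨_, ⟨α, hα, rfl⟩, toSym_W f α⟩
  · rintro ⟨_, ⟨α, hα, rfl⟩, rfl⟩
    exact ⟨α, hα, toSym_W f α⟩

lemma act_mem_orderLE (α : (PowerSeries ℂ)ˣ) {P : V N} (hP : P ∈ orderLE N k) :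
    act α P ∈ orderLE N k := by
  suffices hle : orderLE N k ≤ (orderLE N k).comap (act α) from hle hP
  refine Algebra.adjoin_le ?_
  rintro _ ⟨⟨i, m⟩, hm, rfl⟩
  change act α (X (i, m)) ∈ orderLE N k
  rw [act_X]
  refine sum_mem fun l _ => Subalgebra.smul_mem _ (Algebra.subset_adjoin ?_) _
  exact ⟨(i, m - l), (Nat.sub_le m l).trans hm, rfl⟩

section Adapted

variable {f : Module.Basis (Fin (k + 1)) ℂ F}

lemma IsAdapted.pow_apply (hf : IsAdapted J f) {j : ℕ} (hj : j < k + 1) (l : ℕ) :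
    (J ^ l) (f ⟨j, hj⟩) = (j.descFactorial l : ℂ) • f ⟨j - l, by omega⟩ := by
  induction l with
  | zero => rw [pow_zero, Module.End.one_apply, Nat.descFactorial_zero, Nat.cast_one, one_smul]; rfl
  | succ l ih =>
    rw [pow_succ', Module.End.mul_apply, ih, map_smul, hf, smul_smul, Nat.descFactorial_succ,
      mul_comm, Nat.cast_mul]
    rcases Nat.eq_zero_or_pos (j - l) with hjl | hjl
    · simp only [hjl, Nat.cast_zero, zero_mul, zero_smul]
    · congr 2
      refine Fin.ext ?_
      rw [Fin.val_sub_one_of_ne_zero fun h => hjl.ne' (congrArg Fin.val h)]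
      exact (Nat.sub_add_eq j l 1).symm

lemma IsAdapted.pow_eq_zero (hf : IsAdapted J f) : J ^ (k + 1) = 0 := by
  refine f.ext fun j => ?_
  rw [hf.pow_apply j.2, Nat.descFactorial_eq_zero_iff_lt.2 j.2, Nat.cast_zero, zero_smul,
    LinearMap.zero_apply]

lemma IsAdapted.aeval_apply (hf : IsAdapted J f) (P : Polynomial ℂ) {j : ℕ} (hj : j < k + 1) :
    Polynomial.aeval J P (f ⟨j, hj⟩) =
      ∑ l ∈ Finset.range (j + 1),
        ((j.descFactorial l : ℂ) * P.coeff l) • f ⟨j - l, by omega⟩ := by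
  rw [Polynomial.aeval_eq_sum_range' (n := max (P.natDegree + 1) (j + 1)) (by omega),
    LinearMap.sum_apply]
  simp only [LinearMap.smul_apply, hf.pow_apply hj, smul_smul, mul_comm (P.coeff _)]
  refine (Finset.sum_subset (Finset.range_mono (le_max_right _ _)) fun l _ hl => ?_).symm
  rw [Finset.mem_range, not_lt] at hl
  rw [Nat.descFactorial_eq_zero_iff_lt.2 hl, Nat.cast_zero, zero_mul, zero_smul]

lemma symAct_ι_single (g : Module.End ℂ F) (i : Fin (N + 1)) (u : F) :
    symAct N g (SymmetricAlgebra.ι ℂ (Fin (N + 1) → F) (LinearMap.single ℂ (fun _ => F) i u)) =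
      SymmetricAlgebra.ι ℂ (Fin (N + 1) → F) (LinearMap.single ℂ (fun _ => F) i (g u)) := by
  rw [symAct, SymmetricAlgebra.lift_ι_apply, LinearMap.comp_apply]
  congr 1
  exact funext fun i' => LinearMap.apply_single (fun _ => g) i i' u

lemma symAct_toSym (hf : IsAdapted J f) {P : Polynomial ℂ} {α : (PowerSeries ℂ)ˣ}
    (hα : ∀ l ≤ k, PowerSeries.coeff l (α : PowerSeries ℂ) = P.coeff l) {Q : V N}
    (hQ : Q ∈ orderLE N k) :
    symAct N (Polynomial.aeval J P) (toSym N f Q) = toSym N f (act α Q) := by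
  obtain ⟨q, rfl⟩ := mem_orderLE_iff_exists_rename.1 hQ
  suffices hcomp : ((symAct N (Polynomial.aeval J P)).comp (toSym N f)).comp
      (rename (Prod.map id Fin.val)) =
      ((toSym N f).comp (act α)).comp
        (rename (Prod.map id Fin.val : Fin (N + 1) × Fin (k + 1) → _)) from
    DFunLike.congr_fun hcomp q
  refine MvPolynomial.algHom_ext fun ⟨i, j, hj⟩ => ?_
  simp only [AlgHom.comp_apply, rename_X, Prod.map_apply, id]
  rw [toSym_X f i hj, symAct_ι_single, hf.aeval_apply, act_X, map_sum, map_sum, map_sum]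
  refine Finset.sum_congr rfl fun l hl => ?_
  rw [map_smul, map_smul, map_smul, toSym_X f i (by omega),
    hα l (by rw [Finset.mem_range] at hl; omega)]

lemma eval_zero_ne_zero_of_unit (hf : IsAdapted J f) {g : (Algebra.adjoin ℂ {J})ˣ}
    {P : Polynomial ℂ}
    (hg : Polynomial.aeval J P = ((g : Algebra.adjoin ℂ {J}) : Module.End ℂ F)) :
    P.eval 0 ≠ 0 := by
  intro hP
  have happly : Polynomial.aeval J P (f 0) = 0 := by
    refine (hf.aeval_apply P k.succ_pos).trans ?_
    rw [Finset.sum_range_one, Polynomial.coeff_zero_eq_eval_zero, hP, mul_zero, zero_smul]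
  have hinv : (((g⁻¹ : (Algebra.adjoin ℂ {J})ˣ) : Algebra.adjoin ℂ {J}) : Module.End ℂ F) *
      Polynomial.aeval J P = 1 := by
    rw [hg]
    exact congrArg Subtype.val (Units.inv_mul g)
  refine f.ne_zero 0 ?_
  rw [← Module.End.one_apply (R := ℂ) (f 0), ← hinv, Module.End.mul_apply, happly, map_zero]

lemma toSym_mem_quasiInv_iff (hf : IsAdapted J f) {d : ℕ} {Q : V N} (hQ : Q ∈ orderLE N k) :
    toSym N f Q ∈ quasiInv N J d ↔ Q ∈ diffHom N d := by
  constructor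
  · intro h α
    let P : Polynomial ℂ := PowerSeries.trunc (k + 1) (α : PowerSeries ℂ)
    have hP : ∀ l ≤ k, PowerSeries.coeff l (α : PowerSeries ℂ) = P.coeff l := fun l hl => by
      rw [PowerSeries.coeff_trunc, if_pos (by omega)]
    have hP0 : P.eval 0 = PowerSeries.constantCoeff (α : PowerSeries ℂ) := by
      rw [← Polynomial.coeff_zero_eq_eval_zero, ← hP 0 (Nat.zero_le k),
        PowerSeries.coeff_zero_eq_constantCoeff_apply]
    obtain ⟨g, hg⟩ := exists_unit_of_eval_ne_zero hf.pow_eq_zero (P := P) (by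
      rw [hP0]
      exact (PowerSeries.isUnit_constantCoeff _ α.isUnit).ne_zero)
    have hact := h g P hg
    rw [← hg, symAct_toSym hf hP hQ, hP0, ← map_smul] at hact
    exact injOn_toSym f (act_mem_orderLE α hQ) (Subalgebra.smul_mem _ hQ _) hact
  · intro h g P hg
    have hP0 := eval_zero_ne_zero_of_unit hf hg
    have hcoeff : PowerSeries.constantCoeff (P : PowerSeries ℂ) = P.eval 0 := by
      rw [← PowerSeries.coeff_zero_eq_constantCoeff_apply, Polynomial.coeff_coe,
        Polynomial.coeff_zero_eq_eval_zero]
    obtain ⟨α, hα⟩ : IsUnit (P : PowerSeries ℂ) := by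
      rw [PowerSeries.isUnit_iff_constantCoeff, hcoeff]
      exact hP0.isUnit
    rw [← hg, symAct_toSym hf (α := α) (fun l _ => by rw [hα, Polynomial.coeff_coe]) hQ, h α,
      map_smul, hα, hcoeff]

lemma quasiInvAlg_eq_map (hf : IsAdapted J f) :
    quasiInvAlg N J = (diffAlgLE N k).map (toSym N f) := by
  refine le_antisymm ?_ ?_
  · rintro _ ⟨x, rfl⟩
    induction x using DirectSum.induction_on with
    | zero => exact (map_zero (DirectSum.coeAlgHom (quasiInv N J))).symm ▸ zero_mem _
    | of i p =>
      change DirectSum.coeAlgHom (quasiInv N J) (DirectSum.of _ i p) ∈ _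
      rw [DirectSum.coeAlgHom_of]
      obtain ⟨P, hP, hPv⟩ := exists_toSym_eq f (p : SymCopies N F)
      have hP_inv : toSym N f P ∈ quasiInv N J i := hPv ▸ p.2
      exact ⟨P, ⟨mem_diffAlg_of_mem_diffHom ((toSym_mem_quasiInv_iff hf hP).1 hP_inv), hP⟩, hPv⟩
    | add x y hx hy =>
      change DirectSum.coeAlgHom (quasiInv N J) (x + y) ∈ _
      rw [map_add]
      exact add_mem hx hy
  · rintro _ ⟨P, hP, rfl⟩
    change toSym N f P ∈ _
    rw [← sum_homogeneousComponent P, map_sum]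
    refine sum_mem fun i _ => ?_
    exact ⟨DirectSum.of (fun i => quasiInv N J i) i
      ⟨_, (toSym_mem_quasiInv_iff hf (homogeneousComponent_mem_orderLE hP.2 i)).2
        (mem_diffAlg_iff.1 hP.1 i)⟩, DirectSum.coeAlgHom_of _ _ _⟩

lemma iUnion_G_subset (N k : ℕ) :
    (⋃ i ∈ Finset.Icc 1 (k + 1), G N i) ⊆ (orderLE N k : Set (V N)) := by
  intro P hP
  have hP_mem : P ∈ diffAlgLE N k := adjoin_G N k ▸ Algebra.subset_adjoin hP
  exact hP_mem.2

lemma iUnion_genFamily_copyVar (f : Module.Basis (Fin (k + 1)) ℂ F) :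
    (⋃ i ∈ Finset.Icc 1 (k + 1), genFamily (copyVar N f) i) =
      toSym N f '' ⋃ i ∈ Finset.Icc 1 (k + 1), G N i := by
  simp only [genFamily_copyVar, Set.image_iUnion]

theorem fg_quasiInvAlg (hf : IsAdapted J f) : (quasiInvAlg N J).FG := by
  rw [quasiInvAlg_eq_map hf]
  exact (fg_diffAlgLE N k).map _

theorem minimal_genFamily_copyVar (hf : IsAdapted J f) :
    Minimal (fun S : Set (SymCopies N F) => Algebra.adjoin ℂ S = quasiInvAlg N J)
      (⋃ i ∈ Finset.Icc 1 (k + 1), genFamily (copyVar N f) i) := by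
  rw [iUnion_genFamily_copyVar, quasiInvAlg_eq_map hf]
  refine ⟨?_, fun S hS hSle => ?_⟩
  · change Algebra.adjoin ℂ _ = _
    rw [← AlgHom.map_adjoin, adjoin_G]
  · obtain ⟨T, hT, rfl⟩ := Set.subset_image_iff.1 hSle
    refine Set.image_mono ((minimal_G N k).2 ?_ hT)
    have hmap : (Algebra.adjoin ℂ T).map (toSym N f) = (diffAlgLE N k).map (toSym N f) :=
      (AlgHom.map_adjoin _ T).trans hS
    have hTle : Algebra.adjoin ℂ T ≤ orderLE N k :=
      Algebra.adjoin_le (hT.trans (iUnion_G_subset N k))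
    have hset : toSym N f '' (Algebra.adjoin ℂ T : Set (V N)) =
        toSym N f '' (diffAlgLE N k : Set (V N)) := congrArg SetLike.coe hmap
    exact SetLike.coe_injective (((injOn_toSym f).image_eq_image_iff hTle
      (fun P hP => hP.2)).1 hset)

theorem encard_genFamily_copyVar (f : Module.Basis (Fin (k + 1)) ℂ F) {i : ℕ}
    (hi : i ∈ Finset.Icc 1 (k + 1)) :
    (genFamily (copyVar N f) i).encard = (numGen N i : ℕ∞) := by
  rw [genFamily_copyVar, Set.InjOn.encard_image, encard_G (Finset.mem_Icc.1 hi).1]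
  exact (injOn_toSym f).mono
    ((Set.subset_biUnion_of_mem (u := fun i => G N i) hi).trans (iUnion_G_subset N k))

theorem ne_zero_and_mem_quasiInv (hf : IsAdapted J f) {i : ℕ} (hi : i ∈ Finset.Icc 1 (k + 1))
    {v : SymCopies N F} (hv : v ∈ genFamily (copyVar N f) i) : v ≠ 0 ∧ v ∈ quasiInv N J i := by
  rw [genFamily_copyVar] at hv
  obtain ⟨P, hP, rfl⟩ := hv
  have hPk : P ∈ orderLE N k := iUnion_G_subset N k (Set.mem_biUnion hi hP)
  refine ⟨fun h0 => ?_, (toSym_mem_quasiInv_iff hf hPk).2 (mem_diffHom_of_mem_G hP)⟩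
  rw [← map_zero (toSym N f)] at h0
  exact ne_zero_of_mem_G (Finset.mem_Icc.1 hi).1 hP (injOn_toSym f hPk (zero_mem _) h0)

end Adapted

end Transfer

end DiffHom

end

theorem mainTheorem1 (N k : ℕ) :
    ((DiffHom.diffAlgLE N k).FG ∧
      Minimal (fun S : Set (DiffHom.V N) => Algebra.adjoin ℂ S = DiffHom.diffAlgLE N k)
        (⋃ i ∈ Finset.Icc 1 (k + 1), DiffHom.G N i) ∧
      ∀ i ∈ Finset.Icc 1 (k + 1),
        (DiffHom.G N i).encard = (DiffHom.numGen N i : ℕ∞) ∧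
        ∀ P ∈ DiffHom.G N i,
          P ∈ DiffHom.diffHom N i ∧ P.totalDegree = i ∧ DiffHom.order P = i - 1) ∧
    (∀ (F : Type*) [AddCommGroup F] [Module ℂ F] (J : Module.End ℂ F),
      Module.finrank ℂ F = k + 1 → IsNilpotent J → J ^ k ≠ 0 →
        (∃ e : (Polynomial ℂ ⧸ Ideal.span {(Polynomial.X : Polynomial ℂ) ^ (k + 1)})ˣ ≃*
            (Algebra.adjoin ℂ {J})ˣ,
          ∀ (u : (Polynomial ℂ ⧸ Ideal.span {(Polynomial.X : Polynomial ℂ) ^ (k + 1)})ˣ)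
            (P : Polynomial ℂ),
            (u : Polynomial ℂ ⧸ Ideal.span {(Polynomial.X : Polynomial ℂ) ^ (k + 1)}) =
              Ideal.Quotient.mk _ P →
            ((e u : Algebra.adjoin ℂ {J}) : Module.End ℂ F) = Polynomial.aeval J P) ∧
        (∃ f : Module.Basis (Fin (k + 1)) ℂ F, DiffHom.IsAdapted J f) ∧
        ∀ f : Module.Basis (Fin (k + 1)) ℂ F, DiffHom.IsAdapted J f →
          (DiffHom.quasiInvAlg N J).FG ∧
          Minimal
            (fun S : Set (DiffHom.SymCopies N F) =>
              Algebra.adjoin ℂ S = DiffHom.quasiInvAlg N J)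
            (⋃ i ∈ Finset.Icc 1 (k + 1), DiffHom.genFamily (DiffHom.copyVar N f) i) ∧
          ∀ i ∈ Finset.Icc 1 (k + 1),
            (DiffHom.genFamily (DiffHom.copyVar N f) i).encard = (DiffHom.numGen N i : ℕ∞) ∧
            ∀ v ∈ DiffHom.genFamily (DiffHom.copyVar N f) i,
              v ≠ 0 ∧ v ∈ DiffHom.quasiInv N J i) := by
  refine ⟨⟨DiffHom.fg_diffAlgLE N k, DiffHom.minimal_G N k, fun i hi => ?_⟩,
    fun F _ _ J hF hJ hJk => ?_⟩
  · have hi_pos := (Finset.mem_Icc.1 hi).1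
    exact ⟨DiffHom.encard_G hi_pos, fun P hP => ⟨DiffHom.mem_diffHom_of_mem_G hP,
      DiffHom.totalDegree_of_mem_G hi_pos hP, DiffHom.order_of_mem_G hi_pos hP⟩⟩
  · have hJ_pow := DiffHom.pow_eq_zero_of_isNilpotent hF hJ
    exact ⟨DiffHom.exists_units_equiv hJ_pow hJk, DiffHom.exists_isAdapted hF hJ hJk, fun f hf =>
      ⟨DiffHom.fg_quasiInvAlg hf, DiffHom.minimal_genFamily_copyVar hf, fun i hi =>
        ⟨DiffHom.encard_genFamily_copyVar f hi, fun v hv =>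
          DiffHom.ne_zero_and_mem_quasiInv hf hi hv⟩⟩⟩
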